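/- **Setting.** Fix a universal self-delimiting (prefix) machine $U$ with a one-way input tape of bits: on input $1^e0p$ it runs the $e$-th machine on $p$. We write $U_y(p)=x$ if $U$, with $y$ on its auxiliary tape, outputs $x$ and halts after reading exactly the bits of $p$, and put $\mathbf m(x/y)=\sum_{p:\,U_y(p)=x}2^{-|p|}$. *Relativized to $C$* means that an encoding of the elementary object $C$ is in addition provided to $U$ on an auxiliary tape in every computation below. A vector or matrix is *elementary* if the real and imaginary parts of its entries are rational; elementary objects are encoded by strings. Let $\mathcal Q_n=(\mathbb C^2)^{\otimes n}$ be the $n$-qubit space; pure states are unit vectors. The universal matrix of $\mathcal Q_n$ is $\boldsymbol\mu=\sum_{|\theta\rangle}\mathbf m(|\theta\rangle/n)\,|\theta\rangle\langle\theta|$, the sum over the elementary pure states of $\mathcal Q_n$. A program $q\in\{0,1\}^*$ *lower computes* a positive semidefinite matrix $\sigma$ if, on input $q$, $U$ reads at most $|q|$ bits and outputs, with or without halting, a nonempty increasing (in the Loewner order) sequence of elementary positive semidefinite matrices with limit $\sigma$ (for a finite sequence, the last entry). Put $\underline{\mathbf m}(\sigma/n)=\sum\{\mathbf m(q/n): q\text{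 lower computes }\sigma\}$. Let $\mathcal C$ be the set of all lower computable matrices on $\mathcal Q_n\otimes\mathcal Q_n$ of the form $A\otimes B$, with $A,B$ positive semidefinite, such that $\operatorname{Tr}\,(A\otimes B)(\boldsymbol\mu\otimes\boldsymbol\mu)\le 1$, and let $\mathfrak C=\sum_{M\in\mathcal C}\underline{\mathbf m}(M/n)\,M$. The algorithmic mutual information of semi-density matrices $\sigma,\rho$ on $\mathcal Q_n$ is $\mathbf I(\sigma:\rho)=\log_2\operatorname{Tr}\,\mathfrak C(\sigma\otimes\rho)$, and for pure states $\mathbf I(|\phi\rangle:|\varphi\rangle)=\mathbf I(|\phi\rangle\langle\phi|:|\varphi\rangle\langle\varphi|)$. **Theorem (algorithmic no-cloning).** There is a constant $c$, depending only on $U$, such that for all $n$, every elementary unitary $C$ on $\mathcal Q_n\otimes\mathcal Q_n$, and all (not necessarily elementary) pure states $|\psi\rangle,|\phi\rangle,|\varphi\rangle\in\mathcal Q_n$ with $C|\psi\rangle|0^n\rangle=|\phi\rangle|\varphi\rangle$, relativized to $C$, $$\mathbf I(|\phi\rangle:|\varphi\rangle)<\mathbf I(|\psi\rangle:|\psi\rangle)+c.$$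 -/

import Mathlib

open scoped ENNReal Topology Kronecker ComplexOrder

namespace QAIT

/-! ### A universal self-delimiting machine -/

/-- What a machine with a one-way read-only input tape does next: halt; read one input bit and
enter `s₀` or `s₁` according to its value; or append the item `x` to its output and enter `s`.
Output items are natural numbers, which encode strings and elementary objects. -/
inductive Action (S : Type) : Type
  | halt : Action S
  | read (s₀ s₁ : S) : Action S
  | emit (x : ℕ) (s : S) : Action S

/-- Relabelling of states in an action. -/
def Action.map {S T : Type} (f : S → T) : Action S → Action T
  | .halt => .halt
  | .read s₀ s₁ => .read (f s₀) (f s₁)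
  | .emit x s => .emit x (f s)

/-- The numbering of the actions over the state space `ℕ`. -/
def decodeAction (k : ℕ) : Action ℕ :=
  match Denumerable.ofNat (Option ((ℕ × ℕ) ⊕ (ℕ × ℕ))) k with
  | none => .halt
  | some (Sum.inl (s₀, s₁)) => .read s₀ s₁
  | some (Sum.inr (x, s)) => .emit x s

/-- The next action of the `e`-th machine in state `s`, with contents `z` and `y` of its two
auxiliary tapes: it is computed by the `e`-th partial recursive function, and it is undefined
if that computation diverges (the machine then runs forever without any further read or output). -/
def machineStep (e z y s : ℕ) : Part (Action ℕ) :=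
  ((Denumerable.ofNat Nat.Partrec.Code e).eval (Nat.pair z (Nat.pair y s))).map decodeAction

/-- States of the universal machine: reading the unary index of a machine, or simulating it. -/
inductive UState : Type
  | index (k : ℕ) : UState
  | run (e s : ℕ) : UState

/-- The universal machine `U`: on the input `1ᵉ0p` it runs the `e`-th machine on `p`. The first
auxiliary tape holds the object `z` to which `U` is relativized, the second the condition `y`. -/
def ustep (z y : ℕ) : UState → Part (Action UState)
  | .index k => Part.some (.read (.run k 0) (.index (k + 1)))
  | .run e s => (machineStep e z y s).map (Action.map (UState.run e))

/-- `Reach z y r w s`: at some time in a run of `U` exactly the bits `r` have been read, exactly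
the items `w` have been output, and the state is `s`. -/
inductive Reach (z y : ℕ) : List Bool → List ℕ → UState → Prop
  | start : Reach z y [] [] (.index 0)
  | read {r : List Bool} {w : List ℕ} {s s₀ s₁ : UState} (b : Bool) :
      Reach z y r w s → Action.read s₀ s₁ ∈ ustep z y s →
        Reach z y (r ++ [b]) w (if b then s₁ else s₀)
  | emit {r : List Bool} {w : List ℕ} {s s' : UState} {x : ℕ} :
      Reach z y r w s → Action.emit x s' ∈ ustep z y s → Reach z y r (w ++ [x]) s'

/-- `U(p) = x`: the machine halts after reading exactly the bits of `p`, having output `x`. -/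
def Outputs (z y : ℕ) (p : List Bool) (x : ℕ) : Prop :=
  ∃ s, Reach z y p [x] s ∧ Action.halt ∈ ustep z y s

/-- `x` is the `i`-th item that `U` outputs on the input tape `q`. -/
def Emits (z y : ℕ) (q : List Bool) (i x : ℕ) : Prop :=
  ∃ r w s, r <+: q ∧ Reach z y r w s ∧ w[i]? = some x

/-- `U` never tries to read more than the bits of `q`. -/
def ReadsWithin (z y : ℕ) (q : List Bool) : Prop :=
  ¬ ∃ w s s₀ s₁, Reach z y q w s ∧ Action.read s₀ s₁ ∈ ustep z y s

open scoped Classical in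
/-- The universal probability `𝐦(x/y)` of `x` given `y`, with `U` relativized to `z`. -/
noncomputable def uprob (z x y : ℕ) : ℝ≥0∞ :=
  ∑' p : List Bool, if Outputs z y p x then (2⁻¹ : ℝ≥0∞) ^ p.length else 0

/-! ### Elementary vectors and matrices and their codes -/

/-- Complex numbers with rational real and imaginary parts. -/
@[ext] structure GaussRat : Type where
  re : ℚ
  im : ℚ

/-- The complex number. -/
noncomputable def GaussRat.toComplex (a : GaussRat) : ℂ := ⟨(a.re : ℝ), (a.im : ℝ)⟩

/-- The code of a rational number: numerator and denominator in lowest terms. -/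
def ratCode (a : ℚ) : ℕ := Nat.pair (Encodable.encode a.num) a.den

/-- The code of a complex number with rational parts. -/
def GaussRat.code (a : GaussRat) : ℕ := Nat.pair (ratCode a.re) (ratCode a.im)

/-- The code of an elementary vector: the list of its entries. -/
def vecCode {d : ℕ} (v : Fin d → GaussRat) : ℕ :=
  Encodable.encode (List.ofFn fun i => (v i).code)

/-- The code of an elementary matrix: the list of its rows. -/
def matCode {d : ℕ} (M : Matrix (Fin d) (Fin d) GaussRat) : ℕ :=
  Encodable.encode (List.ofFn fun i => vecCode (M i))

/-- The complex matrix given by an elementary matrix. -/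
noncomputable def toComplexMat {ι : Type} (M : Matrix ι ι GaussRat) : Matrix ι ι ℂ :=
  M.map GaussRat.toComplex

/-- The usual identification of `d × d` blocks of size `d × d` with a `d² × d²` matrix. -/
def flat {d : ℕ} {R : Type} (M : Matrix (Fin d × Fin d) (Fin d × Fin d) R) :
    Matrix (Fin (d * d)) (Fin (d * d)) R :=
  Matrix.reindex finProdFinEquiv finProdFinEquiv M

/-- The space of `n` qubits, with basis `|x⟩`, `x` a bit string of length `n` read as a number. -/
abbrev Qubits (n : ℕ) : Type := EuclideanSpace ℂ (Fin (2 ^ n))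

/-- The basis state `|0ⁿ⟩`. -/
noncomputable def ketZero (n : ℕ) : Qubits n :=
  EuclideanSpace.single (⟨0, Nat.two_pow_pos n⟩ : Fin (2 ^ n)) 1

/-- The product vector `|φ⟩|χ⟩`. -/
noncomputable def tensor {n : ℕ} (φ χ : Qubits n) : Fin (2 ^ n) × Fin (2 ^ n) → ℂ :=
  fun i => φ i.1 * χ i.2

/-- The matrix `|φ⟩⟨φ|`. -/
noncomputable def ketBra {n : ℕ} (φ : Qubits n) : Matrix (Fin (2 ^ n)) (Fin (2 ^ n)) ℂ :=
  Matrix.of fun i j => φ i * star (φ j)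

/-- Elementary pure states of `n` qubits. -/
def ElemState (n : ℕ) : Type :=
  {v : Fin (2 ^ n) → GaussRat // ‖(WithLp.toLp 2 fun i => (v i).toComplex : Qubits n)‖ = 1}

/-- The vector of an elementary pure state. -/
noncomputable def ElemState.ket {n : ℕ} (v : ElemState n) : Qubits n :=
  WithLp.toLp 2 fun i => (v.1 i).toComplex

/-! ### Universal matrix, lower computability, information -/

/-- The universal semi-density matrix `𝛍` of `n` qubits, with `U` relativized to `z`: the sum of
`𝐦(|φ⟩/n) |φ⟩⟨φ|` over the elementary pure states. -/
noncomputable def univMatrix (z n : ℕ) : Matrix (Fin (2 ^ n)) (Fin (2 ^ n)) ℂ :=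
  ∑' v : ElemState n, (((uprob z (vecCode v.1) n).toReal : ℝ) : ℂ) • ketBra v.ket

/-- The program `q` lower computes `σ` (with `U` relativized to `z`): reading at most the bits of
`q`, `U` outputs, with or without halting, a finite or infinite nonempty increasing sequence of
elementary positive semidefinite matrices whose limit is `σ`. A finite output sequence is
continued by its last entry. -/
def LowerComputes {d : ℕ} (z : ℕ) (q : List Bool) (σ : Matrix (Fin d) (Fin d) ℂ) : Prop :=
  ReadsWithin z 0 q ∧
  ∃ a : ℕ → Matrix (Fin d) (Fin d) GaussRat,
    (∃ x, Emits z 0 q 0 x) ∧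
    (∀ i x, Emits z 0 q i x → x = matCode (a i)) ∧
    (∀ i, (¬ ∃ x, Emits z 0 q (i + 1) x) → a (i + 1) = a i) ∧
    (∀ i, (toComplexMat (a i)).PosSemidef) ∧
    (∀ i, (toComplexMat (a (i + 1)) - toComplexMat (a i)).PosSemidef) ∧
    Filter.Tendsto (fun i => toComplexMat (a i)) Filter.atTop (𝓝 σ)

open scoped Classical in
/-- The lower algorithmic probability of `σ` given `y`: the sum of `𝐦(q/y)` over the programs `q`
that lower compute `σ`. -/
noncomputable def lowerProb {d : ℕ} (z : ℕ) (σ : Matrix (Fin d) (Fin d) ℂ) (y : ℕ) : ℝ≥0∞ :=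
  ∑' q : List Bool, if LowerComputes z q σ then uprob z (Encodable.encode q) y else 0

/-- The product tests: lower computable matrices of the form `A ⊗ B` with
`Tr (A ⊗ B)(𝛍 ⊗ 𝛍) ≤ 1`. -/
def productTests (z n : ℕ) :
    Set (Matrix (Fin (2 ^ n) × Fin (2 ^ n)) (Fin (2 ^ n) × Fin (2 ^ n)) ℂ) :=
  {M | (∃ A B : Matrix (Fin (2 ^ n)) (Fin (2 ^ n)) ℂ,
          A.PosSemidef ∧ B.PosSemidef ∧ M = A ⊗ₖ B) ∧
       (∃ q, LowerComputes z q (flat M)) ∧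
       (M * (univMatrix z n ⊗ₖ univMatrix z n)).trace.re ≤ 1}

/-- `Tr ℭ(σ ⊗ ρ)`, where `ℭ` is the sum of the product tests `M`, each weighted by its lower
algorithmic probability given `n`. As the terms are nonnegative for positive semidefinite `σ`
and `ρ`, the trace is written termwise, with values in `[0, ∞]`. -/
noncomputable def testTrace (z n : ℕ) (σ ρ : Matrix (Fin (2 ^ n)) (Fin (2 ^ n)) ℂ) : ℝ≥0∞ :=
  ∑' M : productTests z n,
    lowerProb z (flat M.1) n * ENNReal.ofReal (M.1 * (σ ⊗ₖ ρ)).trace.re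

/-- The algorithmic mutual information `𝐈(σ : ρ) = log₂ Tr ℭ(σ ⊗ ρ)`, with `U` relativized
to `z`, as an extended real number. -/
noncomputable def mutualInfo (z n : ℕ) (σ ρ : Matrix (Fin (2 ^ n)) (Fin (2 ^ n)) ℂ) : EReal :=
  ENNReal.log (testTrace z n σ ρ) / ((Real.log 2 : ℝ) : EReal)

/-! ### The machine is self-delimiting, codes are injective, and the series for `𝛍` converges -/

/-- Configurations: bits read, items output, state. -/
inductive Next (z y : ℕ) : (List Bool × List ℕ × UState) → (List Bool × List ℕ × UState) → Prop
  | read {r w s s₀ s₁} (b : Bool) : Action.read s₀ s₁ ∈ ustep z y s →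
      Next z y (r, w, s) (r ++ [b], w, if b then s₁ else s₀)
  | emit {r w s s' x} : Action.emit x s' ∈ ustep z y s → Next z y (r, w, s) (r, w ++ [x], s')

theorem next_prefix {z y a b} (h : Next z y a b) : a.1 <+: b.1 := by
  cases h <;> simp

theorem steps_prefix {z y a b} (h : Relation.ReflTransGen (Next z y) a b) : a.1 <+: b.1 := by
  induction h with
  | refl => exact List.prefix_rfl
  | tail _ h ih => exact ih.trans (next_prefix h)

theorem reach_steps {z y r w s} (h : Reach z y r w s) :
    Relation.ReflTransGen (Next z y) ([], [], .index 0) (r, w, s) := by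
  induction h with
  | start => exact .refl
  | read b _ h ih => exact ih.tail (.read b h)
  | emit _ h ih => exact ih.tail (.emit h)

theorem step_det {z y a b c} (h : Next z y a b) (h' : Next z y a c) {t : List Bool}
    (hb : b.1 <+: t) (hc : c.1 <+: t) : b = c := by
  cases h with
  | read b h =>
    cases h' with
    | read b' h' =>
      have := Part.mem_unique h h'
      simp only [Action.read.injEq] at this
      have h2 := List.prefix_or_prefix_of_prefix hb hc
      simp only [List.prefix_append_right_inj] at h2
      have : b = b' := by rcases h2 with h2 | h2 <;> simpa [eq_comm] using h2
      simp_all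
    | emit h' => cases Part.mem_unique h h'
  | emit h =>
    cases h' with
    | read b' h' => cases Part.mem_unique h h'
    | emit h' =>
      have := Part.mem_unique h h'
      simp only [Action.emit.injEq] at this
      simp_all

theorem step_halt {z y a b} (h : Action.halt ∈ ustep z y a.2.2) (h' : Next z y a b) : False := by
  cases h' with
  | read b h' => cases Part.mem_unique h h'
  | emit h' => cases Part.mem_unique h h'

theorem steps_halt {z y a b c} (hb : Relation.ReflTransGen (Next z y) a b)
    (hc : Relation.ReflTransGen (Next z y) a c) (hh : Action.halt ∈ ustep z y c.2.2)
    (hp : b.1 <+: c.1) : Relation.ReflTransGen (Next z y) b c := by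
  induction hb with
  | refl => exact hc
  | @tail d e hd hde ih =>
    have := ih ((next_prefix hde).trans hp)
    rcases this.cases_head with rfl | ⟨f, hf, hfc⟩
    · exact (step_halt hh hde).elim
    · rwa [step_det hde hf hp (steps_prefix hfc)]

/-- The domain of `U` is prefix-free and its output is unique. -/
theorem outputs_unique {z y p p' x x'} (h : Outputs z y p x) (h' : Outputs z y p' x')
    (hp : p <+: p') : p = p' ∧ x = x' := by
  obtain ⟨s, h, hs⟩ := h
  obtain ⟨s', h', hs'⟩ := h'
  have := steps_halt (reach_steps h) (reach_steps h') hs' hp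
  rcases this.cases_head with h | ⟨f, hf, _⟩
  · simpa using (⟨congrArg Prod.fst h, by simpa using congrArg (fun t => t.2.1) h⟩ : p = p' ∧ x = x')
  · exact (step_halt hs hf).elim

theorem reach_nil {z y w s} (h : Reach z y [] w s) : w = [] ∧ s = .index 0 := by
  generalize hr : ([] : List Bool) = r at h
  induction h with
  | start => simp
  | read b _ _ _ => simp at hr
  | emit _ h ih =>
    obtain ⟨rfl, rfl⟩ := ih hr
    simp [ustep] at h

theorem outputs_ne_nil {z y p x} (h : Outputs z y p x) : p ≠ [] := by
  rintro rfl
  obtain ⟨s, h, _⟩ := h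
  simpa using (reach_nil h).1

theorem uniquelyDecodable_programs {z y} (S : Set (List Bool)) (hS : ∀ p ∈ S, ∃ x, Outputs z y p x) :
    InformationTheory.UniquelyDecodable S := by
  intro L₁
  induction L₁ with
  | nil =>
    intro L₂ _ h2 h
    cases L₂ with
    | nil => rfl
    | cons q L =>
      obtain ⟨x, hx⟩ := hS q (h2 q (by simp))
      have := outputs_ne_nil hx
      simp_all
  | cons p L ih =>
    intro L₂ h1 h2 h
    obtain ⟨x, hx⟩ := hS p (h1 p (by simp))
    cases L₂ with
    | nil =>
      have := outputs_ne_nil hx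
      simp_all
    | cons q L' =>
      obtain ⟨x', hx'⟩ := hS q (h2 q (by simp))
      simp only [List.flatten_cons] at h
      have : p = q := by
        rcases List.prefix_or_prefix_of_prefix (l₃ := p ++ L.flatten) (List.prefix_append p _)
          (h ▸ List.prefix_append q _) with hh | hh
        · exact (outputs_unique hx hx' hh).1
        · exact (outputs_unique hx' hx hh).1.symm
      subst this
      rw [ih L' (fun w hw => h1 w (by simp [hw])) (fun w hw => h2 w (by simp [hw]))
        (List.append_cancel_left h)]

/-- The universal probabilities sum to at most `1`. -/
theorem uprob_sum_le_one (z y : ℕ) : ∑' x, uprob z x y ≤ 1 := by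
  classical
  unfold uprob
  rw [ENNReal.tsum_comm]
  have key : ∀ p : List Bool, (∑' x, if Outputs z y p x then (2⁻¹ : ℝ≥0∞) ^ p.length else 0)
      = if ∃ x, Outputs z y p x then (2⁻¹ : ℝ≥0∞) ^ p.length else 0 := by
    intro p
    split_ifs with h
    · obtain ⟨x, hx⟩ := h
      rw [tsum_eq_single x, if_pos hx]
      intro x' hx'
      rw [if_neg]
      intro h'
      exact hx' (outputs_unique h' hx List.prefix_rfl).2
    · push Not at h
      simp [h]
  simp_rw [key]
  rw [ENNReal.tsum_eq_iSup_sum]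
  refine iSup_le fun S => ?_
  rw [← Finset.sum_filter]
  have := InformationTheory.kraft_mcmillan_inequality
    (S := S.filter fun p => ∃ x, Outputs z y p x) (uniquelyDecodable_programs (z := z) (y := y) _ (by simp))
  have h2 := ENNReal.ofReal_le_ofReal this
  rw [ENNReal.ofReal_sum_of_nonneg (fun _ _ => by positivity), ENNReal.ofReal_one] at h2
  refine le_trans (le_of_eq (Finset.sum_congr rfl fun p _ => ?_)) h2
  rw [ENNReal.ofReal_pow (by positivity)]
  congr 1
  rw [Fintype.card_bool, one_div, ENNReal.ofReal_inv_of_pos (by norm_num)]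
  norm_num

theorem ratCode_inj : Function.Injective ratCode := by
  intro a b h
  have := Nat.pair_eq_pair.1 h
  exact Rat.ext (Encodable.encode_injective this.1) this.2

theorem code_inj : Function.Injective GaussRat.code := by
  intro a b h
  have := Nat.pair_eq_pair.1 h
  exact GaussRat.ext (ratCode_inj this.1) (ratCode_inj this.2)

theorem vecCode_inj {d : ℕ} : Function.Injective (vecCode (d := d)) := by
  intro v w h
  have := List.ofFn_injective (Encodable.encode_injective h)
  funext i
  exact code_inj (congrFun this i)

theorem matCode_inj {d : ℕ} : Function.Injective (matCode (d := d)) := by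
  intro v w h
  have := List.ofFn_injective (Encodable.encode_injective h)
  funext i
  exact vecCode_inj (congrFun this i)

/-- The series that defines `𝛍` converges. -/
theorem summable_univMatrix (z n : ℕ) : Summable fun v : ElemState n =>
    (((uprob z (vecCode v.1) n).toReal : ℝ) : ℂ) • ketBra v.ket := by
  have hs : ∑' v : ElemState n, uprob z (vecCode v.1) n ≤ 1 :=
    le_trans (ENNReal.tsum_comp_le_tsum_of_injective (f := fun v : ElemState n => vecCode v.1)
      (fun a b h => Subtype.ext (vecCode_inj h)) (fun x => uprob z x n)) (uprob_sum_le_one z n)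
  have h1 : Summable fun v : ElemState n => (uprob z (vecCode v.1) n).toReal :=
    ENNReal.summable_toReal (ne_top_of_le_ne_top ENNReal.one_ne_top hs)
  refine Pi.summable.2 fun i => Pi.summable.2 fun j => ?_
  refine Summable.of_norm_bounded h1 fun v => ?_
  have hb : ∀ i, ‖v.ket i‖ ≤ 1 := fun i => (EuclideanSpace.norm_eq v.ket ▸ PiLp.norm_apply_le v.ket i).trans
    (by rw [← EuclideanSpace.norm_eq]; exact v.2.le)
  simp only [Matrix.smul_apply, ketBra, Matrix.of_apply, smul_eq_mul, norm_mul, norm_star,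
    Complex.norm_real, Real.norm_eq_abs, abs_of_nonneg ENNReal.toReal_nonneg]
  exact mul_le_of_le_one_right ENNReal.toReal_nonneg (mul_le_one₀ (hb i) (norm_nonneg _) (hb j))

end QAIT

/-! Feeding a state and the ancilla `|0ⁿ⟩` to `C` and dropping one output register is a quantum
channel. Its adjoint pulls a matrix `A` on the kept register back to `A' = ∑ⱼ Kⱼ* A Kⱼ`; the channel
that keeps the other register pulls `B` back to `B'`. Because `C|ψ⟩|0ⁿ⟩` is the product `|φ⟩|χ⟩`,
one has `⟨ψ|A'|ψ⟩ = ⟨φ|A|φ⟩` and `⟨ψ|B'|ψ⟩ = ⟨χ|B|χ⟩` (`qf_krausPullBack_true`,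
`qf_krausPullBack_false`). So `A' ⊗ B'` takes on two copies of `ψ` the value that `A ⊗ B` takes on
`φ ⊗ χ`. It remains to see that `A' ⊗ B'`, scaled by a constant, is again a product test, and that
its weight is not much smaller.

The weight: the pull back is linear, preserves the Loewner order and is computable from `C`, so a
program `q` for `A ⊗ B` becomes the program `1ᵉ0q` for the pulled back test
(`exists_lowerComputes_pullBack`). This costs a constant factor of probability, and it is injective
on programs, so the sums over programs can be compared term by term (`exists_testTrace_le`).

The test condition: `Tr A'𝛍 ≤ K · Tr A𝛍`, that is, the channel image of `𝛍` is dominated by a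
multiple of `𝛍` (`exists_domination`). For an elementary state `θ` the image is a sum of projectors
of unnormalized elementary vectors, whose normalizations may be irrational. Four squares and a
quaternionic structure nevertheless bound this image by `4` times a uniform mixture of `2 ^ m`
elementary unit vectors (`exists_unit_pair`, `exists_uniform_mixture`). Such a mixture is recognized
by a rational identity, hence found by search. A program for `θ` followed by `m` random bits then
outputs a random vector of the list, which is the domination (`exists_uprob_sampler`).

Finally the trace at `ψ ⊗ ψ` is neither `0` nor `∞`, so the bound between traces becomes a strict
bound between logarithms. -/

namespace QAIT

/-! ### Computability of the universal machine's transition function. -/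

/-- Actions as a sum type. -/
def Action.equiv (S : Type) : Action S ≃ Option ((S × S) ⊕ (ℕ × S)) where
  toFun
    | .halt => none
    | .read s₀ s₁ => some (.inl (s₀, s₁))
    | .emit x s => some (.inr (x, s))
  invFun
    | none => .halt
    | some (.inl (s₀, s₁)) => .read s₀ s₁
    | some (.inr (x, s)) => .emit x s
  left_inv a := by cases a <;> rfl
  right_inv a := by rcases a with _ | ⟨_ | _⟩ <;> rfl

instance (S : Type) [Primcodable S] : Primcodable (Action S) := Primcodable.ofEquiv _ (Action.equiv S)

/-- States of the universal machine as a sum type. -/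
def UState.equiv : UState ≃ ℕ ⊕ (ℕ × ℕ) where
  toFun
    | .index k => .inl k
    | .run e s => .inr (e, s)
  invFun
    | .inl k => .index k
    | .inr (e, s) => .run e s
  left_inv a := by cases a <;> rfl
  right_inv a := by rcases a with _ | _ <;> rfl

instance : Primcodable UState := Primcodable.ofEquiv _ UState.equiv

theorem decodeAction_eq (k : ℕ) : decodeAction k =
    (Action.equiv ℕ).symm (Denumerable.ofNat (Option ((ℕ × ℕ) ⊕ (ℕ × ℕ))) k) := by
  unfold decodeAction
  rcases Denumerable.ofNat (Option ((ℕ × ℕ) ⊕ (ℕ × ℕ))) k with _ | ⟨_ | _⟩ <;> rfl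

/-- The encoding that `Action ℕ` inherits through `Action.equiv` is inverse to the fixed numbering,
so a machine can be specified by computing codes of actions. -/
theorem decodeAction_encode (a : Action ℕ) : decodeAction (Encodable.encode a) = a := by
  have : Encodable.encode a = Encodable.encode (Action.equiv ℕ a) := rfl
  rw [decodeAction_eq, this, Denumerable.ofNat_encode, Equiv.symm_apply_apply]

theorem primrec_actionEquiv {S : Type} [Primcodable S] : Primrec (Action.equiv S) :=
  Primrec.of_equiv

theorem primrec_actionEquiv_symm {S : Type} [Primcodable S] : Primrec (Action.equiv S).symm :=
  Primrec.of_equiv_symm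

theorem primrec_decodeAction : Primrec decodeAction :=
  (primrec_actionEquiv_symm.comp (Primrec.ofNat _)).of_eq fun k => (decodeAction_eq k).symm

theorem primrec_read {S : Type} [Primcodable S] : Primrec₂ (Action.read : S → S → Action S) :=
  primrec_actionEquiv_symm.comp (Primrec.option_some.comp Primrec.sumInl)

theorem primrec_emit {S : Type} [Primcodable S] : Primrec₂ (Action.emit : ℕ → S → Action S) :=
  primrec_actionEquiv_symm.comp (Primrec.option_some.comp Primrec.sumInr)

theorem primrec_run : Primrec₂ UState.run :=
  Primrec.of_equiv_symm (e := UState.equiv).comp Primrec.sumInr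

theorem primrec_index : Primrec UState.index :=
  Primrec.of_equiv_symm (e := UState.equiv).comp Primrec.sumInl

/-- Case analysis on actions, with a total answer. -/
theorem computable_actionCases {α S σ : Type} [Primcodable α] [Primcodable S] [Primcodable σ]
    {f : α → Action S} {h : α → σ} {r : α → S × S → σ} {m : α → ℕ × S → σ} (hf : Computable f)
    (hh : Computable h) (hr : Computable₂ r) (hm : Computable₂ m) :
    Computable fun a => (match f a with
      | .halt => h a
      | .read s₀ s₁ => r a (s₀, s₁)
      | .emit x s => m a (x, s)) := by
  refine (Computable.option_casesOn (primrec_actionEquiv.to_comp.comp hf) hh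
    (Computable.sumCasesOn Computable.snd
      (hr.comp (Computable.fst.comp Computable.fst) Computable.snd).to₂
      (hm.comp (Computable.fst.comp Computable.fst) Computable.snd).to₂).to₂).of_eq fun a => ?_
  cases f a <;> rfl

theorem computable_actionMap {α S T : Type} [Primcodable α] [Primcodable S] [Primcodable T]
    {f : α → Action S} {g : α → S → T} (hf : Computable f) (hg : Computable₂ g) :
    Computable fun a => (f a).map (g a) := by
  refine (computable_actionCases (h := fun _ => Action.halt)
    (r := fun a p => Action.read (g a p.1) (g a p.2))
    (m := fun a p => Action.emit p.1 (g a p.2)) hf (Computable.const _) ?_ ?_).of_eq fun a => ?_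
  · exact primrec_read.to_comp.comp
      (hg.comp Computable.fst (Computable.fst.comp Computable.snd))
      (hg.comp Computable.fst (Computable.snd.comp Computable.snd))
  · exact primrec_emit.to_comp.comp (Computable.fst.comp Computable.snd)
      (hg.comp Computable.fst (Computable.snd.comp Computable.snd))
  · cases f a <;> rfl

theorem partrec_machineStep {α : Type} [Primcodable α] {e z y s : α → ℕ} (he : Computable e)
    (hz : Computable z) (hy : Computable y) (hs : Computable s) :
    Partrec fun a => machineStep (e a) (z a) (y a) (s a) := by
  unfold machineStep
  refine Partrec.map (Nat.Partrec.Code.eval_part.comp ((Computable.ofNat _).comp he)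
    (Primrec₂.natPair.to_comp.comp hz (Primrec₂.natPair.to_comp.comp hy hs)))
    (primrec_decodeAction.to_comp.comp Computable.snd).to₂

theorem partrec_ustep {α : Type} [Primcodable α] {z y : α → ℕ} {u : α → UState}
    (hz : Computable z) (hy : Computable y) (hu : Computable u) :
    Partrec fun a => ustep (z a) (y a) (u a) := by
  refine (Partrec.sumCasesOn (f := fun a => UState.equiv (u a))
    (g := fun _ k => Part.some (.read (.run k 0) (.index (k + 1))))
    (h := fun a p => (machineStep p.1 (z a) (y a) p.2).map (Action.map (UState.run p.1)))
    (Computable.comp Primrec.of_equiv.to_comp hu) ?_ ?_).of_eq fun a => ?_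
  · exact Computable₂.partrec₂ (f := fun (_ : α) (k : ℕ) => Action.read (UState.run k 0) (UState.index (k + 1)))
      (primrec_read.to_comp.comp
        (primrec_run.to_comp.comp Computable.snd (Computable.const 0))
        (primrec_index.to_comp.comp (Computable.succ.comp Computable.snd)))
  · refine Partrec.map (partrec_machineStep (Computable.fst.comp Computable.snd)
      (hz.comp Computable.fst) (hy.comp Computable.fst) (Computable.snd.comp Computable.snd)) ?_
    exact computable_actionMap Computable.snd (primrec_run.to_comp.comp
      (Computable.fst.comp (Computable.snd.comp (Computable.fst.comp Computable.fst)))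
      Computable.snd)
  · cases u a <;> rfl

/-- Every partial recursive transition function is that of a machine. -/
theorem exists_machine {S : Type} [Primcodable S] {step : (ℕ × ℕ) × S →. Action S}
    (hstep : Partrec step) : ∃ e, ∀ z y s,
      machineStep e z y (Encodable.encode s) = (step ((z, y), s)).map (Action.map Encodable.encode) := by
  have h1 : Partrec fun n : ℕ =>
      ((Encodable.decode (α := S) n.unpair.2.unpair.2 : Part S).bind fun s =>
        (step ((n.unpair.1, n.unpair.2.unpair.1), s)).map fun a =>
          Encodable.encode (a.map Encodable.encode)) := by
    have u1 : Computable fun n : ℕ => n.unpair.1 := Computable.fst.comp Computable.unpair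
    have u2 : Computable fun n : ℕ => n.unpair.2 := Computable.snd.comp Computable.unpair
    refine Partrec.bind (Computable.ofOption (Computable.decode.comp (u2.comp u2))) ?_
    refine Partrec.map (hstep.comp (((u1.comp Computable.fst).pair
      ((u1.comp u2).comp Computable.fst)).pair Computable.snd)) ?_
    exact Computable.encode.comp (computable_actionMap Computable.snd
      (Computable.encode.comp Computable.snd))
  obtain ⟨c, hc⟩ := Nat.Partrec.Code.exists_code.1 (Partrec.nat_iff.1 h1)
  refine ⟨Encodable.encode c, fun z y s => ?_⟩
  unfold machineStep
  rw [Denumerable.ofNat_encode, hc]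
  simp only [Nat.unpair_pair, Encodable.encodek, Part.coe_some, Part.bind_some, Part.map_map]
  congr 1
  funext a
  exact decodeAction_encode _

end QAIT

/-! ### Programs `1ᵉ0p`: simulation, constant outputs and transducers. -/

namespace QAIT

/-- The input `1ᵉ0p`. -/
def word (e : ℕ) (p : List Bool) : List Bool := List.replicate e true ++ false :: p

theorem length_word (e : ℕ) (p : List Bool) : (word e p).length = e + 1 + p.length := by
  simp [word]; omega

theorem word_append (e : ℕ) (p t : List Bool) : word e p ++ t = word e (p ++ t) := by
  simp [word]

/-- The unary index `1ᵉ0` is itself a prefix-free code. -/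
theorem word_prefix_iff {e e' : ℕ} {p p' : List Bool} :
    word e p <+: word e' p' ↔ e = e' ∧ p <+: p' := by
  induction e generalizing e' with
  | zero => cases e' <;> simp [word, List.replicate_succ]
  | succ e ih =>
    cases e' with
    | zero => simp [word, List.replicate_succ]
    | succ e' => simpa [word, List.replicate_succ] using ih (e' := e')

theorem word_inj {e e' : ℕ} {p p' : List Bool} : word e p = word e' p' ↔ e = e' ∧ p = p' := by
  constructor
  · intro h
    have h1 := word_prefix_iff.1 (h ▸ List.prefix_rfl : word e p <+: word e' p')
    obtain ⟨rfl, -⟩ := h1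
    exact ⟨rfl, by simpa [word] using h⟩
  · rintro ⟨rfl, rfl⟩; rfl

theorem replicate_ne_word {k e : ℕ} {p : List Bool} : List.replicate k true ≠ word e p := by
  intro h
  have : false ∈ List.replicate k true := h ▸ (by simp [word])
  simp at this

/-- Runs of an abstract machine with transition function `step`, started in `s₀`. -/
inductive MReach {S : Type} (step : (ℕ × ℕ) × S →. Action S) (s₀ : S) (z y : ℕ) :
    List Bool → List ℕ → S → Prop
  | start : MReach step s₀ z y [] [] s₀
  | read {r w s t₀ t₁} (b : Bool) : MReach step s₀ z y r w s →
      Action.read t₀ t₁ ∈ step ((z, y), s) → MReach step s₀ z y (r ++ [b]) w (if b then t₁ else t₀)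
  | emit {r w s t x} : MReach step s₀ z y r w s → Action.emit x t ∈ step ((z, y), s) →
      MReach step s₀ z y r (w ++ [x]) t

/-- The `e`-th machine has transition function `step` and initial state `s₀`. -/
def Simulates {S : Type} [Primcodable S] (e : ℕ) (step : (ℕ × ℕ) × S →. Action S) (s₀ : S) : Prop :=
  Encodable.encode s₀ = 0 ∧ ∀ z y s,
    machineStep e z y (Encodable.encode s) = (step ((z, y), s)).map (Action.map Encodable.encode)

theorem reach_index (z y k : ℕ) : Reach z y (List.replicate k true) [] (.index k) := by
  induction k with
  | zero => exact .start
  | succ k ih =>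
    rw [List.replicate_succ']
    exact Reach.read (s₀ := .run k 0) (s₁ := .index (k + 1)) true ih (by simp [ustep])

/-- A run is either still reading the unary index, without output, or has fixed the machine `e`;
this invariant lets facts about arbitrary runs of `U` be transferred to one machine. -/
theorem reach_shape {z y : ℕ} {r : List Bool} {w : List ℕ} {s : UState} (h : Reach z y r w s) :
    (∃ k, s = .index k ∧ r = List.replicate k true ∧ w = []) ∨
      ∃ e t p, s = .run e t ∧ r = word e p := by
  induction h with
  | start => exact .inl ⟨0, rfl, rfl, rfl⟩
  | @read r w s s₀ s₁ b hr hs ih =>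
    rcases ih with ⟨k, rfl, rfl, rfl⟩ | ⟨e, t, p, rfl, rfl⟩
    · simp only [ustep, Part.mem_some_iff, Action.read.injEq] at hs
      obtain ⟨rfl, rfl⟩ := hs
      cases b
      · exact .inr ⟨k, 0, [], rfl, rfl⟩
      · exact .inl ⟨k + 1, rfl, by rw [List.replicate_succ'], rfl⟩
    · right
      obtain ⟨a, -, ha⟩ := (Part.mem_map_iff _).1 hs
      cases a <;> simp only [Action.map, reduceCtorEq, Action.read.injEq] at ha
      obtain ⟨rfl, rfl⟩ := ha
      cases b
      · exact ⟨e, _, p ++ [false], rfl, word_append ..⟩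
      · exact ⟨e, _, p ++ [true], rfl, word_append ..⟩
  | @emit r w s s' x hr hs ih =>
    rcases ih with ⟨k, rfl, rfl, rfl⟩ | ⟨e, t, p, rfl, rfl⟩
    · simp [ustep] at hs
    · obtain ⟨a, -, ha⟩ := (Part.mem_map_iff _).1 hs
      cases a <;> simp only [Action.map, reduceCtorEq, Action.emit.injEq] at ha
      exact .inr ⟨e, _, p, ha.2.symm, rfl⟩

section Simulation

variable {S : Type} [Primcodable S] {e : ℕ} {step : (ℕ × ℕ) × S →. Action S} {s₀ : S}

theorem Simulates.mem_ustep (h : Simulates e step s₀) {z y : ℕ} {s : S} {a : Action UState} :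
    a ∈ ustep z y (.run e (Encodable.encode s)) ↔
      ∃ b ∈ step ((z, y), s), b.map (fun t => UState.run e (Encodable.encode t)) = a := by
  simp only [ustep, h.2, Part.mem_map_iff, exists_exists_and_eq_and]
  refine exists_congr fun b => and_congr_right fun _ => ?_
  cases b <;> rfl

theorem Simulates.reach (h : Simulates e step s₀) {z y : ℕ} {r : List Bool} {w : List ℕ} {s : S}
    (hr : MReach step s₀ z y r w s) :
    Reach z y (word e r) w (.run e (Encodable.encode s)) := by
  induction hr with
  | start =>
    rw [h.1]
    exact Reach.read (s₀ := .run e 0) (s₁ := .index (e + 1)) false (reach_index z y e) (by simp [ustep])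
  | @read r w s t₀ t₁ b _ hs ih =>
    rw [← word_append]
    have := Reach.read b ih (h.mem_ustep.2 ⟨_, hs, rfl⟩)
    cases b <;> exact this
  | emit _ hs ih => exact Reach.emit ih (h.mem_ustep.2 ⟨_, hs, rfl⟩)

/-- The converse of `Simulates.reach`. Both directions are needed because `LowerComputes` also makes
negative claims: no further read, no further item. -/
theorem Simulates.exists_of_reach (h : Simulates e step s₀) {z y : ℕ} {r : List Bool} {w : List ℕ}
    {s : UState} (hr : Reach z y (word e r) w s) :
    ∃ t, s = .run e (Encodable.encode t) ∧ MReach step s₀ z y r w t := by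
  generalize hq : word e r = q at hr
  induction hr generalizing r with
  | start => exact (replicate_ne_word (k := 0) hq.symm).elim
  | @read q w s s₀ s₁ b hq' hs ih =>
    rcases reach_shape hq' with ⟨k, rfl, rfl, rfl⟩ | ⟨e', t, p, rfl, rfl⟩
    · simp only [ustep, Part.mem_some_iff, Action.read.injEq] at hs
      obtain ⟨rfl, rfl⟩ := hs
      cases b
      · obtain ⟨rfl, rfl⟩ := word_inj.1 (hq.trans (rfl : _ = word k []))
        exact ⟨_, by simp [h.1], .start⟩
      · rw [← List.replicate_succ'] at hq
        exact (replicate_ne_word hq.symm).elim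
    · rw [word_append] at hq
      obtain ⟨rfl, rfl⟩ := word_inj.1 hq
      obtain ⟨t', ht, hm⟩ := ih rfl
      simp only [UState.run.injEq, true_and] at ht
      subst ht
      obtain ⟨a, ha, hb⟩ := h.mem_ustep.1 hs
      cases a <;> simp only [Action.map, reduceCtorEq, Action.read.injEq] at hb
      obtain ⟨rfl, rfl⟩ := hb
      refine ⟨_, ?_, .read b hm ha⟩
      cases b <;> rfl
  | @emit q w s s' x hq' hs ih =>
    obtain ⟨t', rfl, hm⟩ := ih hq
    obtain ⟨a, ha, hb⟩ := h.mem_ustep.1 hs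
    cases a <;> simp only [Action.map, reduceCtorEq, Action.emit.injEq] at hb
    obtain ⟨rfl, rfl⟩ := hb
    exact ⟨_, rfl, .emit hm ha⟩

theorem Simulates.outputs (h : Simulates e step s₀) {z y : ℕ} {r : List Bool} {x : ℕ} {s : S}
    (hr : MReach step s₀ z y r [x] s) (hs : Action.halt ∈ step ((z, y), s)) :
    Outputs z y (word e r) x :=
  ⟨_, h.reach hr, h.mem_ustep.2 ⟨_, hs, rfl⟩⟩

theorem Simulates.readsWithin_iff (h : Simulates e step s₀) {z y : ℕ} {q : List Bool} :
    ReadsWithin z y (word e q) ↔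
      ¬ ∃ w s t₀ t₁, MReach step s₀ z y q w s ∧ Action.read t₀ t₁ ∈ step ((z, y), s) := by
  refine not_congr ⟨?_, ?_⟩
  · rintro ⟨w, s, s₀, s₁, hr, hs⟩
    obtain ⟨t, rfl, ht⟩ := h.exists_of_reach hr
    obtain ⟨a, ha, hb⟩ := h.mem_ustep.1 hs
    cases a <;> simp only [Action.map, reduceCtorEq, Action.read.injEq] at hb
    exact ⟨w, t, _, _, ht, ha⟩
  · rintro ⟨w, s, t₀, t₁, hr, hs⟩
    exact ⟨w, _, _, _, h.reach hr, h.mem_ustep.2 ⟨_, hs, rfl⟩⟩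

theorem Simulates.emits_iff (h : Simulates e step s₀) {z y : ℕ} {q : List Bool} {i x : ℕ} :
    Emits z y (word e q) i x ↔
      ∃ r w s, r <+: q ∧ MReach step s₀ z y r w s ∧ w[i]? = some x := by
  constructor
  · rintro ⟨r, w, s, hrq, hr, hx⟩
    rcases reach_shape hr with ⟨k, rfl, rfl, rfl⟩ | ⟨e', t, p, rfl, rfl⟩
    · simp at hx
    · obtain ⟨rfl, hp⟩ := word_prefix_iff.1 hrq
      obtain ⟨t, -, ht⟩ := h.exists_of_reach hr
      exact ⟨p, w, t, hp, ht, hx⟩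
  · rintro ⟨r, w, s, hrq, hr, hx⟩
    exact ⟨_, w, _, word_prefix_iff.2 ⟨rfl, hrq⟩, h.reach hr, hx⟩

end Simulation

/-- Every fixed item is output by a program that works under all conditions. -/
theorem exists_program_const (x : ℕ) : ∃ q, ∀ z y, Outputs z y q x ∧ ReadsWithin z y q ∧
    ∀ i x', Emits z y q i x' ↔ i = 0 ∧ x' = x := by
  let step : (ℕ × ℕ) × Bool →. Action Bool :=
    fun p => Part.some (cond p.2 Action.halt (Action.emit x true))
  have hstep : Partrec step :=
    (Computable.cond Computable.snd (Computable.const _) (Computable.const _) :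
      Computable fun p : (ℕ × ℕ) × Bool => cond p.2 Action.halt (Action.emit x true)).partrec
  obtain ⟨e, he⟩ := exists_machine hstep
  have hsim : Simulates e step false := ⟨rfl, he⟩
  have hr : ∀ {z y r w s}, MReach step false z y r w s → r = [] ∧ w = cond s [x] [] := by
    intro z y r w s h
    induction h with
    | start => simp
    | @read r w s _ _ _ _ hs => cases s <;> simp [step] at hs
    | @emit r w s t x' _ hs ih =>
      cases s <;> simp [step] at hs
      obtain ⟨rfl, rfl⟩ := hs
      simp [ih]
  have h1 : ∀ z y, MReach step false z y [] [x] true := fun z y =>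
    MReach.emit (w := []) (s := false) .start (by simp [step])
  refine ⟨word e [], fun z y => ⟨hsim.outputs (h1 z y) (by simp [step]), hsim.readsWithin_iff.2 ?_,
    fun i x' => hsim.emits_iff.trans ⟨?_, ?_⟩⟩⟩
  · rintro ⟨w, s, t₀, t₁, -, hs⟩
    cases s <;> simp [step] at hs
  · rintro ⟨r, w, s, -, h, hx⟩
    obtain ⟨rfl, rfl⟩ := hr h
    cases s
    · simp at hx
    · cases i <;> simp_all
  · rintro ⟨rfl, rfl⟩
    exact ⟨[], _, _, List.prefix_rfl, h1 z y, rfl⟩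

/-- Change of the output item of an action. -/
def Action.mapOutput {S : Type} (f : ℕ → ℕ) : Action S → Action S
  | .halt => .halt
  | .read s₀ s₁ => .read s₀ s₁
  | .emit x s => .emit (f x) s

/-- A computable function of the output items is applied by a machine that simulates `U`. -/
theorem exists_transducer {g : (ℕ × ℕ) × ℕ → ℕ} (hg : Computable g) : ∃ e, ∀ z y q,
    (ReadsWithin z y q → ReadsWithin z y (word e q)) ∧
    ∀ i x, Emits z y (word e q) i x ↔ ∃ x', Emits z y q i x' ∧ g ((z, y), x') = x := by
  let step : (ℕ × ℕ) × UState →. Action UState := fun p =>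
    (ustep p.1.1 p.1.2 p.2).map (Action.mapOutput fun x => g (p.1, x))
  have hstep : Partrec step := by
    refine Partrec.map (partrec_ustep (Computable.fst.comp Computable.fst)
      (Computable.snd.comp Computable.fst) Computable.snd) ?_
    refine Computable.of_eq (computable_actionCases
      (f := fun p : ((ℕ × ℕ) × UState) × Action UState => p.2) (h := fun _ => Action.halt)
      (r := fun _ p => Action.read p.1 p.2) (m := fun a p => Action.emit (g (a.1.1, p.1)) p.2)
      Computable.snd (Computable.const _) ?_ ?_) fun p => ?_
    · exact primrec_read.to_comp.comp (Computable.fst.comp Computable.snd)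
        (Computable.snd.comp Computable.snd)
    · exact primrec_emit.to_comp.comp (hg.comp (Computable.pair
        (Computable.fst.comp (Computable.fst.comp Computable.fst))
        (Computable.fst.comp Computable.snd))) (Computable.snd.comp Computable.snd)
    · rcases p with ⟨_, _ | _ | _⟩ <;> rfl
  obtain ⟨e, he⟩ := exists_machine hstep
  have hsim : Simulates e step (.index 0) := ⟨rfl, he⟩
  have hread : ∀ {z y s t₀ t₁}, Action.read t₀ t₁ ∈ step ((z, y), s) ↔
      Action.read t₀ t₁ ∈ ustep z y s := by
    intro z y s t₀ t₁
    simp only [step, Part.mem_map_iff]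
    constructor
    · rintro ⟨a, ha, h⟩
      cases a <;> simp only [Action.mapOutput, reduceCtorEq] at h
      rwa [← h]
    · exact fun h => ⟨_, h, rfl⟩
  have hemit : ∀ {z y s t x}, Action.emit x t ∈ step ((z, y), s) ↔
      ∃ x', Action.emit x' t ∈ ustep z y s ∧ g ((z, y), x') = x := by
    intro z y s t x
    simp only [step, Part.mem_map_iff]
    constructor
    · rintro ⟨a, ha, h⟩
      cases a <;> simp only [Action.mapOutput, reduceCtorEq, Action.emit.injEq] at h
      obtain ⟨rfl, rfl⟩ := h
      exact ⟨_, ha, rfl⟩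
    · rintro ⟨x', h, rfl⟩
      exact ⟨_, h, rfl⟩
  have h1 : ∀ {z y r w s}, Reach z y r w s →
      MReach step (.index 0) z y r (w.map fun x => g ((z, y), x)) s := by
    intro z y r w s h
    induction h with
    | start => exact .start
    | read b _ hs ih => exact .read b ih (hread.2 hs)
    | emit _ hs ih => simpa using MReach.emit ih (hemit.2 ⟨_, hs, rfl⟩)
  -- Runs are also lifted back to `U`, which shows that the transducer neither reads more nor
  -- outputs other items.
  have h2 : ∀ {z y r w s}, MReach step (.index 0) z y r w s →
      ∃ w', w = w'.map (fun x => g ((z, y), x)) ∧ Reach z y r w' s := by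
    intro z y r w s h
    induction h with
    | start => exact ⟨[], rfl, .start⟩
    | read b _ hs ih =>
      obtain ⟨w', rfl, h'⟩ := ih
      exact ⟨w', rfl, .read b h' (hread.1 hs)⟩
    | emit _ hs ih =>
      obtain ⟨w', rfl, h'⟩ := ih
      obtain ⟨x', hx, rfl⟩ := hemit.1 hs
      exact ⟨w' ++ [x'], by simp, .emit h' hx⟩
  refine ⟨e, fun z y q => ⟨fun h => hsim.readsWithin_iff.2 ?_, fun i x =>
    hsim.emits_iff.trans ⟨?_, ?_⟩⟩⟩
  · rintro ⟨w, s, t₀, t₁, hr, hs⟩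
    obtain ⟨w', rfl, h'⟩ := h2 hr
    exact h ⟨w', s, t₀, t₁, h', hread.1 hs⟩
  · rintro ⟨r, w, s, hrq, hr, hx⟩
    obtain ⟨w', rfl, h'⟩ := h2 hr
    simp only [List.getElem?_map, Option.map_eq_some_iff] at hx
    obtain ⟨x', hx', rfl⟩ := hx
    exact ⟨x', ⟨r, w', s, hrq, h', hx'⟩, rfl⟩
  · rintro ⟨x', ⟨r, w', s, hrq, h', hx'⟩, rfl⟩
    exact ⟨r, _, s, hrq, h1 h', by simp [hx']⟩

end QAIT

/-! ### Sampling from a computed list with extra random bits. -/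

namespace QAIT

/-- States of a machine that simulates `U`, then holds its output, then samples from a list. -/
abbrev SamplerState : Type := UState ⊕ ((ℕ × UState) ⊕ List ℕ)

/-- One step of the selection of a random entry of a list by repeated halving. -/
def halve (l : List ℕ) : Action SamplerState :=
  if l.length ≤ 1 then
    Option.casesOn l.head? .halt fun x => .emit x (.inr (.inr []))
  else .read (.inr (.inr (l.take (l.length / 2)))) (.inr (.inr (l.drop (l.length / 2))))

theorem primrec_halve : Primrec halve := by
  have hs : Primrec fun l : List ℕ => (Sum.inr (Sum.inr l) : SamplerState) :=
    Primrec.sumInr.comp Primrec.sumInr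
  have hl : Primrec fun l : List ℕ => l.length / 2 :=
    Primrec.nat_div.comp Primrec.list_length (Primrec.const 2)
  refine Primrec.ite (Primrec.nat_le.comp Primrec.list_length (Primrec.const 1)) ?_ ?_
  · exact Primrec.option_casesOn Primrec.list_head? (Primrec.const _)
      (primrec_emit.comp Primrec.snd (Primrec.const _)).to₂
  · exact primrec_read.comp (hs.comp (Primrec.list_take.comp hl Primrec.id))
      (hs.comp (Primrec.list_drop.comp hl Primrec.id))

/-- The bit strings of length `m` that lead to the item `u` when a list of length `2 ^ m` is
halved repeatedly. -/
def paths (u : ℕ) : ℕ → List ℕ → Finset (List Bool)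
  | 0, l => if l = [u] then {[]} else ∅
  | m + 1, l => (paths u m (l.take (l.length / 2))).image (List.cons false) ∪
      (paths u m (l.drop (l.length / 2))).image (List.cons true)

theorem length_of_mem_paths {u m : ℕ} {l : List ℕ} {t : List Bool} (h : t ∈ paths u m l) :
    t.length = m := by
  induction m generalizing l t with
  | zero =>
    unfold paths at h
    split_ifs at h <;> simp_all
  | succ m ih =>
    simp only [paths, Finset.mem_union, Finset.mem_image] at h
    rcases h with ⟨t, ht, rfl⟩ | ⟨t, ht, rfl⟩ <;> simp [ih ht]

/-- Halving a list of length `2 ^ m` puts the strings of length `m` in bijection with its positions,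
so an item is reached once for each occurrence. -/
theorem card_paths {u m : ℕ} {l : List ℕ} (h : l.length = 2 ^ m) :
    (paths u m l).card = l.count u := by
  induction m generalizing l with
  | zero =>
    obtain ⟨x, rfl⟩ := List.length_eq_one_iff.1 h
    by_cases hx : x = u <;> simp [paths, hx]
  | succ m ih =>
    have h2 : l.length / 2 = 2 ^ m := by rw [h, pow_succ]; omega
    rw [paths, Finset.card_union_of_disjoint, Finset.card_image_of_injective _ List.cons_injective,
      Finset.card_image_of_injective _ List.cons_injective, ih, ih, ← List.count_append,
      List.take_append_drop]
    · rw [List.length_drop, h2, h, pow_succ]; omega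
    · rw [List.length_take, h2, h, pow_succ]; omega
    · rw [Finset.disjoint_left]
      simp

/-- What the sampler does, while it holds `x`, when `U` takes the given action: nothing total if
`U` halts. -/
def holdCase (x : ℕ) : Action UState → Unit ⊕ Option (Action SamplerState)
  | .halt => .inl ()
  | .read s₀ s₁ => .inr (some (.read (.inr (.inl (x, s₀))) (.inr (.inl (x, s₁)))))
  | .emit _ _ => .inr none

theorem computable_holdCase : Computable₂ holdCase := by
  have hx : Computable fun q : (ℕ × Action UState) × UState × UState => q.1.1 :=
    Computable.fst.comp Computable.fst
  have hr : Computable₂ fun (q : ℕ × Action UState) (s : UState × UState) =>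
      (Sum.inr (some (Action.read (.inr (.inl (q.1, s.1))) (.inr (.inl (q.1, s.2))))) :
        Unit ⊕ Option (Action SamplerState)) :=
    Computable.sumInr.comp (Computable.option_some.comp (primrec_read.to_comp.comp
      (Computable.sumInr.comp (Computable.sumInl.comp (hx.pair (Computable.fst.comp Computable.snd))))
      (Computable.sumInr.comp (Computable.sumInl.comp (hx.pair (Computable.snd.comp Computable.snd))))))
  refine (computable_actionCases (f := fun q : ℕ × Action UState => q.2) (h := fun _ => Sum.inl ())
    (m := fun _ _ => Sum.inr none) Computable.snd (Computable.const _) hr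
    (Computable.const _).to₂).of_eq fun q => ?_
  rcases q with ⟨_, _ | _ | _⟩ <;> rfl

/-- What the sampler does, before `U` has output anything, when `U` takes the given action. -/
def simCase : Action UState → Option (Action SamplerState) ⊕ (ℕ × UState)
  | .halt => .inl none
  | .read s₀ s₁ => .inl (some (.read (.inl s₀) (.inl s₁)))
  | .emit x s => .inr (x, s)

theorem computable_simCase : Computable simCase := by
  have hr : Computable₂ fun (_ : Action UState) (s : UState × UState) =>
      (Sum.inl (some (Action.read (.inl s.1) (.inl s.2))) :
        Option (Action SamplerState) ⊕ (ℕ × UState)) :=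
    Computable.sumInl.comp (Computable.option_some.comp (primrec_read.to_comp.comp
      (Computable.sumInl.comp (Computable.fst.comp Computable.snd))
      (Computable.sumInl.comp (Computable.snd.comp Computable.snd))))
  refine (computable_actionCases (f := fun q : Action UState => q) (h := fun _ => Sum.inl none)
    (m := fun _ p => Sum.inr p) Computable.id (Computable.const _) hr
    (Computable.sumInr.comp Computable.snd).to₂).of_eq fun q => ?_
  rcases q with _ | _ | _ <;> rfl

/-- The steps of the sampler while it holds the output of `U`. -/
def holdStep (G : (ℕ × ℕ) × ℕ →. List ℕ) (c : ℕ × ℕ) (p : ℕ × UState) : Part (Action SamplerState) :=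
  (ustep c.1 c.2 p.2).bind fun a =>
    Sum.casesOn (holdCase p.1 a) (fun _ => (G (c, p.1)).map halve) fun o => (o : Part _)

theorem partrec_holdStep {G : (ℕ × ℕ) × ℕ →. List ℕ} (hG : Partrec G) : Partrec₂ (holdStep G) := by
  refine Partrec.bind (partrec_ustep (Computable.fst.comp Computable.fst)
    (Computable.snd.comp Computable.fst) (Computable.snd.comp Computable.snd)) ?_
  refine Partrec.sumCasesOn (f := fun q : ((ℕ × ℕ) × ℕ × UState) × Action UState =>
    holdCase q.1.2.1 q.2) (g := fun q _ => (G (q.1.1, q.1.2.1)).map halve)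
    (h := fun _ o => (o : Part (Action SamplerState))) ?_ ?_ (Computable.ofOption Computable.snd).to₂
  · exact computable_holdCase.comp (Computable.fst.comp (Computable.snd.comp Computable.fst))
      Computable.snd
  · refine Partrec.map (hG.comp (Computable.pair
      (Computable.fst.comp (Computable.fst.comp Computable.fst))
      (Computable.fst.comp (Computable.snd.comp (Computable.fst.comp Computable.fst)))))
      (primrec_halve.to_comp.comp Computable.snd).to₂

/-- The steps of the sampler. -/
def samplerStep (G : (ℕ × ℕ) × ℕ →. List ℕ) (p : (ℕ × ℕ) × SamplerState) :
    Part (Action SamplerState) :=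
  Sum.casesOn p.2
    (fun u => (ustep p.1.1 p.1.2 u).bind fun a =>
      Sum.casesOn (simCase a) (fun o => (o : Part _)) fun q => holdStep G p.1 q)
    (fun q => Sum.casesOn q (fun q => holdStep G p.1 q) fun l => Part.some (halve l))

theorem partrec_samplerStep {G : (ℕ × ℕ) × ℕ →. List ℕ} (hG : Partrec G) :
    Partrec (samplerStep G) := by
  refine Partrec.sumCasesOn Computable.snd ?_ ?_
  · refine Partrec.bind (partrec_ustep (Computable.fst.comp (Computable.fst.comp Computable.fst))
      (Computable.snd.comp (Computable.fst.comp Computable.fst)) Computable.snd) ?_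
    refine Partrec.sumCasesOn (f := fun q : (((ℕ × ℕ) × SamplerState) × UState) × Action UState =>
      simCase q.2) (g := fun _ o => (o : Part (Action SamplerState)))
      (h := fun q r => holdStep G q.1.1.1 r) (computable_simCase.comp Computable.snd)
      (Computable.ofOption Computable.snd).to₂ ?_
    exact ((partrec_holdStep hG).comp (Computable.fst.comp (Computable.fst.comp (Computable.fst.comp
      Computable.fst))) Computable.snd).to₂
  · refine Partrec.sumCasesOn (f := fun q : ((ℕ × ℕ) × SamplerState) × ((ℕ × UState) ⊕ List ℕ) =>
      q.2) (g := fun q r => holdStep G q.1.1 r) (h := fun _ l => Part.some (halve l))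
      Computable.snd ?_ ?_
    · exact ((partrec_holdStep hG).comp (Computable.fst.comp (Computable.fst.comp Computable.fst))
        Computable.snd).to₂
    · exact (primrec_halve.to_comp.comp Computable.snd).partrec.to₂

/-- A machine that simulates `U` and replaces its output `x` by a random entry of a list that is
found by a computable search. -/
theorem exists_sampler {G : (ℕ × ℕ) × ℕ →. List ℕ} (hG : Partrec G) : ∃ e, ∀ z y p x l m t u,
    Outputs z y p x → l ∈ G ((z, y), x) → l.length = 2 ^ m → t ∈ paths u m l →
    Outputs z y (word e (p ++ t)) u := by
  obtain ⟨e, he⟩ := exists_machine (partrec_samplerStep hG)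
  have hsim : Simulates e (samplerStep G) (.inl (.index 0)) := ⟨rfl, he⟩
  have hread : ∀ {z y : ℕ} {u s₀ s₁ : UState}, Action.read s₀ s₁ ∈ ustep z y u →
      Action.read (.inl s₀) (.inl s₁) ∈ samplerStep G ((z, y), .inl u) :=
    fun h => Part.mem_bind h (Part.mem_some _)
  have hhold_read : ∀ {z y x : ℕ} {u s₀ s₁ : UState}, Action.read s₀ s₁ ∈ ustep z y u →
      Action.read (.inr (.inl (x, s₀))) (.inr (.inl (x, s₁))) ∈ holdStep G (z, y) (x, u) :=
    fun h => Part.mem_bind h (Part.mem_some _)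
  have h0 : ∀ {z y r w s}, Reach z y r w s → w = [] →
      MReach (samplerStep G) (.inl (.index 0)) z y r [] (.inl s) := by
    intro z y r w s h
    induction h with
    | start => exact fun _ => .start
    | read b _ hs ih =>
      intro hw
      have := MReach.read b (ih hw) (hread hs)
      cases b <;> exact this
    | emit _ _ _ => simp
  -- There are no silent moves, so the output of `U` must be absorbed: the sampler remains in the
  -- state before the emission, where its next action is already the one that it takes while holding
  -- `x`.
  have h1 : ∀ {z y r w s}, Reach z y r w s → ∀ x, w = [x] →
      ∃ t, MReach (samplerStep G) (.inl (.index 0)) z y r [] t ∧ samplerStep G ((z, y), t) = holdStep G (z, y) (x, s) := by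
    intro z y r w s h
    induction h with
    | start => simp
    | @read r w s s₀ s₁ b _ hs ih =>
      intro x hw
      obtain ⟨t, ht, hst⟩ := ih x hw
      refine ⟨_, MReach.read b ht (hst ▸ hhold_read hs), ?_⟩
      cases b <;> rfl
    | @emit r w s s' x hr hs ih =>
      intro x' hw
      have hw0 : w = [] ∧ x = x' := by simpa [List.append_eq_singleton_iff] using hw
      obtain ⟨rfl, rfl⟩ := hw0
      refine ⟨_, h0 hr rfl, ?_⟩
      have : ustep z y s = Part.some (Action.emit x s') := Part.eq_some_iff.2 hs
      simp [samplerStep, simCase, this]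
  -- The halving is tracked through the next action `halve l` rather than through the state, because
  -- the first halving happens in a simulation state at which `U` halts.
  have h2 : ∀ m z y r t l u s, MReach (samplerStep G) (.inl (.index 0)) z y r [] s →
      halve l ∈ samplerStep G ((z, y), s) → l.length = 2 ^ m → t ∈ paths u m l →
      Outputs z y (word e (r ++ t)) u := by
    intro m
    induction m with
    | zero =>
      intro z y r t l u s hr hs hl ht
      simp only [paths] at ht
      split_ifs at ht with hlu
      · subst hlu
        obtain rfl : t = [] := by simpa using ht
        rw [List.append_nil]
        exact hsim.outputs (MReach.emit hr hs) (Part.mem_some _)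
      · simp at ht
    | succ m ih =>
      intro z y r t l u s hr hs hl ht
      have hm : 0 < 2 ^ m := by positivity
      have hl' : ¬ l.length ≤ 1 := by rw [hl, pow_succ]; omega
      have h2 : l.length / 2 = 2 ^ m := by rw [hl, pow_succ]; omega
      rw [halve, if_neg hl'] at hs
      simp only [paths, Finset.mem_union, Finset.mem_image] at ht
      rcases ht with ⟨t, ht, rfl⟩ | ⟨t, ht, rfl⟩
      · rw [List.append_cons]
        exact ih _ _ _ _ _ _ _ (MReach.read false hr hs) (Part.mem_some _)
          (by rw [List.length_take, h2, hl, pow_succ]; omega) ht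
      · rw [List.append_cons]
        exact ih _ _ _ _ _ _ _ (MReach.read true hr hs) (Part.mem_some _)
          (by rw [List.length_drop, h2, hl, pow_succ]; omega) ht
  refine ⟨e, fun z y p x l m t u hp hl hm ht => ?_⟩
  obtain ⟨s, hr, hs⟩ := hp
  obtain ⟨s', hr', hs'⟩ := h1 hr x rfl
  refine h2 m z y p t l u s' hr' ?_ hm ht
  rw [hs']
  exact Part.mem_bind hs (Part.mem_map _ hl)

/-! ### Universal probability under sampling and computable maps. -/

open scoped Classical in
/-- The universal probability dominates the sampling of a list entry after an output of `U`. -/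
theorem exists_uprob_sampler {G : (ℕ × ℕ) × ℕ →. List ℕ} (hG : Partrec G) :
    ∃ c : ℝ≥0∞, c ≠ 0 ∧ c ≠ ∞ ∧ ∀ (z y u : ℕ) {ι : Type} (k : ι → ℕ) (L : ι → List ℕ)
      (m : ι → ℕ), Function.Injective k →
      (∀ x, L x ∈ G ((z, y), k x) ∧ (L x).length = 2 ^ m x) →
      ∑' x, uprob z (k x) y * ((2⁻¹ : ℝ≥0∞) ^ m x * (L x).count u) ≤ c * uprob z u y := by
  obtain ⟨e, he⟩ := exists_sampler hG
  -- The factor pays for the prefix `1ᵉ0`, of length `e + 1`.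
  refine ⟨2 ^ (e + 1), by simp, by finiteness, fun z y u ι k L m hk hX => ?_⟩
  -- An element consists of an index `x`, a program `p` for its code, and a path `t` to an
  -- occurrence of `u` in `L x`; its weight is `2 ^ -(|p| + m x)`.
  let T := Σ q : {q : ι × List Bool // Outputs z y q.2 (k q.1)}, paths u (m q.1.1) (L q.1.1)
  have hcalc : ∑' x, uprob z (k x) y * ((2⁻¹ : ℝ≥0∞) ^ m x * (L x).count u) =
      ∑' t : T, (2⁻¹ : ℝ≥0∞) ^ (t.1.1.2.length + m t.1.1.1) := by
    rw [ENNReal.tsum_sigma']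
    have : ∀ q : {q : ι × List Bool // Outputs z y q.2 (k q.1)},
        ∑' _ : paths u (m q.1.1) (L q.1.1), (2⁻¹ : ℝ≥0∞) ^ (q.1.2.length + m q.1.1) =
          (2⁻¹ : ℝ≥0∞) ^ q.1.2.length * ((2⁻¹ : ℝ≥0∞) ^ m q.1.1 * (L q.1.1).count u) := by
      intro q
      rw [tsum_fintype, Finset.sum_const, Finset.card_univ, Fintype.card_coe,
        card_paths (hX _).2, nsmul_eq_mul, pow_add]
      ring
    simp_rw [this]
    erw [tsum_subtype {q : ι × List Bool | Outputs z y q.2 (k q.1)} (fun q =>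
      (2⁻¹ : ℝ≥0∞) ^ q.2.length * ((2⁻¹ : ℝ≥0∞) ^ m q.1 * (L q.1).count u)), ENNReal.tsum_prod']
    refine tsum_congr fun x => ?_
    rw [uprob, ← ENNReal.tsum_mul_right]
    refine tsum_congr fun p => ?_
    simp only [Set.indicator_apply, Set.mem_ofPred_eq, ite_mul, zero_mul]
  rw [hcalc]
  let f : T → List Bool := fun t => word e (t.1.1.2 ++ t.2.1)
  -- The domain of `U` is prefix-free, so `p ++ t` determines where `p` ends; the output of `p` then
  -- determines `x`.
  have hf : Function.Injective f := by
    rintro ⟨⟨⟨x, p⟩, hp⟩, ⟨t, ht⟩⟩ ⟨⟨⟨x', p'⟩, hp'⟩, ⟨t', ht'⟩⟩ h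
    replace h : p ++ t = p' ++ t' := (word_inj.1 h).2
    dsimp only at hp hp' ht ht'
    have hpp : p = p' ∧ k x = k x' := by
      rcases List.prefix_or_prefix_of_prefix (List.prefix_append p t)
        (h ▸ List.prefix_append p' t') with hh | hh
      · exact outputs_unique hp hp' hh
      · exact (outputs_unique hp' hp hh).imp Eq.symm Eq.symm
    obtain ⟨rfl, hx⟩ := hpp
    obtain rfl := hk hx
    obtain rfl := List.append_cancel_left h
    rfl
  have hout : ∀ t : T, Outputs z y (f t) u := fun t =>
    he z y t.1.1.2 _ _ _ _ u t.1.2 (hX _).1 (hX _).2 t.2.2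
  have hlen : ∀ t : T, (2⁻¹ : ℝ≥0∞) ^ (t.1.1.2.length + m t.1.1.1) =
      2 ^ (e + 1) * if Outputs z y (f t) u then (2⁻¹ : ℝ≥0∞) ^ (f t).length else 0 := by
    intro t
    rw [if_pos (hout t), length_word, List.length_append, length_of_mem_paths t.2.2,
      pow_add 2⁻¹ (e + 1), ← mul_assoc, ← mul_pow, ENNReal.mul_inv_cancel (by simp) (by simp), one_pow,
      one_mul]
  simp_rw [hlen]
  rw [ENNReal.tsum_mul_left]
  gcongr
  exact ENNReal.tsum_comp_le_tsum_of_injective hf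
    fun q => if Outputs z y q u then (2⁻¹ : ℝ≥0∞) ^ q.length else 0

/-- This is sampling from the one-element list `[f x]`, with no random bits. -/
theorem exists_uprob_map {f : ℕ → ℕ} (hf : Computable f) : ∃ c : ℝ≥0∞, c ≠ 0 ∧ c ≠ ∞ ∧
    ∀ z x y, uprob z x y ≤ c * uprob z (f x) y := by
  obtain ⟨c, hc0, hc, h⟩ := exists_uprob_sampler
    (G := fun p => Part.some [f p.2]) (Computable.partrec
      (Computable.list_cons.comp (hf.comp Computable.snd) (Computable.const [])))
  refine ⟨c, hc0, hc, fun z x y => ?_⟩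
  have := h z y (f x) (fun _ : Unit => x) (fun _ => [f x]) (fun _ => 0)
    (fun _ _ _ => rfl) (by simp)
  simpa using this

/-- The program that prints `x` ignores both auxiliary tapes, whence the uniformity in `z` and `y`.
-/
theorem exists_uprob_pos (x : ℕ) : ∃ c : ℝ≥0∞, c ≠ 0 ∧ ∀ z y, c ≤ uprob z x y := by
  obtain ⟨q, hq⟩ := exists_program_const x
  refine ⟨2⁻¹ ^ q.length, by simp, fun z y => ?_⟩
  refine le_trans ?_ (ENNReal.le_tsum q)
  rw [if_pos (hq z y).1]

end QAIT

namespace QAIT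

/-! ### Arithmetic of complex numbers with rational parts -/

namespace GaussRat

instance : Zero GaussRat := ⟨⟨0, 0⟩⟩
instance : One GaussRat := ⟨⟨1, 0⟩⟩
instance : Add GaussRat := ⟨fun a b => ⟨a.re + b.re, a.im + b.im⟩⟩
instance : Neg GaussRat := ⟨fun a => ⟨-a.re, -a.im⟩⟩
instance : Mul GaussRat := ⟨fun a b => ⟨a.re * b.re - a.im * b.im, a.re * b.im + a.im * b.re⟩⟩

/-- Complex conjugation. -/
def conj (a : GaussRat) : GaussRat := ⟨a.re, -a.im⟩

/-- Natural numbers as complex numbers with rational parts. -/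
def ofNat (n : ℕ) : GaussRat := ⟨n, 0⟩

theorem add_def (a b : GaussRat) : a + b = ⟨a.re + b.re, a.im + b.im⟩ := rfl
theorem neg_def (a : GaussRat) : -a = ⟨-a.re, -a.im⟩ := rfl
theorem mul_def (a b : GaussRat) :
    a * b = ⟨a.re * b.re - a.im * b.im, a.re * b.im + a.im * b.re⟩ := rfl
theorem zero_def : (0 : GaussRat) = ⟨0, 0⟩ := rfl
theorem one_def : (1 : GaussRat) = ⟨1, 0⟩ := rfl

instance : AddCommMonoid GaussRat where
  add_assoc a b c := by ext <;> simp [add_def, add_assoc]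
  zero_add a := by ext <;> simp [add_def, zero_def]
  add_zero a := by ext <;> simp [add_def, zero_def]
  add_comm a b := by ext <;> simp [add_def, add_comm]
  nsmul := nsmulRec

theorem toComplex_injective : Function.Injective toComplex := by
  intro a b h
  have h1 := congrArg Complex.re h
  have h2 := congrArg Complex.im h
  simp only [toComplex, Rat.cast_inj] at h1 h2
  exact GaussRat.ext h1 h2

@[simp] theorem toComplex_zero : toComplex 0 = 0 := by
  apply Complex.ext <;> simp [toComplex, zero_def]

@[simp] theorem toComplex_one : toComplex 1 = 1 := by
  apply Complex.ext <;> simp [toComplex, one_def]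

@[simp] theorem toComplex_ofNat (n : ℕ) : toComplex (ofNat n) = n := by
  apply Complex.ext <;> simp [toComplex, ofNat]

@[simp] theorem toComplex_add (a b : GaussRat) : toComplex (a + b) = toComplex a + toComplex b := by
  apply Complex.ext <;> simp [toComplex, add_def]

@[simp] theorem toComplex_neg (a : GaussRat) : toComplex (-a) = -toComplex a := by
  apply Complex.ext <;> simp [toComplex, neg_def]

@[simp] theorem toComplex_mul (a b : GaussRat) : toComplex (a * b) = toComplex a * toComplex b := by
  apply Complex.ext <;> simp [toComplex, mul_def]

@[simp] theorem toComplex_conj (a : GaussRat) : toComplex (conj a) = star (toComplex a) := by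
  apply Complex.ext <;> simp [toComplex, conj]

/-- `toComplex` as an additive homomorphism. -/
noncomputable def toComplexHom : GaussRat →+ ℂ where
  toFun := toComplex
  map_zero' := toComplex_zero
  map_add' := toComplex_add

@[simp] theorem toComplex_sum {ι : Type*} (s : Finset ι) (f : ι → GaussRat) :
    toComplex (∑ i ∈ s, f i) = ∑ i ∈ s, toComplex (f i) :=
  map_sum toComplexHom f s

end GaussRat

/-! ### Codes of rational numbers are handled primitive recursively -/

/-- The gcd is the greatest common divisor found by a search bounded by `a + b`. For `a = b = 0`
everything divides, and the bound forces the answer `0`. -/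
theorem primrec_gcd : Primrec₂ Nat.gcd := by
  have hm : ∀ {f g : (ℕ × ℕ) × ℕ → ℕ}, Primrec f → Primrec g →
      PrimrecPred fun p => f p ∣ g p := by
    intro f g hf hg
    exact (Primrec.eq.comp (Primrec.nat_mod.comp hg hf) (Primrec.const 0)).of_eq
      fun p => (Nat.dvd_iff_mod_eq_zero).symm
  have h : PrimrecRel fun (p : ℕ × ℕ) (k : ℕ) => k ∣ p.1 ∧ k ∣ p.2 :=
    ((hm Primrec.snd (Primrec.fst.comp Primrec.fst)).and
      (hm Primrec.snd (Primrec.snd.comp Primrec.fst))).primrecRel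
  refine (Primrec.nat_findGreatest (f := fun p : ℕ × ℕ => p.1 + p.2)
    (Primrec.nat_add.comp Primrec.fst Primrec.snd) h).of_eq fun p => ?_
  obtain ⟨a, b⟩ := p
  rw [Nat.findGreatest_eq_iff]
  refine ⟨?_, fun _ => ⟨Nat.gcd_dvd_left a b, Nat.gcd_dvd_right a b⟩, fun n hn hle hdvd => ?_⟩
  · rcases Nat.eq_zero_or_pos a with rfl | ha
    · simp
    · exact (Nat.gcd_le_left b ha).trans (Nat.le_add_right a b)
  · have hd := Nat.dvd_gcd hdvd.1 hdvd.2
    rcases Nat.eq_zero_or_pos (a.gcd b) with h0 | h0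
    · have := Nat.gcd_eq_zero_iff.1 h0
      dsimp only at hle
      omega
    · exact absurd (Nat.le_of_dvd h0 hd) (by dsimp only at hn; omega)

/-- Positive part of an integer, from its code. -/
def posPart (c : ℕ) : ℕ := if c % 2 = 0 then c / 2 else 0

/-- Negative part of an integer, from its code. -/
def negPart (c : ℕ) : ℕ := if c % 2 = 0 then 0 else c / 2 + 1

theorem primrec_posPart : Primrec posPart :=
  Primrec.ite (Primrec.eq.comp (Primrec.nat_mod.comp Primrec.id (Primrec.const 2)) (Primrec.const 0))
    (Primrec.nat_div.comp Primrec.id (Primrec.const 2)) (Primrec.const 0)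

theorem primrec_negPart : Primrec negPart :=
  Primrec.ite (Primrec.eq.comp (Primrec.nat_mod.comp Primrec.id (Primrec.const 2)) (Primrec.const 0))
    (Primrec.const 0) (Primrec.succ.comp (Primrec.nat_div.comp Primrec.id (Primrec.const 2)))

theorem encode_ofNat (n : ℕ) : Encodable.encode (n : ℤ) = 2 * n := rfl

theorem encode_negSucc (n : ℕ) : Encodable.encode (Int.negSucc n) = 2 * n + 1 := rfl

theorem posPart_sub_negPart (a : ℤ) :
    (posPart (Encodable.encode a) : ℤ) - negPart (Encodable.encode a) = a := by
  cases a with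
  | ofNat n =>
    rw [Int.ofNat_eq_natCast, encode_ofNat]
    simp [posPart, negPart]
  | negSucc n =>
    rw [encode_negSucc]
    have h1 : (2 * n + 1) % 2 = 1 := by omega
    have h2 : (2 * n + 1) / 2 = n := by omega
    simp [posPart, negPart, h1, h2, Int.negSucc_eq]

/-- The code of the rational number `(p - m) / d`. -/
def fracCode (p m d : ℕ) : ℕ :=
  let k := (p - m) + (m - p)
  let g := k.gcd d
  Nat.pair (if m ≤ p then 2 * (k / g) else 2 * (k / g) - 1) (d / g)

/-- The code of a rational requires lowest terms. This lets arithmetic produce unreduced fractions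
of natural numbers and reduces them only at the end. -/
theorem ratCode_frac (p m d : ℕ) (hd : d ≠ 0) :
    ratCode (((p : ℚ) - m) / d) = fracCode p m d := by
  have hg : ∀ k : ℕ, 0 < k.gcd d := fun k => Nat.gcd_pos_of_pos_right _ (Nat.pos_of_ne_zero hd)
  have key : ∀ k : ℕ, ((k : ℚ) / d).num = (k / k.gcd d : ℕ) ∧ ((k : ℚ) / d).den = d / k.gcd d := by
    intro k
    have h1 : ((k : ℚ) / d) = ((k / k.gcd d : ℕ) : ℚ) / ((d / k.gcd d : ℕ) : ℚ) := by
      have hg' : ((k.gcd d : ℕ) : ℚ) ≠ 0 := by have := hg k; positivity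
      rw [Nat.cast_div (Nat.gcd_dvd_left _ _) hg', Nat.cast_div (Nat.gcd_dvd_right _ _) hg']
      field_simp
    have hpos : 0 < d / k.gcd d := Nat.div_pos
      (Nat.le_of_dvd (Nat.pos_of_ne_zero hd) (Nat.gcd_dvd_right _ _)) (hg k)
    have hc : (k / k.gcd d).Coprime (d / k.gcd d) := Nat.coprime_div_gcd_div_gcd (hg k)
    rw [h1]
    generalize k / k.gcd d = u at *
    generalize d / k.gcd d = v at *
    have hu : ((u : ℤ)).natAbs.Coprime ((v : ℤ)).natAbs := by simpa using hc
    have hn := Rat.num_div_eq_of_coprime (a := (u : ℤ)) (b := (v : ℤ)) (by exact_mod_cast hpos) hu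
    have hd := Rat.den_div_eq_of_coprime (a := (u : ℤ)) (b := (v : ℤ)) (by exact_mod_cast hpos) hu
    simp only [Int.cast_natCast, Nat.cast_inj] at hn hd
    exact ⟨hn, hd⟩
  unfold fracCode ratCode
  by_cases h : m ≤ p
  · have hk : (p - m) + (m - p) = p - m := by omega
    have hq : ((p : ℚ) - m) = ((p - m : ℕ) : ℚ) := by push_cast [h]; rfl
    simp only [hk, if_pos h]
    rw [hq, (key _).1, (key _).2, encode_ofNat]
  · have hk : (p - m) + (m - p) = m - p := by omega
    have hq : ((p : ℚ) - m) / d = -(((m - p : ℕ) : ℚ) / d) := by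
      rw [Nat.cast_sub (by omega)]; ring
    simp only [hk, if_neg h]
    rw [hq, Rat.neg_num, Rat.neg_den, (key _).1, (key _).2]
    congr 1
    have hpos : 0 < (m - p) / (m - p).gcd d :=
      Nat.div_pos (Nat.le_of_dvd (by omega) (Nat.gcd_dvd_left _ _)) (hg _)
    obtain ⟨t, ht⟩ := Nat.exists_eq_succ_of_ne_zero hpos.ne'
    rw [ht]
    -- The numerator `-(t + 1)` has code `2 * t + 1`, which is `2 * k - 1` for the absolute value `k
    -- = t + 1`.
    have : (-((t.succ : ℕ) : ℤ)) = Int.negSucc t := rfl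
    rw [this, encode_negSucc]
    omega

theorem primrec_fracCode {α : Type} [Primcodable α] {p m d : α → ℕ} (hp : Primrec p)
    (hm : Primrec m) (hd : Primrec d) : Primrec fun a => fracCode (p a) (m a) (d a) := by
  have hk : Primrec fun a => (p a - m a) + (m a - p a) :=
    Primrec.nat_add.comp (Primrec.nat_sub.comp hp hm) (Primrec.nat_sub.comp hm hp)
  have hg := primrec_gcd.comp hk hd
  have h2 := Primrec.nat_mul.comp (Primrec.const 2) (Primrec.nat_div.comp hk hg)
  exact Primrec₂.natPair.comp (Primrec.ite (Primrec.nat_le.comp hm hp) h2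
    (Primrec.nat_sub.comp h2 (Primrec.const 1))) (Primrec.nat_div.comp hd hg)

/-- Pairs of a numerator and a denominator in lowest terms. -/
abbrev LowestTerms : Type := {p : ℤ × ℕ // p.2 ≠ 0 ∧ p.1.natAbs.gcd p.2 = 1}

theorem primrecPred_lowestTerms :
    PrimrecPred fun p : ℤ × ℕ => p.2 ≠ 0 ∧ p.1.natAbs.gcd p.2 = 1 := by
  have h : Primrec fun p : ℤ × ℕ => p.1.natAbs := by
    refine (Primrec.nat_add.comp (primrec_posPart.comp (Primrec.encode.comp Primrec.fst))
      (primrec_negPart.comp (Primrec.encode.comp Primrec.fst))).of_eq fun p => ?_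
    obtain ⟨a, b⟩ := p
    cases a with
    | ofNat n =>
      change posPart (2 * n) + negPart (2 * n) = n
      simp [posPart, negPart]
    | negSucc n =>
      change posPart (2 * n + 1) + negPart (2 * n + 1) = n + 1
      have h1 : (2 * n + 1) % 2 = 1 := by omega
      have h2 : (2 * n + 1) / 2 = n := by omega
      simp [posPart, negPart, h1, h2]
  exact (Primrec.eq.comp Primrec.snd (Primrec.const 0)).not.and
    (Primrec.eq.comp (primrec_gcd.comp h Primrec.snd) (Primrec.const 1))

instance : Primcodable LowestTerms := Primcodable.subtype primrecPred_lowestTerms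

/-- Rational numbers as pairs in lowest terms. -/
def lowestTermsEquiv : ℚ ≃ LowestTerms where
  toFun a := ⟨(a.num, a.den), a.den_nz, a.reduced⟩
  invFun p := ⟨p.1.1, p.1.2, p.2.1, p.2.2⟩
  left_inv _ := rfl
  right_inv _ := rfl

/-- Complex numbers with rational parts as pairs. -/
def gaussRatEquiv : GaussRat ≃ LowestTerms × LowestTerms where
  toFun a := (lowestTermsEquiv a.re, lowestTermsEquiv a.im)
  invFun p := ⟨lowestTermsEquiv.symm p.1, lowestTermsEquiv.symm p.2⟩
  left_inv _ := rfl
  right_inv _ := rfl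

instance : Primcodable GaussRat := Primcodable.ofEquiv _ gaussRatEquiv

/-- The passage through `LowestTerms` was chosen to make this definitional: the `Primcodable`
encoding is the prescribed code. -/
theorem encode_gaussRat (a : GaussRat) : Encodable.encode a = a.code := rfl

section

variable {α : Type} [Primcodable α] {f g : α → GaussRat}

/-- With its converse `exists_primrec_parts`, this reduces primitive recursiveness of the field
operations to identities between fractions with natural number parts, a sign being a difference `p -
m`. -/
theorem primrec_gaussRat {p m d p' m' d' : α → ℕ} (hp : Primrec p) (hm : Primrec m)
    (hd : Primrec d) (hp' : Primrec p') (hm' : Primrec m') (hd' : Primrec d')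
    (h0 : ∀ a, d a ≠ 0) (h0' : ∀ a, d' a ≠ 0)
    (hre : ∀ a, (f a).re = ((p a : ℚ) - m a) / d a) (him : ∀ a, (f a).im = ((p' a : ℚ) - m' a) / d' a) :
    Primrec f := by
  refine Primrec.encode_iff.1 ((Primrec₂.natPair.comp (primrec_fracCode hp hm hd)
    (primrec_fracCode hp' hm' hd')).of_eq fun a => ?_)
  rw [encode_gaussRat, GaussRat.code, hre, him, ratCode_frac _ _ _ (h0 a), ratCode_frac _ _ _ (h0' a)]

theorem exists_primrec_parts (hf : Primrec f) : ∃ p m d p' m' d' : α → ℕ,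
    (Primrec p ∧ Primrec m ∧ Primrec d) ∧ (Primrec p' ∧ Primrec m' ∧ Primrec d') ∧
    (∀ a, (d a : ℚ) ≠ 0) ∧ (∀ a, (d' a : ℚ) ≠ 0) ∧
    (∀ a, (f a).re = ((p a : ℚ) - m a) / d a) ∧ ∀ a, (f a).im = ((p' a : ℚ) - m' a) / d' a := by
  have hc : Primrec fun a => (f a).code := Primrec.encode.comp hf
  have u1 : Primrec fun n : ℕ => n.unpair.1 := Primrec.fst.comp Primrec.unpair
  have u2 : Primrec fun n : ℕ => n.unpair.2 := Primrec.snd.comp Primrec.unpair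
  have hr : ∀ q : ℚ, q = ((posPart (Encodable.encode q.num) : ℚ) - negPart (Encodable.encode q.num)) / q.den := by
    intro q
    have := congrArg (Int.cast : ℤ → ℚ) (posPart_sub_negPart q.num)
    push_cast at this
    rw [this, Rat.num_div_den]
  refine ⟨fun a => posPart (Encodable.encode (f a).re.num), fun a => negPart (Encodable.encode (f a).re.num),
    fun a => (f a).re.den, fun a => posPart (Encodable.encode (f a).im.num),
    fun a => negPart (Encodable.encode (f a).im.num), fun a => (f a).im.den,
    ⟨?_, ?_, ?_⟩, ⟨?_, ?_, ?_⟩, fun a => by exact_mod_cast (f a).re.den_nz,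
    fun a => by exact_mod_cast (f a).im.den_nz, fun a => hr _, fun a => hr _⟩
  · exact (primrec_posPart.comp (u1.comp (u1.comp hc))).of_eq
      fun a => by simp [GaussRat.code, ratCode]
  · exact (primrec_negPart.comp (u1.comp (u1.comp hc))).of_eq
      fun a => by simp [GaussRat.code, ratCode]
  · exact (u2.comp (u1.comp hc)).of_eq fun a => by simp [GaussRat.code, ratCode]
  · exact (primrec_posPart.comp (u1.comp (u2.comp hc))).of_eq
      fun a => by simp [GaussRat.code, ratCode]
  · exact (primrec_negPart.comp (u1.comp (u2.comp hc))).of_eq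
      fun a => by simp [GaussRat.code, ratCode]
  · exact (u2.comp (u2.comp hc)).of_eq fun a => by simp [GaussRat.code, ratCode]

theorem primrec_conj (hf : Primrec f) : Primrec fun a => (f a).conj := by
  obtain ⟨p, m, d, p', m', d', ⟨hp, hm, hd⟩, ⟨hp', hm', hd'⟩, h0, h0', hre, him⟩ :=
    exists_primrec_parts hf
  -- Conjugation exchanges the positive and the negative part of the imaginary numerator.
  refine primrec_gaussRat hp hm hd hm' hp' hd' (fun a => by exact_mod_cast h0 a)
    (fun a => by exact_mod_cast h0' a) hre fun a => ?_
  simp only [GaussRat.conj, him]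
  ring

theorem primrec_add (hf : Primrec f) (hg : Primrec g) : Primrec fun a => f a + g a := by
  obtain ⟨p, m, d, p', m', d', ⟨hp, hm, hd⟩, ⟨hp', hm', hd'⟩, h0, h0', hre, him⟩ :=
    exists_primrec_parts hf
  obtain ⟨q, n, e, q', n', e', ⟨hq, hn, he⟩, ⟨hq', hn', he'⟩, k0, k0', kre, kim⟩ :=
    exists_primrec_parts hg
  have add {u v : α → ℕ} (hu : Primrec u) (hv : Primrec v) : Primrec fun a => u a + v a :=
    Primrec.nat_add.comp hu hv
  have mul {u v : α → ℕ} (hu : Primrec u) (hv : Primrec v) : Primrec fun a => u a * v a :=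
    Primrec.nat_mul.comp hu hv
  refine primrec_gaussRat (add (mul hp he) (mul hq hd)) (add (mul hm he) (mul hn hd)) (mul hd he)
    (add (mul hp' he') (mul hq' hd')) (add (mul hm' he') (mul hn' hd')) (mul hd' he')
    (fun a => by exact_mod_cast mul_ne_zero (h0 a) (k0 a))
    (fun a => by exact_mod_cast mul_ne_zero (h0' a) (k0' a)) (fun a => ?_) fun a => ?_
  · have := h0 a; have := k0 a
    simp only [GaussRat.add_def, hre, kre]
    push_cast
    field_simp
    ring
  · have := h0' a; have := k0' a
    simp only [GaussRat.add_def, him, kim]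
    push_cast
    field_simp
    ring

theorem primrec_mul (hf : Primrec f) (hg : Primrec g) : Primrec fun a => f a * g a := by
  obtain ⟨p, m, d, p', m', d', ⟨hp, hm, hd⟩, ⟨hp', hm', hd'⟩, h0, h0', hre, him⟩ :=
    exists_primrec_parts hf
  obtain ⟨q, n, e, q', n', e', ⟨hq, hn, he⟩, ⟨hq', hn', he'⟩, k0, k0', kre, kim⟩ :=
    exists_primrec_parts hg
  have add {u v : α → ℕ} (hu : Primrec u) (hv : Primrec v) : Primrec fun a => u a + v a :=
    Primrec.nat_add.comp hu hv
  have mul {u v : α → ℕ} (hu : Primrec u) (hv : Primrec v) : Primrec fun a => u a * v a :=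
    Primrec.nat_mul.comp hu hv
  have D := mul (mul hd he) (mul hd' he')
  have D0 : ∀ a, d a * e a * (d' a * e' a) ≠ 0 := fun a => by
    exact_mod_cast mul_ne_zero (mul_ne_zero (h0 a) (k0 a)) (mul_ne_zero (h0' a) (k0' a))
  refine primrec_gaussRat
    (add (mul (add (mul hp hq) (mul hm hn)) (mul hd' he')) (mul (add (mul hp' hn') (mul hm' hq')) (mul hd he)))
    (add (mul (add (mul hp hn) (mul hm hq)) (mul hd' he')) (mul (add (mul hp' hq') (mul hm' hn')) (mul hd he)))
    D
    (add (mul (add (mul hp hq') (mul hm hn')) (mul hd' he)) (mul (add (mul hp' hq) (mul hm' hn)) (mul hd he')))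
    (add (mul (add (mul hp hn') (mul hm hq')) (mul hd' he)) (mul (add (mul hp' hn) (mul hm' hq)) (mul hd he')))
    D D0 D0 (fun a => ?_) fun a => ?_
  · have := h0 a; have := k0 a; have := h0' a; have := k0' a
    simp only [GaussRat.mul_def, hre, kre, him, kim]
    push_cast
    field_simp
    ring
  · have := h0 a; have := k0 a; have := h0' a; have := k0' a
    simp only [GaussRat.mul_def, hre, kre, him, kim]
    push_cast
    field_simp
    ring

theorem primrec_ofNat {n : α → ℕ} (hn : Primrec n) : Primrec fun a => GaussRat.ofNat (n a) :=
  primrec_gaussRat hn (Primrec.const 0) (Primrec.const 1) (Primrec.const 0) (Primrec.const 0)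
    (Primrec.const 1) (by simp) (by simp) (by simp [GaussRat.ofNat]) (by simp [GaussRat.ofNat])

theorem primrec_sum {n : α → ℕ} {f : α → ℕ → GaussRat} (hn : Primrec n) (hf : Primrec₂ f) :
    Primrec fun a => ∑ i ∈ Finset.range (n a), f a i := by
  refine (Primrec.nat_rec' (g := fun _ => (0 : GaussRat)) (h := fun a p => p.2 + f a p.1) hn
    (Primrec.const 0) (primrec_add (Primrec.snd.comp Primrec.snd)
      (hf.comp Primrec.fst (Primrec.fst.comp Primrec.snd))).to₂).of_eq fun a => ?_
  induction n a with
  | zero => rfl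
  | succ k ih => rw [Finset.sum_range_succ, ← ih]

theorem primrec_listSum {β : Type} [Primcodable β] {l : α → List β} {f : α → β → GaussRat}
    (hl : Primrec l) (hf : Primrec₂ f) : Primrec fun a => ((l a).map (f a)).sum := by
  refine (Primrec.list_foldr (g := fun _ => (0 : GaussRat)) (h := fun a p => f a p.1 + p.2) hl
    (Primrec.const 0) (primrec_add (hf.comp Primrec.fst (Primrec.fst.comp Primrec.snd))
      (Primrec.snd.comp Primrec.snd)).to₂).of_eq fun a => ?_
  induction l a with
  | nil => rfl
  | cons b l ih => simp [ih]

end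

end QAIT

namespace QAIT

/-! ### Lists of rows -/

/-- The entries of a matrix that is given by the list of its rows. -/
def entry (M : List (List GaussRat)) (i j : ℕ) : GaussRat := (M.getD i []).getD j 0

/-- The list of the rows of an `n × m` matrix. -/
def table (n m : ℕ) (f : ℕ → ℕ → GaussRat) : List (List GaussRat) :=
  (List.range n).map fun i => (List.range m).map (f i)

/-- Hence `vecCode` and `matCode` are the `Encodable` codes of a list and of a list of lists, and
machines can decode them. -/
theorem encode_map_encode {α : Type} [Encodable α] (l : List α) :
    Encodable.encode (l.map Encodable.encode) = Encodable.encode l := by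
  induction l with
  | nil => rfl
  | cons a l ih => rw [List.map_cons, Encodable.encode_list_cons, ih]; rfl

theorem vecCode_eq {d : ℕ} (v : Fin d → GaussRat) : vecCode v = Encodable.encode (List.ofFn v) := by
  rw [← encode_map_encode, List.map_ofFn]
  rfl

theorem table_eq_ofFn (n m : ℕ) (f : ℕ → ℕ → GaussRat) :
    table n m f = List.ofFn fun i : Fin n => List.ofFn fun j : Fin m => f i j := by
  unfold table
  refine List.ext_getElem (by simp) fun i h1 h2 => ?_
  simp only [List.getElem_map, List.getElem_range, List.getElem_ofFn]
  exact List.ext_getElem (by simp) fun j h3 h4 => by simp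

theorem matCode_eq {d : ℕ} (M : Matrix (Fin d) (Fin d) GaussRat) :
    matCode M = Encodable.encode (List.ofFn fun i => List.ofFn (M i)) := by
  rw [← encode_map_encode, List.map_ofFn, matCode]
  congr 2
  funext i
  exact vecCode_eq _

theorem getD_ofFn {α : Type} {d : ℕ} (v : Fin d → α) (i : Fin d) (a : α) :
    (List.ofFn v).getD i a = v i := by
  simp

theorem entry_ofFn {n m : ℕ} (M : Fin n → Fin m → GaussRat) (i : Fin n) (j : Fin m) :
    entry (List.ofFn fun i => List.ofFn (M i)) i j = M i j := by
  rw [entry, getD_ofFn, getD_ofFn]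

theorem table_inj {n m : ℕ} {f g : ℕ → ℕ → GaussRat} :
    table n m f = table n m g ↔ ∀ (i : Fin n) (j : Fin m), f i j = g i j := by
  rw [table_eq_ofFn, table_eq_ofFn]
  constructor
  · intro h i j
    rw [← entry_ofFn (fun (i : Fin n) (j : Fin m) => f i j) i j, h, entry_ofFn]
  · intro h
    congr; funext i; congr; funext j; exact h i j

section

variable {α : Type} [Primcodable α]

theorem primrec_entry {M : α → List (List GaussRat)} {i j : α → ℕ} (hM : Primrec M) (hi : Primrec i)
    (hj : Primrec j) : Primrec fun a => entry (M a) (i a) (j a) :=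
  (Primrec.list_getD _).comp ((Primrec.list_getD _).comp hM hi) hj

theorem primrec_table {n m : α → ℕ} {f : α → ℕ → ℕ → GaussRat} (hn : Primrec n) (hm : Primrec m)
    (hf : Primrec fun p : (α × ℕ) × ℕ => f p.1.1 p.1.2 p.2) :
    Primrec fun a => table (n a) (m a) (f a) :=
  Primrec.list_map (Primrec.list_range.comp hn)
    (Primrec.list_map (f := fun p : α × ℕ => List.range (m p.1)) (g := fun p j => f p.1 p.2 j)
      (Primrec.list_range.comp (hm.comp Primrec.fst)) hf.to₂).to₂

theorem primrec_pow {f g : α → ℕ} (hf : Primrec f) (hg : Primrec g) :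
    Primrec fun a => f a ^ g a :=
  (Primrec₂.unpaired'.1 Nat.Primrec.pow).comp hf hg

end

/-! ### The action of a gate `C` on a state and the ancilla `|0ⁿ⟩`, in terms of rows -/

/-- The number of rows of `C` is the square of this dimension. -/
def dim (C : List (List GaussRat)) : ℕ := C.length.sqrt

/-- The matrix `s ↦ ⟨a, j| C |s, 0⟩` (or `⟨j, a| C |s, 0⟩`), with row index `a`. -/
def krausEntry (side : Bool) (C : List (List GaussRat)) (j a s : ℕ) : GaussRat :=
  entry C (cond side (j + dim C * a) (a + dim C * j)) (dim C * s)

/-- The slices, over the values of one output register, of the image of a vector. -/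
def slices (side : Bool) (C : List (List GaussRat)) (θ : List GaussRat) : List (List GaussRat) :=
  table (dim C) (dim C) fun j a =>
    ∑ s ∈ Finset.range (dim C), krausEntry side C j a s * θ.getD s 0

/-- The sum of the projectors of the vectors of a list. -/
def gram (L : List (List GaussRat)) (a b : ℕ) : GaussRat :=
  (L.map fun u => u.getD a 0 * (u.getD b 0).conj).sum

/-- The square of the norm of a vector. -/
def listNormSq (u : List GaussRat) : GaussRat := (u.map fun x => x * x.conj).sum

/-- A certificate that the reduced state of the image of `θ` is dominated by the uniform mixture of
a list of unit vectors. -/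
def IsCertificate (side : Bool) (C : List (List GaussRat)) (θ : List GaussRat)
    (c : (ℕ × ℕ) × List (List GaussRat) × List (List GaussRat)) : Prop :=
  c.2.1.length = 2 ^ c.1.2 ∧ 2 ^ c.1.2 ≤ 4 * c.1.1 ∧
  (∀ u ∈ c.2.1, u.length = dim C ∧ listNormSq u = 1) ∧
  table (dim C) (dim C) (gram c.2.1) = table (dim C) (dim C)
    fun a b => GaussRat.ofNat c.1.1 * gram (slices side C θ) a b + gram c.2.2 a b

/-- The entries of the product of two of the matrices `krausEntry`. -/
def krausProd (C : List (List GaussRat)) (k p q : ℕ) : GaussRat :=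
  krausEntry true C (k / dim C) (p / dim C) (q / dim C) *
    krausEntry false C (k % dim C) (p % dim C) (q % dim C)

/-- The pull back of a matrix on the output registers to two copies of the input. -/
def pullBack (κ : GaussRat) (C M : List (List GaussRat)) : List (List GaussRat) :=
  table C.length C.length fun p q => κ * ∑ k ∈ Finset.range C.length, ∑ r ∈ Finset.range C.length,
    ∑ s ∈ Finset.range C.length, (krausProd C k r p).conj * entry M r s * krausProd C k s q

section

variable {α : Type} [Primcodable α]

theorem primrec_dim {C : α → List (List GaussRat)} (hC : Primrec C) : Primrec fun a => dim (C a) :=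
  Primrec.nat_sqrt.comp (Primrec.list_length.comp hC)

theorem primrec_krausEntry (side : Bool) {C : α → List (List GaussRat)} {j a s : α → ℕ}
    (hC : Primrec C) (hj : Primrec j) (ha : Primrec a) (hs : Primrec s) :
    Primrec fun x => krausEntry side (C x) (j x) (a x) (s x) := by
  have hd := primrec_dim hC
  refine primrec_entry hC ?_ (Primrec.nat_mul.comp hd hs)
  cases side
  · exact Primrec.nat_add.comp ha (Primrec.nat_mul.comp hd hj)
  · exact Primrec.nat_add.comp hj (Primrec.nat_mul.comp hd ha)

theorem primrec_slices (side : Bool) {C : α → List (List GaussRat)} {θ : α → List GaussRat}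
    (hC : Primrec C) (hθ : Primrec θ) : Primrec fun x => slices side (C x) (θ x) := by
  refine primrec_table (primrec_dim hC) (primrec_dim hC) ?_
  have hC' : Primrec fun p : (α × ℕ) × ℕ => C p.1.1 := hC.comp (Primrec.fst.comp Primrec.fst)
  refine primrec_sum (f := fun (p : (α × ℕ) × ℕ) s =>
    krausEntry side (C p.1.1) p.1.2 p.2 s * (θ p.1.1).getD s 0) (primrec_dim hC') ?_
  have hg : Primrec fun q : ((α × ℕ) × ℕ) × ℕ => (θ q.1.1.1).getD q.2 0 := (Primrec.list_getD 0).comp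
    (hθ.comp (Primrec.fst.comp (Primrec.fst.comp Primrec.fst))) Primrec.snd
  exact primrec_mul (primrec_krausEntry side (hC'.comp Primrec.fst)
    (Primrec.snd.comp (Primrec.fst.comp Primrec.fst)) (Primrec.snd.comp Primrec.fst) Primrec.snd) hg

theorem primrec_gram {L : α → List (List GaussRat)} {a b : α → ℕ} (hL : Primrec L) (ha : Primrec a)
    (hb : Primrec b) : Primrec fun x => gram (L x) (a x) (b x) :=
  primrec_listSum hL (primrec_mul ((Primrec.list_getD _).comp Primrec.snd (ha.comp Primrec.fst))
    (primrec_conj ((Primrec.list_getD _).comp Primrec.snd (hb.comp Primrec.fst)))).to₂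

theorem primrec_listNormSq {u : α → List GaussRat} (hu : Primrec u) :
    Primrec fun x => listNormSq (u x) :=
  primrec_listSum hu (primrec_mul Primrec.snd (primrec_conj Primrec.snd)).to₂

theorem primrecPred_isCertificate (side : Bool) {C : α → List (List GaussRat)}
    {θ : α → List GaussRat} {c : α → (ℕ × ℕ) × List (List GaussRat) × List (List GaussRat)}
    (hC : Primrec C) (hθ : Primrec θ) (hc : Primrec c) :
    PrimrecPred fun x => IsCertificate side (C x) (θ x) (c x) := by
  have hd := primrec_dim hC
  have hD : Primrec fun x => (c x).1.1 := Primrec.fst.comp (Primrec.fst.comp hc)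
  have hm : Primrec fun x => (c x).1.2 := Primrec.snd.comp (Primrec.fst.comp hc)
  have hu : Primrec fun x => (c x).2.1 := Primrec.fst.comp (Primrec.snd.comp hc)
  have hv : Primrec fun x => (c x).2.2 := Primrec.snd.comp (Primrec.snd.comp hc)
  have hpow : Primrec fun x => 2 ^ (c x).1.2 := primrec_pow (Primrec.const 2) hm
  have h1 : PrimrecPred fun x => (c x).2.1.length = 2 ^ (c x).1.2 :=
    Primrec.eq.comp (Primrec.list_length.comp hu) hpow
  have h2 : PrimrecPred fun x => 2 ^ (c x).1.2 ≤ 4 * (c x).1.1 :=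
    Primrec.nat_le.comp hpow (Primrec.nat_mul.comp (Primrec.const 4) hD)
  have h3 : PrimrecPred fun x => ∀ u ∈ (c x).2.1, u.length = dim (C x) ∧ listNormSq u = 1 := by
    have h : PrimrecRel fun (u : List GaussRat) (d : ℕ) => u.length = d ∧ listNormSq u = 1 :=
      ((Primrec.eq.comp (Primrec.list_length.comp Primrec.fst) Primrec.snd).and
        (Primrec.eq.comp (primrec_listNormSq Primrec.fst) (Primrec.const 1))).primrecRel
    exact h.forall_mem_list.comp hu hd
  refine h1.and (h2.and (h3.and (Primrec.eq.comp (primrec_table hd hd ?_) (primrec_table hd hd ?_))))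
  · exact primrec_gram (hu.comp (Primrec.fst.comp Primrec.fst)) (Primrec.snd.comp Primrec.fst)
      Primrec.snd
  · refine primrec_add (primrec_mul (primrec_ofNat (hD.comp (Primrec.fst.comp Primrec.fst)))
      (primrec_gram (primrec_slices side (hC.comp (Primrec.fst.comp Primrec.fst))
        (hθ.comp (Primrec.fst.comp Primrec.fst))) (Primrec.snd.comp Primrec.fst) Primrec.snd))
      (primrec_gram (hv.comp (Primrec.fst.comp Primrec.fst)) (Primrec.snd.comp Primrec.fst)
        Primrec.snd)

theorem primrec_krausProd {C : α → List (List GaussRat)} {k p q : α → ℕ}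
    (hC : Primrec C) (hk : Primrec k) (hp : Primrec p) (hq : Primrec q) :
    Primrec fun x => krausProd (C x) (k x) (p x) (q x) := by
  have hd := primrec_dim hC
  exact primrec_mul (primrec_krausEntry true hC (Primrec.nat_div.comp hk hd)
    (Primrec.nat_div.comp hp hd) (Primrec.nat_div.comp hq hd))
    (primrec_krausEntry false hC (Primrec.nat_mod.comp hk hd)
    (Primrec.nat_mod.comp hp hd) (Primrec.nat_mod.comp hq hd))

theorem primrec_pullBack (κ : GaussRat) {C M : α → List (List GaussRat)} (hC : Primrec C)
    (hM : Primrec M) : Primrec fun x => pullBack κ (C x) (M x) := by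
  have hl := Primrec.list_length.comp hC
  refine primrec_table hl hl (primrec_mul (Primrec.const κ) ?_)
  have c1 : Primrec fun p : (α × ℕ) × ℕ => p.1.1 := Primrec.fst.comp Primrec.fst
  refine primrec_sum (f := fun (t : (α × ℕ) × ℕ) k => ∑ r ∈ Finset.range (C t.1.1).length,
    ∑ s ∈ Finset.range (C t.1.1).length, (krausProd (C t.1.1) k r t.1.2).conj * entry (M t.1.1) r s *
      krausProd (C t.1.1) k s t.2) (hl.comp c1) ?_
  have c2 : Primrec fun p : ((α × ℕ) × ℕ) × ℕ => p.1.1.1 := c1.comp Primrec.fst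
  refine primrec_sum (f := fun (t : ((α × ℕ) × ℕ) × ℕ) r =>
    ∑ s ∈ Finset.range (C t.1.1.1).length, (krausProd (C t.1.1.1) t.2 r t.1.1.2).conj *
      entry (M t.1.1.1) r s * krausProd (C t.1.1.1) t.2 s t.1.2) (hl.comp c2) ?_
  have c3 : Primrec fun p : (((α × ℕ) × ℕ) × ℕ) × ℕ => p.1.1.1.1 := c2.comp Primrec.fst
  refine primrec_sum (f := fun (t : (((α × ℕ) × ℕ) × ℕ) × ℕ) s =>
    (krausProd (C t.1.1.1.1) t.1.2 t.2 t.1.1.1.2).conj *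
      entry (M t.1.1.1.1) t.2 s * krausProd (C t.1.1.1.1) t.1.2 s t.1.1.2) (hl.comp c3) ?_
  have c4 : Primrec fun p : ((((α × ℕ) × ℕ) × ℕ) × ℕ) × ℕ => p.1.1.1.1.1 := c3.comp Primrec.fst
  have d1 : Primrec fun p : ((((α × ℕ) × ℕ) × ℕ) × ℕ) × ℕ => p.1 := Primrec.fst
  have d2 : Primrec fun p : ((((α × ℕ) × ℕ) × ℕ) × ℕ) × ℕ => p.1.1 := Primrec.fst.comp d1
  have d3 : Primrec fun p : ((((α × ℕ) × ℕ) × ℕ) × ℕ) × ℕ => p.1.1.1 := Primrec.fst.comp d2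
  have d4 : Primrec fun p : ((((α × ℕ) × ℕ) × ℕ) × ℕ) × ℕ => p.1.1.1.1 := Primrec.fst.comp d3
  exact primrec_mul (primrec_mul
    (primrec_conj (primrec_krausProd (hC.comp c4) (Primrec.snd.comp d2) (Primrec.snd.comp d1)
      (Primrec.snd.comp d4)))
    (primrec_entry (hM.comp c4) (Primrec.snd.comp d1) Primrec.snd))
    (primrec_krausProd (hC.comp c4) (Primrec.snd.comp d2) Primrec.snd (Primrec.snd.comp d3))

end

/-! ### Decoding of inputs and the search for certificates. -/

/-- The list of rows with the given code. -/
def decodeRows (z : ℕ) : List (List GaussRat) := (Encodable.decode z).getD []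

/-- The vector with the given code. -/
def decodeVec (x : ℕ) : List GaussRat := (Encodable.decode x).getD []

theorem primrec_decodeRows : Primrec decodeRows :=
  Primrec.option_getD.comp Primrec.decode (Primrec.const [])

theorem primrec_decodeVec : Primrec decodeVec :=
  Primrec.option_getD.comp Primrec.decode (Primrec.const [])

theorem decodeRows_matCode {d : ℕ} (M : Matrix (Fin d) (Fin d) GaussRat) :
    decodeRows (matCode M) = List.ofFn fun i => List.ofFn (M i) := by
  rw [decodeRows, matCode_eq, Encodable.encodek]; rfl

theorem decodeVec_vecCode {d : ℕ} (v : Fin d → GaussRat) : decodeVec (vecCode v) = List.ofFn v := by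
  rw [decodeVec, vecCode_eq, Encodable.encodek]; rfl

open scoped Classical in
/-- The codes of the unit vectors of the first certificate. -/
noncomputable def search (side : Bool) (p : (ℕ × ℕ) × ℕ) : Part (List ℕ) :=
  Nat.rfindOpt fun n =>
    (Encodable.decode n : Option ((ℕ × ℕ) × List (List GaussRat) × List (List GaussRat))).bind fun c =>
      if IsCertificate side (decodeRows p.1.1) (decodeVec p.2) c then
        some (c.2.1.map Encodable.encode) else none

theorem partrec_search (side : Bool) : Partrec (search side) := by
  classical
  have hC : Primrec fun q : (((ℕ × ℕ) × ℕ) × ℕ) ×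
      (ℕ × ℕ) × List (List GaussRat) × List (List GaussRat) => decodeRows q.1.1.1.1 :=
    primrec_decodeRows.comp (Primrec.fst.comp (Primrec.fst.comp (Primrec.fst.comp Primrec.fst)))
  have hθ : Primrec fun q : (((ℕ × ℕ) × ℕ) × ℕ) ×
      (ℕ × ℕ) × List (List GaussRat) × List (List GaussRat) => decodeVec q.1.1.2 :=
    primrec_decodeVec.comp (Primrec.snd.comp (Primrec.fst.comp Primrec.fst))
  have hcert := primrecPred_isCertificate side hC hθ Primrec.snd
  have hl : Primrec fun q : (((ℕ × ℕ) × ℕ) × ℕ) ×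
      (ℕ × ℕ) × List (List GaussRat) × List (List GaussRat) => q.2.2.1.map Encodable.encode :=
    Primrec.list_map (Primrec.fst.comp (Primrec.snd.comp Primrec.snd))
      (Primrec.encode.comp Primrec.snd).to₂
  have hite := Primrec.ite hcert (Primrec.option_some.comp hl) (Primrec.const none)
  exact Partrec.rfindOpt (Primrec.option_bind (Primrec.decode.comp Primrec.snd) hite.to₂).to_comp.to₂

/-- The certificate found need not be the one given; all that is used later is that it is a
certificate. -/
theorem exists_mem_search {side : Bool} {p : (ℕ × ℕ) × ℕ}
    (h : ∃ c, IsCertificate side (decodeRows p.1.1) (decodeVec p.2) c) :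
    ∃ c, IsCertificate side (decodeRows p.1.1) (decodeVec p.2) c ∧
      c.2.1.map Encodable.encode ∈ search side p := by
  classical
  obtain ⟨c, hc⟩ := h
  have hdom : (search side p).Dom := by
    refine Nat.rfindOpt_dom.2 ⟨Encodable.encode c, c.2.1.map Encodable.encode, ?_⟩
    simp [hc]
  obtain ⟨n, hn⟩ := Nat.rfindOpt_spec (Part.get_mem hdom)
  simp only [Option.mem_def, Option.bind_eq_some_iff] at hn
  obtain ⟨c', -, hc'⟩ := hn
  split_ifs at hc' with h'
  exact ⟨c', h', (Option.some.inj hc') ▸ Part.get_mem hdom⟩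

end QAIT

namespace QAIT

/-! ### Sums of projectors -/

/-- The complex vector given by an elementary vector. -/
noncomputable def cvec {d : ℕ} (v : Fin d → GaussRat) : Fin d → ℂ := fun i => (v i).toComplex

/-- The sum of the projectors of the vectors of a list. -/
noncomputable def cgram {d : ℕ} (L : List (Fin d → GaussRat)) : Matrix (Fin d) (Fin d) ℂ :=
  (L.map fun u => Matrix.vecMulVec (cvec u) (star (cvec u))).sum

/-- Elementary vectors of norm `1`. -/
def IsUnitVec {d : ℕ} (v : Fin d → GaussRat) : Prop := cvec v ⬝ᵥ star (cvec v) = 1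

section

variable {d : ℕ}

theorem cgram_nil : cgram ([] : List (Fin d → GaussRat)) = 0 := rfl

theorem cgram_append (L L' : List (Fin d → GaussRat)) : cgram (L ++ L') = cgram L + cgram L' := by
  simp [cgram]

theorem cgram_cons (u : Fin d → GaussRat) (L : List (Fin d → GaussRat)) :
    cgram (u :: L) = Matrix.vecMulVec (cvec u) (star (cvec u)) + cgram L := by
  simp [cgram]

theorem cgram_flatten_replicate (k : ℕ) (L : List (Fin d → GaussRat)) :
    cgram (List.replicate k L).flatten = (k : ℂ) • cgram L := by
  induction k with
  | zero => simp [cgram_nil]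
  | succ k ih =>
    rw [List.replicate_succ, List.flatten_cons, cgram_append, ih]
    push_cast
    rw [add_smul, one_smul, add_comm]

theorem toComplex_gram (L : List (Fin d → GaussRat)) (a b : Fin d) :
    (gram (L.map fun u => List.ofFn u) a b).toComplex = cgram L a b := by
  induction L with
  | nil => simp [gram, cgram]
  | cons u L ih =>
    have h : gram ((u :: L).map fun u => List.ofFn u) a b =
        (List.ofFn u).getD a 0 * ((List.ofFn u).getD b 0).conj + gram (L.map fun u => List.ofFn u) a b := by
      simp only [gram, List.map_cons, List.sum_cons]
    rw [h, cgram_cons, getD_ofFn, getD_ofFn, GaussRat.toComplex_add, ih]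
    simp [Matrix.vecMulVec_apply, cvec]

theorem listNormSq_ofFn (u : Fin d → GaussRat) : listNormSq (List.ofFn u) = 1 ↔ IsUnitVec u := by
  rw [← GaussRat.toComplex_injective.eq_iff, listNormSq, IsUnitVec]
  rw [List.map_ofFn, List.sum_ofFn]
  simp [dotProduct, cvec]

/-! ### Elementary unit vectors from four squares and a quaternionic structure. -/

/-- The square of the absolute value. -/
def GaussRat.normSq (a : GaussRat) : ℚ := a.re ^ 2 + a.im ^ 2

theorem GaussRat.toComplex_mul_star (a : GaussRat) :
    a.toComplex * star a.toComplex = ((a.normSq : ℝ) : ℂ) := by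
  rw [Complex.star_def, Complex.mul_conj, Complex.normSq_apply]
  congr 1
  simp only [toComplex, normSq]
  push_cast
  ring

/-- Lagrange's four square theorem for `num * den`, divided by `den ^ 2`. One square modulus would
not suffice: it is a sum of only two rational squares. -/
theorem exists_normSq_add (q : ℚ) (hq : 0 ≤ q) : ∃ α β : GaussRat, α.normSq + β.normSq = q := by
  obtain ⟨a, b, c, e, h⟩ := Nat.sum_four_squares (q.num.toNat * q.den)
  have hd : (q.den : ℚ) ≠ 0 := by exact_mod_cast q.den_nz
  refine ⟨⟨a / q.den, b / q.den⟩, ⟨c / q.den, e / q.den⟩, ?_⟩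
  have h1 : ((q.num.toNat : ℕ) : ℚ) = q * q.den := by
    rw [Rat.mul_den_eq_num]
    have := Int.toNat_of_nonneg (Rat.num_nonneg.2 hq)
    exact_mod_cast this
  have h2 : (a : ℚ) ^ 2 + b ^ 2 + c ^ 2 + e ^ 2 = q * q.den * q.den := by
    rw [← h1]
    exact_mod_cast h
  simp only [GaussRat.normSq]
  field_simp
  linarith

/-- A quaternionic structure. -/
def quat (w : Fin d → GaussRat) (i : Fin d) : GaussRat :=
  if i < i.rev then (w i.rev).conj else -(w i.rev).conj

/-- Reversing the indices changes the sign of the sum, because exactly one of `i` and `i.rev` lies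
in the lower half; evenness of `d` excludes a fixed index. -/
theorem dotProduct_quat (hd : Even d) (w : Fin d → GaussRat) :
    cvec w ⬝ᵥ star (cvec (quat w)) = 0 := by
  have h : cvec w ⬝ᵥ star (cvec (quat w)) = -(cvec w ⬝ᵥ star (cvec (quat w))) := by
    conv_lhs => rw [dotProduct, ← Equiv.sum_comp Fin.revPerm]
    rw [dotProduct, ← Finset.sum_neg_distrib]
    refine Finset.sum_congr rfl fun i _ => ?_
    have hi : (i : ℕ) ≠ d - (i + 1) := by
      intro h
      have := i.2
      obtain ⟨m, hm⟩ := hd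
      omega
    have h1 : i.rev < i ↔ ¬ i < i.rev := by
      rw [Fin.lt_def, Fin.lt_def, Fin.val_rev]
      omega
    by_cases h2 : i < i.rev
    · simp [cvec, quat, h1, h2, mul_comm]
    · simp [cvec, quat, h1, h2, mul_comm]
  linear_combination h / 2

theorem dotProduct_quat_self (w : Fin d → GaussRat) :
    cvec (quat w) ⬝ᵥ star (cvec (quat w)) = cvec w ⬝ᵥ star (cvec w) := by
  conv_rhs => rw [dotProduct, ← Equiv.sum_comp Fin.revPerm]
  refine Finset.sum_congr rfl fun i _ => ?_
  by_cases h2 : i < i.rev <;> simp [cvec, quat, h2, mul_comm]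

/-- Scalar multiples of elementary vectors. -/
def smulVec (α : GaussRat) (w : Fin d → GaussRat) : Fin d → GaussRat := fun i => α * w i

theorem vecMulVec_smulVec (α : GaussRat) (w : Fin d → GaussRat) :
    Matrix.vecMulVec (cvec (smulVec α w)) (star (cvec (smulVec α w))) =
      ((α.normSq : ℝ) : ℂ) • Matrix.vecMulVec (cvec w) (star (cvec w)) := by
  ext a b
  simp only [Matrix.vecMulVec_apply, cvec, smulVec, GaussRat.toComplex_mul, Pi.star_apply, star_mul,
    Matrix.smul_apply, smul_eq_mul, ← GaussRat.toComplex_mul_star]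
  ring

theorem dotProduct_self_eq (w : Fin d → GaussRat) :
    cvec w ⬝ᵥ star (cvec w) = (((∑ i, (w i).normSq : ℚ) : ℝ) : ℂ) := by
  rw [dotProduct]
  push_cast
  exact Finset.sum_congr rfl fun i _ => GaussRat.toComplex_mul_star _

theorem GaussRat.normSq_nonneg (a : GaussRat) : 0 ≤ a.normSq := by
  unfold normSq; positivity

/-- The projector of `w`, divided by its squared norm, is dominated by a sum of two projectors of
elementary unit vectors. -/
theorem exists_unit_pair (hd : Even d) (w : Fin d → GaussRat) (hw : 0 < ∑ i, (w i).normSq) :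
    ∃ us vs : List (Fin d → GaussRat), us.length = 2 ∧ (∀ u ∈ us, IsUnitVec u) ∧
      cgram us = ((((∑ i, (w i).normSq : ℚ) : ℝ) : ℂ)⁻¹) • Matrix.vecMulVec (cvec w) (star (cvec w)) +
        cgram vs := by
  have hw2 := dotProduct_self_eq w
  set r : ℚ := ∑ i, (w i).normSq
  -- With `|α|² + |β|² = r⁻¹` the vectors `αw ± β(quat w)` are unit vectors. Taking `|β| ≤ |α|`
  -- makes the excess `|α|² - |β|²` nonnegative, hence again of the form `|γ|² + |δ|²`.
  obtain ⟨α, β, hle, hαβ⟩ : ∃ α β : GaussRat, β.normSq ≤ α.normSq ∧ α.normSq + β.normSq = r⁻¹ := by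
    obtain ⟨α, β, h⟩ := exists_normSq_add r⁻¹ (by positivity)
    rcases le_total β.normSq α.normSq with h1 | h1
    · exact ⟨α, β, h1, h⟩
    · exact ⟨β, α, h1, by rw [add_comm, h]⟩
  obtain ⟨γ, δ, hγδ⟩ := exists_normSq_add (α.normSq - β.normSq) (by linarith)
  let u := cvec w
  let v := cvec (quat w)
  have huv : ∑ i, u i * star (v i) = 0 := dotProduct_quat hd w
  have hvu : ∑ i, v i * star (u i) = 0 := by
    have := congrArg star huv
    simpa [mul_comm] using this
  have huu : ∑ i, u i * star (u i) = ((r : ℝ) : ℂ) := hw2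
  have hvv : ∑ i, v i * star (v i) = ((r : ℝ) : ℂ) := (dotProduct_quat_self w).trans hw2
  have hr : ((r : ℝ) : ℂ) ≠ 0 := by
    exact_mod_cast hw.ne'
  have hab : α.toComplex * star α.toComplex + β.toComplex * star β.toComplex = (((r : ℝ) : ℂ))⁻¹ := by
    rw [GaussRat.toComplex_mul_star, GaussRat.toComplex_mul_star]
    exact_mod_cast congrArg (fun q : ℚ => ((q : ℝ) : ℂ)) hαβ
  have hcd : ((γ.normSq : ℝ) : ℂ) + ((δ.normSq : ℝ) : ℂ) = ((α.normSq : ℝ) : ℂ) - ((β.normSq : ℝ) : ℂ) := by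
    exact_mod_cast congrArg (fun q : ℚ => ((q : ℝ) : ℂ)) hγδ
  -- Used for the signs `ε = 1` and `ε = -1`.
  have hunit : ∀ ε : ℂ, ε * star ε = 1 → ∑ i, (α.toComplex * u i + ε * β.toComplex * v i) *
      star (α.toComplex * u i + ε * β.toComplex * v i) = 1 := by
    intro ε hε
    have : ∀ i, (α.toComplex * u i + ε * β.toComplex * v i) *
        star (α.toComplex * u i + ε * β.toComplex * v i) =
        α.toComplex * star α.toComplex * (u i * star (u i)) +
        α.toComplex * star (ε * β.toComplex) * (u i * star (v i)) +
        star α.toComplex * (ε * β.toComplex) * (v i * star (u i)) +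
        β.toComplex * star β.toComplex * (v i * star (v i)) := by
      intro i
      simp only [star_add, star_mul]
      linear_combination (β.toComplex * star β.toComplex * (v i * star (v i))) * hε
    simp_rw [this]
    simp only [Finset.sum_add_distrib, ← Finset.mul_sum, huv, hvu, huu, hvv, mul_zero, add_zero]
    rw [← add_mul, hab, inv_mul_cancel₀ hr]
  -- In the sum of the two projectors the cross terms cancel. There remain `2|α|²` times the
  -- projector of `w`, where `2|α|² = r⁻¹ + |γ|² + |δ|²`, and `2|β|²` times that of `quat w`; the
  -- second list collects the surplus.
  refine ⟨[fun i => α * w i + β * quat w i, fun i => α * w i + -β * quat w i],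
    [smulVec γ w, smulVec δ w, smulVec β (quat w), smulVec β (quat w)], rfl, ?_, ?_⟩
  · intro t ht
    simp only [List.mem_cons, List.not_mem_nil, or_false] at ht
    rcases ht with rfl | rfl
    · have := hunit 1 (by simp)
      simpa [IsUnitVec, dotProduct, cvec, u, v] using this
    · have := hunit (-1) (by simp)
      simpa [IsUnitVec, dotProduct, cvec, u, v] using this
  · simp only [cgram_cons, cgram_nil, vecMulVec_smulVec]
    rw [← hab]
    ext a b
    simp only [Matrix.vecMulVec_apply, cvec, Matrix.add_apply, Matrix.smul_apply, smul_eq_mul,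
      Pi.star_apply, GaussRat.toComplex_add, GaussRat.toComplex_mul, GaussRat.toComplex_neg,
      star_add, star_mul, star_neg, add_zero]
    have h1 := GaussRat.toComplex_mul_star α
    have h2 := GaussRat.toComplex_mul_star β
    rw [← h1, ← h2] at hcd
    rw [← h2]
    linear_combination (-(w a).toComplex * star (w b).toComplex) * hcd

theorem cgram_append_eq (us vs ps : List (Fin d → GaussRat)) {W : Matrix (Fin d) (Fin d) ℂ}
    (h : cgram us = W + cgram vs) : cgram (us ++ ps) = W + cgram (vs ++ ps) := by
  rw [cgram_append, cgram_append, h, add_assoc]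

/-- Scaled copies of a projector are dominated by elementary unit vectors. -/
theorem exists_units (hd : Even d) (w : Fin d → GaussRat) (D k : ℕ)
    (hk : (D : ℚ) * ∑ i, (w i).normSq = k) :
    ∃ us vs : List (Fin d → GaussRat), us.length = 2 * k ∧ (∀ u ∈ us, IsUnitVec u) ∧
      cgram us = (D : ℂ) • Matrix.vecMulVec (cvec w) (star (cvec w)) + cgram vs := by
  rcases (Finset.sum_nonneg fun i _ => (w i).normSq_nonneg :
    0 ≤ ∑ i, (w i).normSq).eq_or_lt with h0 | h0
  · have hw : cvec w = 0 := by
      funext i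
      have h1 := (Finset.sum_eq_zero_iff_of_nonneg fun i _ => (w i).normSq_nonneg).1 h0.symm i
        (Finset.mem_univ i)
      have h2 := GaussRat.toComplex_mul_star (w i)
      rw [h1] at h2
      simpa [cvec] using h2
    rw [← h0, mul_zero] at hk
    obtain rfl : k = 0 := by exact_mod_cast hk.symm
    exact ⟨[], [], rfl, by simp, by simp [hw, cgram_nil]⟩
  · obtain ⟨us, vs, hl, hu, h⟩ := exists_unit_pair hd w h0
    -- Since `D * r = k` for the squared norm `r`, taking `k` copies of the pair turns the
    -- coefficient `r⁻¹` into `D`.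
    refine ⟨(List.replicate k us).flatten, (List.replicate k vs).flatten, ?_, ?_, ?_⟩
    · simp [hl, mul_comm]
    · intro u hu'
      simp only [List.mem_flatten, List.mem_replicate] at hu'
      obtain ⟨l, ⟨-, rfl⟩, hul⟩ := hu'
      exact hu u hul
    · rw [cgram_flatten_replicate, cgram_flatten_replicate, h, smul_add, smul_smul]
      congr 2
      have hr : (((∑ i, (w i).normSq : ℚ) : ℝ) : ℂ) ≠ 0 := by exact_mod_cast h0.ne'
      have hk' : (D : ℂ) * (((∑ i, (w i).normSq : ℚ) : ℝ) : ℂ) = k := by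
        exact_mod_cast congrArg (fun q : ℚ => ((q : ℝ) : ℂ)) hk
      rw [← hk']
      field_simp

/-- A family of elementary vectors of total squared norm `1` is dominated by a uniform mixture of
elementary unit vectors. -/
theorem exists_uniform_mixture (hpos : 0 < d) (hd : Even d ∨ d = 1) (w : Fin d → Fin d → GaussRat)
    (hw : ∑ j, ∑ i, (w j i).normSq = 1) :
    ∃ (D m : ℕ) (us vs : List (Fin d → GaussRat)), us.length = 2 ^ m ∧ 2 ^ m ≤ 4 * D ∧
      (∀ u ∈ us, IsUnitVec u) ∧ cgram us = (D : ℂ) • cgram (List.ofFn w) + cgram vs := by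
  rcases hd with hd | rfl
  · let r : Fin d → ℚ := fun j => ∑ i, (w j i).normSq
    -- A common denominator of the squared norms `r j`: the numbers `D * r j` are integers `k j`
    -- with sum `D`, so the vectors obtained number `2 * D`.
    let D : ℕ := ∏ j, (r j).den
    have hD : 0 < D := Finset.prod_pos fun j _ => (r j).den_pos
    have hk : ∀ j, ∃ k : ℕ, (D : ℚ) * r j = k := by
      intro j
      obtain ⟨t, ht⟩ : (r j).den ∣ D := Finset.dvd_prod_of_mem _ (Finset.mem_univ j)
      have h0 : 0 ≤ r j := Finset.sum_nonneg fun i _ => (w j i).normSq_nonneg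
      refine ⟨t * (r j).num.toNat, ?_⟩
      have h1 : (((r j).num.toNat : ℕ) : ℚ) = (r j).num := by
        have := Int.toNat_of_nonneg (Rat.num_nonneg.2 h0)
        exact_mod_cast this
      rw [ht]
      push_cast
      rw [h1, ← Rat.mul_den_eq_num]
      ring
    choose k hk using hk
    choose us vs hl hu hg using fun j => exists_units hd (w j) D (k j) (hk j)
    have hsum : ∑ j, k j = D := by
      have : (∑ j, (k j : ℚ)) = D := by
        rw [← Finset.sum_congr rfl fun j _ => hk j, ← Finset.mul_sum]
        simp [r, hw]
      exact_mod_cast this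
    have hflat : ∀ f : Fin d → List (Fin d → GaussRat),
        cgram (List.ofFn f).flatten = ∑ j, cgram (f j) := by
      intro f
      rw [← List.sum_ofFn]
      have : ∀ L : List (List (Fin d → GaussRat)), cgram L.flatten = (L.map cgram).sum := by
        intro L
        induction L with
        | nil => rfl
        | cons l L ih => rw [List.flatten_cons, cgram_append, ih]; simp
      rw [this, List.map_ofFn]
      rfl
    have hlog1 : 2 ^ Nat.log 2 D ≤ D := Nat.pow_log_le_self 2 hD.ne'
    have hlog2 : D < 2 ^ (Nat.log 2 D + 1) := Nat.lt_pow_succ_log_self (by norm_num) D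
    have hlen : (List.ofFn us).flatten.length = 2 * D := by
      rw [List.length_flatten, List.map_ofFn, List.sum_ofFn, ← hsum, Finset.mul_sum]
      exact Finset.sum_congr rfl fun j _ => hl j
    let e : Fin d → GaussRat := fun i => if i = ⟨0, hpos⟩ then 1 else 0
    have he : IsUnitVec e := by
      have : ∀ i, (e i).toComplex = if i = ⟨0, hpos⟩ then 1 else 0 := by
        intro i; simp only [e]; split_ifs <;> simp
      simp [IsUnitVec, dotProduct, cvec, this]
    -- Padding to a power of two: `2 ^ (log D + 2)` lies between `2 * D` and `4 * D`. The padding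
    -- vectors enter both lists and so keep the identity.
    let ps := List.replicate (2 ^ (Nat.log 2 D + 2) - 2 * D) e
    refine ⟨D, Nat.log 2 D + 2, (List.ofFn us).flatten ++ ps, (List.ofFn vs).flatten ++ ps,
      ?_, ?_, ?_, ?_⟩
    · rw [List.length_append, hlen, List.length_replicate]
      rw [pow_succ] at hlog2 ⊢
      rw [pow_succ]
      omega
    · rw [pow_add]; omega
    · intro u hu'
      simp only [List.mem_append, List.mem_flatten, List.mem_ofFn] at hu'
      rcases hu' with ⟨l, ⟨j, rfl⟩, h⟩ | h
      · exact hu j u h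
      · rw [(List.mem_replicate.1 h).2]; exact he
    · refine cgram_append_eq _ _ _ ?_
      rw [hflat, hflat, cgram, List.map_ofFn, List.sum_ofFn, Finset.smul_sum, ← Finset.sum_add_distrib]
      exact Finset.sum_congr rfl fun j _ => hg j
  · refine ⟨1, 0, List.ofFn w, [], by simp, by norm_num, ?_, by simp [cgram_nil]⟩
    intro u hu
    obtain ⟨j, rfl⟩ := List.mem_ofFn.1 hu
    rw [IsUnitVec, dotProduct_self_eq]
    have : ∑ i, (w j i).normSq = 1 := by
      rw [Fin.sum_univ_one] at hw
      rwa [Subsingleton.elim j 0]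
    rw [this]
    simp

end

end QAIT

namespace QAIT

/-! ### Quadratic forms and the Kraus matrices of a gate -/

/-- The quadratic form `⟨v|A|v⟩`. -/
noncomputable def qf {ι : Type} [Fintype ι] (A : Matrix ι ι ℂ) (v : ι → ℂ) : ℝ :=
  (A.mulVec v ⬝ᵥ star v).re

section

variable {ι : Type} [Fintype ι]

theorem qf_nonneg {A : Matrix ι ι ℂ} (hA : A.PosSemidef) (v : ι → ℂ) : 0 ≤ qf A v := by
  have h := hA.dotProduct_mulVec_nonneg v
  rw [dotProduct_comm] at h
  exact (Complex.le_def.1 h).1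

theorem trace_mul_vecMulVec (A : Matrix ι ι ℂ) (v : ι → ℂ) :
    (A * Matrix.vecMulVec v (star v)).trace.re = qf A v := by
  rw [Matrix.mul_vecMulVec, Matrix.trace_vecMulVec, qf]

theorem qf_conj {κ : Type} [Fintype κ] (A : Matrix ι ι ℂ) (K : Matrix ι κ ℂ) (v : κ → ℂ) :
    qf (K.conjTranspose * A * K) v = qf A (K.mulVec v) := by
  rw [qf, qf, ← Matrix.mulVec_mulVec, ← Matrix.mulVec_mulVec, dotProduct_comm, Matrix.dotProduct_mulVec,
    ← Matrix.star_mulVec, dotProduct_comm]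

theorem qf_sum {κ : Type} (s : Finset κ) (A : κ → Matrix ι ι ℂ) (v : ι → ℂ) :
    qf (∑ j ∈ s, A j) v = ∑ j ∈ s, qf (A j) v := by
  simp only [qf, Matrix.sum_mulVec, sum_dotProduct, Complex.re_sum]

end

section

variable {d : ℕ}

/-- The Kraus matrix, for the value `j` of the register that is dropped, of the gate `C` applied to
a state and the ancilla `|0⟩`. -/
noncomputable def kraus (side : Bool) (hd : 0 < d) (C : Matrix (Fin d × Fin d) (Fin d × Fin d) ℂ)
    (j : Fin d) : Matrix (Fin d) (Fin d) ℂ :=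
  Matrix.of fun a s => C (cond side (a, j) (j, a)) (s, ⟨0, hd⟩)

/-- The vector `|x⟩|0⟩`. -/
noncomputable def withAncilla (hd : 0 < d) (x : Fin d → ℂ) (p : Fin d × Fin d) : ℂ :=
  x p.1 * if p.2 = ⟨0, hd⟩ then 1 else 0

theorem kraus_mulVec (side : Bool) (hd : 0 < d) (C : Matrix (Fin d × Fin d) (Fin d × Fin d) ℂ)
    (j a : Fin d) (x : Fin d → ℂ) :
    (kraus side hd C j).mulVec x a = C.mulVec (withAncilla hd x) (cond side (a, j) (j, a)) := by
  simp only [Matrix.mulVec, dotProduct, Fintype.sum_prod_type, withAncilla, kraus, Matrix.of_apply]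
  refine Finset.sum_congr rfl fun s _ => ?_
  rw [Finset.sum_eq_single (⟨0, hd⟩ : Fin d)]
  · simp
  · intro t _ ht; simp [ht]
  · simp

/-- The vectors `Kⱼx` are the slices of `C|x⟩|0⟩`, and a unitary preserves the norm: the channel
preserves the trace. -/
theorem sum_kraus_dotProduct (side : Bool) (hd : 0 < d)
    {C : Matrix (Fin d × Fin d) (Fin d × Fin d) ℂ} (hC : C ∈ Matrix.unitaryGroup (Fin d × Fin d) ℂ)
    (x : Fin d → ℂ) :
    ∑ j, (kraus side hd C j).mulVec x ⬝ᵥ star ((kraus side hd C j).mulVec x) = x ⬝ᵥ star x := by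
  have h1 : C.mulVec (withAncilla hd x) ⬝ᵥ star (C.mulVec (withAncilla hd x)) =
      withAncilla hd x ⬝ᵥ star (withAncilla hd x) := by
    rw [dotProduct_comm, Matrix.star_mulVec, Matrix.dotProduct_mulVec, Matrix.vecMul_vecMul,
      ← Matrix.star_eq_conjTranspose, Matrix.mem_unitaryGroup_iff'.1 hC, Matrix.vecMul_one,
      dotProduct_comm]
  have h2 : withAncilla hd x ⬝ᵥ star (withAncilla hd x) = x ⬝ᵥ star x := by
    simp only [dotProduct, Fintype.sum_prod_type, withAncilla]
    refine Finset.sum_congr rfl fun s _ => ?_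
    rw [Finset.sum_eq_single (⟨0, hd⟩ : Fin d)]
    · simp [withAncilla]
    · intro t _ ht; simp [ht]
    · simp
  rw [← h2, ← h1]
  simp only [dotProduct, Pi.star_apply, kraus_mulVec]
  cases side
  · rw [Fintype.sum_prod_type]; rfl
  · rw [Fintype.sum_prod_type_right]; rfl

/-- The list of the rows of a gate. -/
def gateRows (C : Matrix (Fin d × Fin d) (Fin d × Fin d) GaussRat) : List (List GaussRat) :=
  List.ofFn fun i => List.ofFn (flat C i)

theorem length_gateRows (C : Matrix (Fin d × Fin d) (Fin d × Fin d) GaussRat) :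
    (gateRows C).length = d * d := by simp [gateRows]

theorem dim_gateRows (C : Matrix (Fin d × Fin d) (Fin d × Fin d) GaussRat) :
    dim (gateRows C) = d := by
  rw [dim, length_gateRows, Nat.sqrt_eq]

theorem entry_gateRows (C : Matrix (Fin d × Fin d) (Fin d × Fin d) GaussRat) (p q : Fin d × Fin d) :
    entry (gateRows C) (p.2 + d * p.1) (q.2 + d * q.1) = C p q := by
  have := entry_ofFn (flat C) (finProdFinEquiv p) (finProdFinEquiv q)
  simpa [flat, gateRows] using this

/-- The pair `(a, b)` has number `b + d * a` in the flat matrix, and the ancilla index is `0`,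
whence the column `d * s`. -/
theorem krausEntry_gateRows (side : Bool) (hd : 0 < d)
    (C : Matrix (Fin d × Fin d) (Fin d × Fin d) GaussRat) (j a s : Fin d) :
    (krausEntry side (gateRows C) j a s).toComplex = kraus side hd (toComplexMat C) j a s := by
  have h := entry_gateRows C (cond side (a, j) (j, a)) (s, ⟨0, hd⟩)
  simp only [kraus, Matrix.of_apply, toComplexMat, Matrix.map_apply, ← h, krausEntry, dim_gateRows]
  cases side <;> simp

theorem decodeRows_gate (C : Matrix (Fin d × Fin d) (Fin d × Fin d) GaussRat) :
    decodeRows (matCode (flat C)) = gateRows C := decodeRows_matCode _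

/-- The slices of the image of an elementary vector. -/
def sliceVec (side : Bool) (C : Matrix (Fin d × Fin d) (Fin d × Fin d) GaussRat)
    (θ : Fin d → GaussRat) (j a : Fin d) : GaussRat :=
  ∑ s : Fin d, krausEntry side (gateRows C) j a s * θ s

theorem cvec_sliceVec (side : Bool) (hd : 0 < d)
    (C : Matrix (Fin d × Fin d) (Fin d × Fin d) GaussRat) (θ : Fin d → GaussRat) (j : Fin d) :
    cvec (sliceVec side C θ j) = (kraus side hd (toComplexMat C) j).mulVec (cvec θ) := by
  funext a
  simp [cvec, sliceVec, krausEntry_gateRows side hd, Matrix.mulVec, dotProduct]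

theorem slices_gateRows (side : Bool) (C : Matrix (Fin d × Fin d) (Fin d × Fin d) GaussRat)
    (θ : Fin d → GaussRat) :
    slices side (gateRows C) (List.ofFn θ) =
      (List.ofFn (sliceVec side C θ)).map fun u => List.ofFn u := by
  rw [slices, dim_gateRows, table_eq_ofFn, List.map_ofFn]
  congr; funext j
  simp only [Function.comp]
  congr; funext a
  rw [Finset.sum_range, sliceVec]
  exact Finset.sum_congr rfl fun s _ => by rw [getD_ofFn]

/-- The slices of the image of a unit vector have total squared norm `1`, so the uniform mixture
applies to them. The surplus is given as a sum of projectors, which turns a Loewner inequality into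
an identity between rational entries that a machine can check. -/
theorem exists_certificate (hpos : 0 < d) (hd : Even d ∨ d = 1) (side : Bool)
    {C : Matrix (Fin d × Fin d) (Fin d × Fin d) GaussRat}
    (hC : toComplexMat C ∈ Matrix.unitaryGroup (Fin d × Fin d) ℂ) {θ : Fin d → GaussRat}
    (hθ : IsUnitVec θ) : ∃ c, IsCertificate side (gateRows C) (List.ofFn θ) c := by
  have hw : ∑ j, ∑ i, (sliceVec side C θ j i).normSq = 1 := by
    have h := sum_kraus_dotProduct side hpos hC (cvec θ)
    simp_rw [← cvec_sliceVec, dotProduct_self_eq] at h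
    rw [← dotProduct_self_eq θ, hθ] at h
    exact_mod_cast h
  obtain ⟨D, m, us, vs, h1, h2, h3, h4⟩ := exists_uniform_mixture hpos hd (sliceVec side C θ) hw
  refine ⟨((D, m), us.map (fun u => List.ofFn u), vs.map fun u => List.ofFn u), ?_, h2, ?_, ?_⟩
  · simpa using h1
  · intro u hu
    obtain ⟨v, hv, rfl⟩ := List.mem_map.1 hu
    exact ⟨by simp [dim_gateRows], (listNormSq_ofFn v).2 (h3 v hv)⟩
  · rw [dim_gateRows, table_inj]
    intro a b
    apply GaussRat.toComplex_injective
    rw [slices_gateRows, GaussRat.toComplex_add, GaussRat.toComplex_mul, toComplex_gram, toComplex_gram,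
      toComplex_gram, h4]
    simp

theorem qf_cgram (A : Matrix (Fin d) (Fin d) ℂ) (L : List (Fin d → GaussRat)) :
    (A * cgram L).trace.re = (L.map fun u => qf A (cvec u)).sum := by
  induction L with
  | nil => simp [cgram_nil]
  | cons u L ih => rw [cgram_cons, mul_add, Matrix.trace_add, Complex.add_re, ih, trace_mul_vecMulVec]; rfl

/-- Pairing the certified identity with a positive semidefinite `A` makes the surplus nonnegative;
the factor `4` comes from `2 ^ m ≤ 4 * D`. -/
theorem IsCertificate.exists_bound (hpos : 0 < d) {side : Bool}
    {C : Matrix (Fin d × Fin d) (Fin d × Fin d) GaussRat} {θ : Fin d → GaussRat}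
    {c : (ℕ × ℕ) × List (List GaussRat) × List (List GaussRat)}
    (h : IsCertificate side (gateRows C) (List.ofFn θ) c) :
    ∃ L : List {u : Fin d → GaussRat // IsUnitVec u}, c.2.1 = L.map (fun u => List.ofFn u.1) ∧
      ∀ A : Matrix (Fin d) (Fin d) ℂ, A.PosSemidef →
        2 ^ c.1.2 * ∑ j, qf A ((kraus side hpos (toComplexMat C) j).mulVec (cvec θ)) ≤
          4 * (L.map fun u => qf A (cvec u.1)).sum := by
  obtain ⟨⟨D, m⟩, us, vs⟩ := c
  obtain ⟨-, h2, h3, h4⟩ := h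
  dsimp only at h2 h3 h4 ⊢
  rw [dim_gateRows] at h3 h4
  have hus : ∃ L : List {u : Fin d → GaussRat // IsUnitVec u}, us = L.map (fun u => List.ofFn u.1) := by
    clear h4
    induction us with
    | nil => exact ⟨[], rfl⟩
    | cons u us ih =>
      obtain ⟨L, rfl⟩ := ih fun u hu => h3 u (List.mem_cons_of_mem _ hu)
      obtain ⟨hl, hu⟩ := h3 u List.mem_cons_self
      have hu' : u = List.ofFn fun i : Fin d => u.getD i 0 := by
        refine List.ext_getElem (by simp [hl]) fun i h1 h2 => ?_
        simp [h1]
      rw [hu', listNormSq_ofFn] at hu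
      exact ⟨⟨_, hu⟩ :: L, by rw [List.map_cons, ← hu']⟩
  obtain ⟨L, rfl⟩ := hus
  refine ⟨L, rfl, fun A hA => ?_⟩
  -- A certificate does not prescribe the lengths of the surplus vectors: only the first `d` entries
  -- count, and missing ones are read as `0`.
  have hvs : ∀ a b : Fin d, gram vs a b =
      gram ((vs.map fun (v : List GaussRat) (i : Fin d) => v.getD i 0).map fun u => List.ofFn u) a b := by
    intro a b
    simp only [gram, List.map_map]
    congr 2
    funext v
    simp only [Function.comp, getD_ofFn]
  set vs' := vs.map fun (v : List GaussRat) (i : Fin d) => v.getD i 0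
  have hL : L.map (fun u => List.ofFn u.1) = (L.map Subtype.val).map fun u => List.ofFn u := by
    rw [List.map_map]; rfl
  have hmat : cgram (L.map Subtype.val) =
      (D : ℂ) • cgram (List.ofFn (sliceVec side C θ)) + cgram vs' := by
    ext a b
    have := congrArg GaussRat.toComplex (table_inj.1 h4 a b)
    rw [slices_gateRows, hL, hvs, GaussRat.toComplex_add, GaussRat.toComplex_mul, toComplex_gram,
      toComplex_gram, toComplex_gram] at this
    simpa using this
  have htr := congrArg (fun M => (A * M).trace.re) hmat
  simp only [mul_add, Matrix.trace_add, Complex.add_re, Matrix.mul_smul, Matrix.trace_smul, qf_cgram,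
    smul_eq_mul, List.map_map] at htr
  rw [← Complex.ofReal_natCast, Complex.re_ofReal_mul, qf_cgram, List.map_ofFn, List.sum_ofFn] at htr
  simp only [Function.comp_def, cvec_sliceVec side hpos] at htr
  rw [htr]
  have h0 : 0 ≤ (vs'.map fun u => qf A (cvec u)).sum := by
    refine List.sum_nonneg fun x hx => ?_
    obtain ⟨u, -, rfl⟩ := List.mem_map.1 hx
    exact qf_nonneg hA _
  have h1 : 0 ≤ ∑ j, qf A ((kraus side hpos (toComplexMat C) j).mulVec (cvec θ)) :=
    Finset.sum_nonneg fun j _ => qf_nonneg hA _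
  have h2' : (2 : ℝ) ^ m ≤ 4 * D := by exact_mod_cast h2
  nlinarith [mul_le_mul_of_nonneg_right h2' h1]

end

/-! ### Domination by the universal matrix -/

theorem isUnitVec_iff {n : ℕ} (v : Fin (2 ^ n) → GaussRat) :
    IsUnitVec v ↔ ‖(WithLp.toLp 2 fun i => (v i).toComplex : Qubits n)‖ = 1 := by
  rw [← sq_eq_sq₀ (norm_nonneg _) zero_le_one, EuclideanSpace.norm_sq_eq, one_pow, IsUnitVec]
  have : cvec v ⬝ᵥ star (cvec v) = ((∑ i, ‖(v i).toComplex‖ ^ 2 : ℝ) : ℂ) := by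
    rw [dotProduct]
    push_cast
    exact Finset.sum_congr rfl fun i _ => Complex.mul_conj' _
  rw [this]
  exact_mod_cast Iff.rfl

/-- Elementary unit vectors as elementary pure states. -/
def ElemState.ofUnit {n : ℕ} (u : {u : Fin (2 ^ n) → GaussRat // IsUnitVec u}) : ElemState n :=
  ⟨u.1, (isUnitVec_iff u.1).1 u.2⟩

/-- The expectation of `A` in the universal matrix. -/
noncomputable def univExpect (z n : ℕ) (A : Matrix (Fin (2 ^ n)) (Fin (2 ^ n)) ℂ) : ℝ≥0∞ :=
  ∑' v : ElemState n, uprob z (vecCode v.1) n * ENNReal.ofReal (qf A v.ket)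

/-- Regrouping a sum over a list by values matches it with the multiplicities in the sampling bound.
-/
theorem tsum_count_mul {β : Type} {k : β → ℕ} (hk : Function.Injective k) (L : List β)
    (f : β → ℝ≥0∞) : ∑' v, ((L.map k).count (k v) : ℝ≥0∞) * f v = (L.map f).sum := by
  classical
  induction L with
  | nil => simp
  | cons u L ih =>
    simp only [List.map_cons, List.count_cons, List.sum_cons, ← ih, Nat.cast_add, add_mul]
    rw [ENNReal.tsum_add, add_comm]
    congr 1
    rw [tsum_eq_single u]
    · simp
    · intro v hv
      have : k u ≠ k v := fun h => hv (hk h).symm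
      simp [this]

theorem even_or_eq_one_two_pow (n : ℕ) : Even (2 ^ n) ∨ 2 ^ n = 1 := by
  cases n with
  | zero => right; rfl
  | succ n => left; exact ⟨2 ^ n, by ring⟩

theorem exists_search_list (side : Bool) {n : ℕ}
    {C : Matrix (Fin (2 ^ n) × Fin (2 ^ n)) (Fin (2 ^ n) × Fin (2 ^ n)) GaussRat}
    (hC : toComplexMat C ∈ Matrix.unitaryGroup (Fin (2 ^ n) × Fin (2 ^ n)) ℂ) (θ : ElemState n) :
    ∃ (m : ℕ) (L : List (ElemState n)),
      L.map (fun v => vecCode v.1) ∈ search side ((matCode (flat C), n), vecCode θ.1) ∧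
      L.length = 2 ^ m ∧ ∀ A : Matrix (Fin (2 ^ n)) (Fin (2 ^ n)) ℂ, A.PosSemidef →
      2 ^ m * ∑ j, qf A ((kraus side (Nat.two_pow_pos n) (toComplexMat C) j).mulVec θ.ket) ≤
        4 * (L.map fun u => qf A u.ket).sum := by
  have hdec : ∃ c, IsCertificate side (decodeRows (matCode (flat C))) (decodeVec (vecCode θ.1)) c := by
    rw [decodeRows_gate, decodeVec_vecCode]
    exact exists_certificate (Nat.two_pow_pos n) (even_or_eq_one_two_pow n) side hC
      ((isUnitVec_iff θ.1).2 θ.2)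
  obtain ⟨t, ht, hs⟩ := exists_mem_search (p := ((matCode (flat C), n), vecCode θ.1)) hdec
  dsimp only at ht
  rw [decodeRows_gate, decodeVec_vecCode] at ht
  obtain ⟨L, hL, hb⟩ := IsCertificate.exists_bound (Nat.two_pow_pos n) ht
  have hlen := ht.1
  rw [hL] at hs hlen
  rw [List.length_map] at hlen
  refine ⟨t.1.2, L.map ElemState.ofUnit, ?_, by rw [List.length_map, hlen], ?_⟩
  · convert hs using 1
    rw [List.map_map, List.map_map]
    exact List.map_congr_left fun u _ => vecCode_eq _
  · intro A hA
    rw [List.map_map]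
    exact hb A hA

/-- The pull back of a matrix on one output register to the input. -/
noncomputable def krausPullBack (side : Bool) {d : ℕ} (hd : 0 < d)
    (C : Matrix (Fin d × Fin d) (Fin d × Fin d) ℂ) (A : Matrix (Fin d) (Fin d) ℂ) :
    Matrix (Fin d) (Fin d) ℂ :=
  ∑ j, (kraus side hd C j).conjTranspose * A * kraus side hd C j

theorem qf_krausPullBack (side : Bool) {d : ℕ} (hd : 0 < d)
    (C : Matrix (Fin d × Fin d) (Fin d × Fin d) ℂ) (A : Matrix (Fin d) (Fin d) ℂ) (x : Fin d → ℂ) :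
    qf (krausPullBack side hd C A) x = ∑ j, qf A ((kraus side hd C j).mulVec x) := by
  rw [krausPullBack, qf_sum]
  simp_rw [qf_conj]

theorem ofReal_list_sum {ι : Type} (l : List ι) (f : ι → ℝ) (hf : ∀ i, 0 ≤ f i) :
    ENNReal.ofReal (l.map f).sum = (l.map fun i => ENNReal.ofReal (f i)).sum := by
  induction l with
  | nil => simp
  | cons u l ih =>
    simp only [List.map_cons, List.sum_cons]
    rw [← ih, ENNReal.ofReal_add (hf u) (List.sum_nonneg _)]
    intro x hx
    obtain ⟨u, -, rfl⟩ := List.mem_map.1 hx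
    exact hf u

theorem ofReal_le_of_two_pow_mul_le {m : ℕ} {x y : ℝ} (h : 2 ^ m * x ≤ 4 * y) :
    ENNReal.ofReal x ≤ 4 * ((2⁻¹ : ℝ≥0∞) ^ m * ENNReal.ofReal y) := by
  have h2m : (2⁻¹ : ℝ≥0∞) ^ m = ENNReal.ofReal ((2 ^ m)⁻¹) := by
    rw [ENNReal.ofReal_inv_of_pos (by positivity), ENNReal.ofReal_pow (by norm_num), ENNReal.inv_pow]
    norm_num
  have h4 : (4 : ℝ≥0∞) = ENNReal.ofReal 4 := by norm_num
  rw [h2m, h4, ← ENNReal.ofReal_mul (by positivity), ← ENNReal.ofReal_mul (by norm_num)]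
  refine ENNReal.ofReal_le_ofReal ?_
  rw [mul_left_comm, ← div_eq_inv_mul, le_div_iff₀ (by positivity), mul_comm]
  exact h

/-- Domination by sampling, for an injectively encoded type of items. -/
theorem tsum_le_of_sampling {β : Type} {k : β → ℕ} (hk : Function.Injective k) {z y : ℕ}
    {c : ℝ≥0∞} {m : β → ℕ} {L : β → List β} {f g : β → ℝ≥0∞}
    (hc : ∀ u, ∑' x, uprob z (k x) y * ((2⁻¹ : ℝ≥0∞) ^ m x * (((L x).map k).count u)) ≤ c * uprob z u y)
    (hg : ∀ x, g x ≤ 4 * ((2⁻¹ : ℝ≥0∞) ^ m x * ((L x).map f).sum)) :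
    ∑' x, uprob z (k x) y * g x ≤ 4 * c * ∑' v, uprob z (k v) y * f v := by
  -- Each list sum is expanded by values, so that exchanging the two series leaves, for each `v`,
  -- exactly the sampling sum that `hc` bounds.
  have h1 : ∀ x, uprob z (k x) y * g x ≤ ∑' v, 4 * (uprob z (k x) y *
      ((2⁻¹ : ℝ≥0∞) ^ m x * (((L x).map k).count (k v)))) * f v := by
    intro x
    refine (mul_le_mul_right (hg x) _).trans (le_of_eq ?_)
    rw [← tsum_count_mul hk, ← ENNReal.tsum_mul_left, ← ENNReal.tsum_mul_left,
      ← ENNReal.tsum_mul_left]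
    refine tsum_congr fun v => ?_
    ring
  refine (ENNReal.tsum_le_tsum h1).trans ?_
  rw [ENNReal.tsum_comm, ← ENNReal.tsum_mul_left]
  refine ENNReal.tsum_le_tsum fun v => ?_
  rw [ENNReal.tsum_mul_right, ENNReal.tsum_mul_left, ← mul_assoc, mul_assoc 4 c]
  exact mul_le_mul_left (mul_le_mul_right (hc (k v)) _) _

theorem vecCode_val_injective (n : ℕ) : Function.Injective fun v : ElemState n => vecCode v.1 :=
  fun _ _ h => Subtype.ext (vecCode_inj h)

/-- The image of `𝛍` under the channel is at most `K𝛍`, tested against positive semidefinite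
matrices. The constant depends only on the sampler and not on `C`, which the search reads from the
auxiliary tape: here the relativization enters. -/
theorem exists_domination (side : Bool) : ∃ K : ℝ≥0∞, K ≠ ∞ ∧ ∀ (n : ℕ)
    (C : Matrix (Fin (2 ^ n) × Fin (2 ^ n)) (Fin (2 ^ n) × Fin (2 ^ n)) GaussRat)
    (A : Matrix (Fin (2 ^ n)) (Fin (2 ^ n)) ℂ),
    toComplexMat C ∈ Matrix.unitaryGroup (Fin (2 ^ n) × Fin (2 ^ n)) ℂ → A.PosSemidef →
    univExpect (matCode (flat C)) n (krausPullBack side (Nat.two_pow_pos n) (toComplexMat C) A) ≤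
      K * univExpect (matCode (flat C)) n A := by
  obtain ⟨c, -, hc, hsamp⟩ := exists_uprob_sampler (partrec_search side)
  refine ⟨4 * c, by finiteness, fun n C A hC hA => ?_⟩
  choose m L h1 h2 h3 using exists_search_list side hC
  refine tsum_le_of_sampling (vecCode_val_injective n) (m := m) (L := L) (fun u => ?_) fun θ => ?_
  · refine hsamp _ n u _ _ m (vecCode_val_injective n) fun θ => ⟨h1 θ, ?_⟩
    rw [List.length_map, h2 θ]
  · rw [← ofReal_list_sum _ _ fun v : ElemState n => qf_nonneg hA v.ket, qf_krausPullBack]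
    exact ofReal_le_of_two_pow_mul_le (h3 θ A hA)

end QAIT

namespace QAIT

/-! ### Pulling tests back along a gate -/

section

variable {d : ℕ}

/-- The product of Kraus matrices of both registers, as a flat matrix. -/
noncomputable def krausFlat (hd : 0 < d) (C : Matrix (Fin d × Fin d) (Fin d × Fin d) ℂ)
    (k : Fin d × Fin d) : Matrix (Fin (d * d)) (Fin (d * d)) ℂ :=
  flat (kraus true hd C k.1 ⊗ₖ kraus false hd C k.2)

/-- The pull back, scaled by `κ`, of a flat matrix on both output registers. -/
noncomputable def flatPullBack (hd : 0 < d) (C : Matrix (Fin d × Fin d) (Fin d × Fin d) ℂ) (κ : ℝ)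
    (N : Matrix (Fin (d * d)) (Fin (d * d)) ℂ) : Matrix (Fin (d * d)) (Fin (d * d)) ℂ :=
  (κ : ℂ) • ∑ k, (krausFlat hd C k).conjTranspose * N * krausFlat hd C k

theorem krausProd_gateRows (hd : 0 < d) (C : Matrix (Fin d × Fin d) (Fin d × Fin d) GaussRat)
    (k p q : Fin d × Fin d) :
    (krausProd (gateRows C) (finProdFinEquiv k : Fin (d * d)) (finProdFinEquiv p : Fin (d * d))
      (finProdFinEquiv q : Fin (d * d))).toComplex =
      krausFlat hd (toComplexMat C) k (finProdFinEquiv p) (finProdFinEquiv q) := by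
  have hdiv : ∀ p : Fin d × Fin d, ((finProdFinEquiv p : Fin (d * d)) : ℕ) / d = p.1 := by
    intro p
    rw [finProdFinEquiv_apply_val, Nat.add_mul_div_left _ _ hd, Nat.div_eq_of_lt p.2.2, zero_add]
  have hmod : ∀ p : Fin d × Fin d, ((finProdFinEquiv p : Fin (d * d)) : ℕ) % d = p.2 := by
    intro p
    rw [finProdFinEquiv_apply_val, Nat.add_mul_mod_self_left, Nat.mod_eq_of_lt p.2.2]
  rw [krausProd, dim_gateRows, hdiv, hdiv, hdiv, hmod, hmod, hmod, GaussRat.toComplex_mul,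
    krausEntry_gateRows true hd, krausEntry_gateRows false hd]
  simp [krausFlat, flat, Matrix.kroneckerMap_apply]

/-- The pull back of an elementary matrix. -/
def elemPullBack (κ : GaussRat) (C : Matrix (Fin d × Fin d) (Fin d × Fin d) GaussRat)
    (M : Matrix (Fin (d * d)) (Fin (d * d)) GaussRat) : Matrix (Fin (d * d)) (Fin (d * d)) GaussRat :=
  Matrix.of fun p q => κ * ∑ k : Fin (d * d), ∑ r : Fin (d * d), ∑ s : Fin (d * d),
    (krausProd (gateRows C) k r p).conj * M r s * krausProd (gateRows C) k s q

theorem encode_pullBack (κ : GaussRat) (C : Matrix (Fin d × Fin d) (Fin d × Fin d) GaussRat)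
    (M : Matrix (Fin (d * d)) (Fin (d * d)) GaussRat) :
    Encodable.encode (pullBack κ (gateRows C) (decodeRows (matCode M))) =
      matCode (elemPullBack κ C M) := by
  rw [decodeRows_matCode, matCode_eq, pullBack, length_gateRows, table_eq_ofFn]
  congr; funext p; congr; funext q
  have h : ∀ r s : Fin (d * d), entry (List.ofFn fun i => List.ofFn (M i)) r s = M r s :=
    entry_ofFn M
  simp only [Finset.sum_range, h, elemPullBack, Matrix.of_apply]

theorem toComplexMat_elemPullBack (hd : 0 < d) {κ : GaussRat} {r : ℝ} (hκ : κ.toComplex = r)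
    (C : Matrix (Fin d × Fin d) (Fin d × Fin d) GaussRat)
    (M : Matrix (Fin (d * d)) (Fin (d * d)) GaussRat) :
    toComplexMat (elemPullBack κ C M) = flatPullBack hd (toComplexMat C) r (toComplexMat M) := by
  ext p q
  obtain ⟨p, rfl⟩ := finProdFinEquiv.surjective p
  obtain ⟨q, rfl⟩ := finProdFinEquiv.surjective q
  have hentry : ∀ k p q : Fin d × Fin d, (krausProd (gateRows C) (finProdFinEquiv k : Fin (d * d))
      (finProdFinEquiv p : Fin (d * d)) (finProdFinEquiv q : Fin (d * d))).toComplex =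
      krausFlat hd (toComplexMat C) k (finProdFinEquiv p) (finProdFinEquiv q) :=
    krausProd_gateRows hd C
  simp only [toComplexMat, elemPullBack, Matrix.map_apply, Matrix.of_apply, GaussRat.toComplex_mul,
    GaussRat.toComplex_sum, GaussRat.toComplex_conj, hκ, flatPullBack, Matrix.smul_apply, smul_eq_mul,
    Matrix.sum_apply]
  congr 1
  rw [← Equiv.sum_comp finProdFinEquiv]
  refine Finset.sum_congr rfl fun k _ => ?_
  rw [Matrix.mul_apply, Finset.sum_comm, ← Equiv.sum_comp finProdFinEquiv]
  conv_rhs => rw [← Equiv.sum_comp finProdFinEquiv]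
  refine Finset.sum_congr rfl fun s _ => ?_
  rw [Matrix.mul_apply, Finset.sum_mul, ← Equiv.sum_comp finProdFinEquiv]
  conv_rhs => rw [← Equiv.sum_comp finProdFinEquiv]
  refine Finset.sum_congr rfl fun t _ => ?_
  simp only [hentry, Matrix.conjTranspose_apply, Matrix.map_apply]
  rfl

theorem flatPullBack_sub (hd : 0 < d) (C : Matrix (Fin d × Fin d) (Fin d × Fin d) ℂ) (r : ℝ)
    (M N : Matrix (Fin (d * d)) (Fin (d * d)) ℂ) :
    flatPullBack hd C r M - flatPullBack hd C r N = flatPullBack hd C r (M - N) := by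
  simp only [flatPullBack, ← smul_sub, ← Finset.sum_sub_distrib, Matrix.mul_sub, Matrix.sub_mul]

theorem posSemidef_flatPullBack (hd : 0 < d) (C : Matrix (Fin d × Fin d) (Fin d × Fin d) ℂ) {r : ℝ}
    (hr : 0 ≤ r) {M : Matrix (Fin (d * d)) (Fin (d * d)) ℂ} (hM : M.PosSemidef) :
    (flatPullBack hd C r M).PosSemidef :=
  (Matrix.posSemidef_sum _ fun _ _ => hM.conjTranspose_mul_mul_same _).smul
    (by exact_mod_cast hr : (0 : ℂ) ≤ (r : ℂ))

theorem continuous_flatPullBack (hd : 0 < d) (C : Matrix (Fin d × Fin d) (Fin d × Fin d) ℂ) (r : ℝ) :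
    Continuous (flatPullBack hd C r) := by
  unfold flatPullBack
  fun_prop

/-- The pull back of a lower computable matrix is lower computable, uniformly in the gate. -/
theorem exists_lowerComputes_pullBack {κ : GaussRat} {r : ℝ} (hκ : κ.toComplex = r) (hr : 0 ≤ r) :
    ∃ e, ∀ (d : ℕ) (hd : 0 < d) (C : Matrix (Fin d × Fin d) (Fin d × Fin d) GaussRat) (q : List Bool)
      (σ : Matrix (Fin (d * d)) (Fin (d * d)) ℂ), LowerComputes (matCode (flat C)) q σ →
      LowerComputes (matCode (flat C)) (word e q) (flatPullBack hd (toComplexMat C) r σ) := by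
  -- `p.1.1` is the auxiliary tape with the code of the gate, so one index `e` serves all gates.
  have hg : Computable fun p : (ℕ × ℕ) × ℕ =>
      Encodable.encode (pullBack κ (decodeRows p.1.1) (decodeRows p.2)) :=
    (Primrec.encode.comp (primrec_pullBack κ (primrec_decodeRows.comp (Primrec.fst.comp Primrec.fst))
      (primrec_decodeRows.comp Primrec.snd))).to_comp
  obtain ⟨e, he⟩ := exists_transducer hg
  refine ⟨e, fun d hd C q σ ⟨hread, a, h0, h1, h2, h3, h4, h5⟩ => ?_⟩
  have hem := fun i x => (he (matCode (flat C)) 0 q).2 i x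
  refine ⟨(he _ _ _).1 hread, fun i => elemPullBack κ C (a i), ?_, ?_, ?_, ?_, ?_, ?_⟩
  · obtain ⟨x, hx⟩ := h0
    exact ⟨_, (hem 0 _).2 ⟨x, hx, rfl⟩⟩
  · intro i x hx
    obtain ⟨x', hx', rfl⟩ := (hem i x).1 hx
    rw [h1 i x' hx']
    dsimp only
    rw [decodeRows_gate, encode_pullBack]
  · intro i hi
    dsimp only
    rw [h2 i]
    rintro ⟨x, hx⟩
    exact hi ⟨_, (hem (i + 1) _).2 ⟨x, hx, rfl⟩⟩
  · intro i
    rw [toComplexMat_elemPullBack hd hκ]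
    exact posSemidef_flatPullBack hd _ hr (h3 i)
  · intro i
    rw [toComplexMat_elemPullBack hd hκ, toComplexMat_elemPullBack hd hκ, flatPullBack_sub]
    exact posSemidef_flatPullBack hd _ hr (h4 i)
  · simp only [toComplexMat_elemPullBack hd hκ]
    exact ((continuous_flatPullBack hd _ r).tendsto σ).comp h5

/-- The pull back acts on the whole two-register matrix by the products `Kⱼ ⊗ Lₖ`. It can therefore
be applied to each approximation of `A ⊗ B`, which need not be a product, while the limit again is
one. -/
theorem flatPullBack_kronecker (hd : 0 < d) (C : Matrix (Fin d × Fin d) (Fin d × Fin d) ℂ) (r : ℝ)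
    (A B : Matrix (Fin d) (Fin d) ℂ) : flatPullBack hd C r (flat (A ⊗ₖ B)) =
      flat (((r : ℂ) • krausPullBack true hd C A) ⊗ₖ krausPullBack false hd C B) := by
  have h : ((r : ℂ) • krausPullBack true hd C A) ⊗ₖ krausPullBack false hd C B =
      (r : ℂ) • ∑ k : Fin d × Fin d, (kraus true hd C k.1 ⊗ₖ kraus false hd C k.2).conjTranspose *
        (A ⊗ₖ B) * (kraus true hd C k.1 ⊗ₖ kraus false hd C k.2) := by
    rw [Matrix.smul_kronecker]
    congr 1
    simp only [Matrix.conjTranspose_kronecker, ← Matrix.mul_kronecker_mul]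
    ext p q
    simp only [krausPullBack, Matrix.kroneckerMap_apply, Matrix.sum_apply, Finset.sum_mul_sum,
      Fintype.sum_prod_type]
  rw [h]
  ext p q
  simp only [flatPullBack, krausFlat, Matrix.smul_apply, Matrix.sum_apply, flat, Matrix.reindex_apply,
    Matrix.submatrix_apply, Matrix.conjTranspose_submatrix, Matrix.submatrix_mul_equiv]

theorem flat_injective : Function.Injective
    (flat : Matrix (Fin d × Fin d) (Fin d × Fin d) ℂ → Matrix (Fin (d * d)) (Fin (d * d)) ℂ) :=
  (Matrix.reindex finProdFinEquiv finProdFinEquiv).injective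

/-- Codes are injective and a finite output is continued by its last entry, so a program determines
its whole sequence and hence its limit. -/
theorem LowerComputes.unique {z : ℕ} {q : List Bool} {σ σ' : Matrix (Fin d) (Fin d) ℂ}
    (h : LowerComputes z q σ) (h' : LowerComputes z q σ') : σ = σ' := by
  obtain ⟨-, a, h0, h1, h2, -, -, h5⟩ := h
  obtain ⟨-, a', -, h1', h2', -, -, h5'⟩ := h'
  have : a = a' := by
    funext i
    induction i with
    | zero =>
      obtain ⟨x, hx⟩ := h0
      exact matCode_inj ((h1 0 x hx).symm.trans (h1' 0 x hx))
    | succ i ih =>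
      by_cases hi : ∃ x, Emits z 0 q (i + 1) x
      · obtain ⟨x, hx⟩ := hi
        exact matCode_inj ((h1 _ x hx).symm.trans (h1' _ x hx))
      · rw [h2 i hi, h2' i hi, ih]
  subst this
  exact tendsto_nhds_unique h5 h5'

end

end QAIT

namespace QAIT

/-! ### Traces against the universal matrix -/

theorem trace_mul_ketBra {n : ℕ} (A : Matrix (Fin (2 ^ n)) (Fin (2 ^ n)) ℂ) (φ : Qubits n) :
    (A * ketBra φ).trace = A.mulVec φ ⬝ᵥ star (φ : Fin (2 ^ n) → ℂ) := by
  have : ketBra φ = Matrix.vecMulVec φ (star (φ : Fin (2 ^ n) → ℂ)) := rfl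
  rw [this, Matrix.mul_vecMulVec, Matrix.trace_vecMulVec]

theorem dotProduct_star_eq_qf {ι : Type} [Fintype ι] {A : Matrix ι ι ℂ} (hA : A.PosSemidef)
    (v : ι → ℂ) : A.mulVec v ⬝ᵥ star v = (qf A v : ℂ) := by
  have h := hA.dotProduct_mulVec_nonneg v
  rw [dotProduct_comm] at h
  exact Complex.ext rfl (Complex.le_def.1 h).2.symm

theorem trace_mul_ketBra_of_posSemidef {n : ℕ} {A : Matrix (Fin (2 ^ n)) (Fin (2 ^ n)) ℂ}
    (hA : A.PosSemidef) (φ : Qubits n) : (A * ketBra φ).trace = (qf A φ : ℂ) := by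
  rw [trace_mul_ketBra, dotProduct_star_eq_qf hA]

theorem sum_norm_sq_eq_one {n : ℕ} {φ : Qubits n} (hφ : ‖φ‖ = 1) : ∑ i, ‖φ i‖ ^ 2 = 1 := by
  rw [← EuclideanSpace.norm_sq_eq, hφ, one_pow]

theorem norm_apply_le_one {n : ℕ} {φ : Qubits n} (hφ : ‖φ‖ = 1) (i : Fin (2 ^ n)) : ‖φ i‖ ≤ 1 :=
  hφ ▸ PiLp.norm_apply_le φ i

/-- A crude bound, uniform over unit vectors, that serves only to make `univExpect` finite. -/
theorem qf_le_sum_norm {n : ℕ} (A : Matrix (Fin (2 ^ n)) (Fin (2 ^ n)) ℂ) {φ : Qubits n}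
    (hφ : ‖φ‖ = 1) : qf A φ ≤ ∑ i, ∑ j, ‖A i j‖ := by
  refine (Complex.re_le_norm _).trans ((norm_sum_le _ _).trans (Finset.sum_le_sum fun i _ => ?_))
  have hi : ‖star (φ : Fin (2 ^ n) → ℂ) i‖ = ‖φ i‖ := norm_star (φ i)
  rw [norm_mul, hi]
  refine (mul_le_of_le_one_right (norm_nonneg _) (norm_apply_le_one hφ i)).trans ?_
  change ‖∑ j, A i j * φ j‖ ≤ _
  refine (norm_sum_le _ _).trans (Finset.sum_le_sum fun j _ => ?_)
  rw [norm_mul]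
  exact mul_le_of_le_one_right (norm_nonneg _) (norm_apply_le_one hφ j)

theorem ElemState.norm_ket {n : ℕ} (v : ElemState n) : ‖v.ket‖ = 1 := v.2

theorem tsum_uprob_elemState_le_one (z n : ℕ) : ∑' v : ElemState n, uprob z (vecCode v.1) n ≤ 1 :=
  (ENNReal.tsum_comp_le_tsum_of_injective (vecCode_val_injective n) fun x => uprob z x n).trans
    (uprob_sum_le_one z n)

theorem univExpect_ne_top (z n : ℕ) (A : Matrix (Fin (2 ^ n)) (Fin (2 ^ n)) ℂ) :
    univExpect z n A ≠ ∞ := by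
  have h : univExpect z n A ≤ 1 * ENNReal.ofReal (∑ i, ∑ j, ‖A i j‖) := by
    rw [univExpect]
    refine (ENNReal.tsum_le_tsum fun v => mul_le_mul_right
      (ENNReal.ofReal_le_ofReal (qf_le_sum_norm A v.norm_ket)) _).trans ?_
    rw [ENNReal.tsum_mul_right]
    exact mul_le_mul_left (tsum_uprob_elemState_le_one z n) _
  exact ne_top_of_le_ne_top (by finiteness) h

theorem uprob_ne_top (z x y : ℕ) : uprob z x y ≠ ∞ :=
  ne_top_of_le_ne_top ENNReal.one_ne_top ((ENNReal.le_tsum x).trans (uprob_sum_le_one z y))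

/-- The trace against `A` is additive and continuous, so it passes through the series for `𝛍`; this
translates the test condition into sums in `ℝ≥0∞`. -/
theorem trace_mul_univMatrix {z n : ℕ} {A : Matrix (Fin (2 ^ n)) (Fin (2 ^ n)) ℂ}
    (hA : A.PosSemidef) : (A * univMatrix z n).trace = ((univExpect z n A).toReal : ℂ) := by
  let T : Matrix (Fin (2 ^ n)) (Fin (2 ^ n)) ℂ →+ ℂ :=
    { toFun := fun M => (A * M).trace
      map_zero' := by simp
      map_add' := fun M N => by rw [mul_add, Matrix.trace_add] }
  have hT : Continuous T := by
    change Continuous fun M : Matrix (Fin (2 ^ n)) (Fin (2 ^ n)) ℂ => (A * M).trace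
    fun_prop
  have h1 := ((summable_univMatrix z n).hasSum.map T hT).tsum_eq
  have h2 : T (∑' v : ElemState n, (((uprob z (vecCode v.1) n).toReal : ℝ) : ℂ) • ketBra v.ket) =
    (A * univMatrix z n).trace := rfl
  rw [← h2, ← h1, univExpect, ENNReal.tsum_toReal_eq fun v =>
    ENNReal.mul_ne_top (uprob_ne_top _ _ _) ENNReal.ofReal_ne_top, Complex.ofReal_tsum]
  refine tsum_congr fun v => ?_
  change (A * ((((uprob z (vecCode v.1) n).toReal : ℝ) : ℂ) • ketBra v.ket)).trace = _
  rw [Matrix.mul_smul, Matrix.trace_smul, trace_mul_ketBra_of_posSemidef hA, ENNReal.toReal_mul,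
    ENNReal.toReal_ofReal (qf_nonneg hA _), smul_eq_mul]
  push_cast
  rfl

theorem trace_kronecker_univMatrix {z n : ℕ} {A B : Matrix (Fin (2 ^ n)) (Fin (2 ^ n)) ℂ}
    (hA : A.PosSemidef) (hB : B.PosSemidef) :
    ((A ⊗ₖ B) * (univMatrix z n ⊗ₖ univMatrix z n)).trace.re =
      (univExpect z n A * univExpect z n B).toReal := by
  rw [← Matrix.mul_kronecker_mul, Matrix.trace_kronecker, trace_mul_univMatrix hA,
    trace_mul_univMatrix hB, ENNReal.toReal_mul, ← Complex.ofReal_mul, Complex.ofReal_re]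

theorem trace_kronecker_univMatrix_le_one_iff {z n : ℕ} {A B : Matrix (Fin (2 ^ n)) (Fin (2 ^ n)) ℂ}
    (hA : A.PosSemidef) (hB : B.PosSemidef) :
    ((A ⊗ₖ B) * (univMatrix z n ⊗ₖ univMatrix z n)).trace.re ≤ 1 ↔
      univExpect z n A * univExpect z n B ≤ 1 := by
  rw [trace_kronecker_univMatrix hA hB, ← ENNReal.toReal_one, ENNReal.toReal_le_toReal
    (ENNReal.mul_ne_top (univExpect_ne_top _ _ _) (univExpect_ne_top _ _ _)) ENNReal.one_ne_top]

theorem trace_kronecker_ketBra {n : ℕ} {A B : Matrix (Fin (2 ^ n)) (Fin (2 ^ n)) ℂ}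
    (hA : A.PosSemidef) (hB : B.PosSemidef) (φ χ : Qubits n) :
    ((A ⊗ₖ B) * (ketBra φ ⊗ₖ ketBra χ)).trace.re = qf A φ * qf B χ := by
  rw [← Matrix.mul_kronecker_mul, Matrix.trace_kronecker, trace_mul_ketBra_of_posSemidef hA,
    trace_mul_ketBra_of_posSemidef hB, ← Complex.ofReal_mul, Complex.ofReal_re]

theorem qf_smul {ι : Type} [Fintype ι] (A : Matrix ι ι ℂ) (c : ℂ) (v : ι → ℂ) :
    qf A (c • v) = ‖c‖ ^ 2 * qf A v := by
  rw [qf, qf, Matrix.mulVec_smul, star_smul, smul_dotProduct, dotProduct_smul, smul_smul, smul_eq_mul,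
    Complex.star_def, Complex.mul_conj', ← Complex.ofReal_pow, Complex.re_ofReal_mul]

theorem qf_smul_left {ι : Type} [Fintype ι] (A : Matrix ι ι ℂ) (r : ℝ) (v : ι → ℂ) :
    qf ((r : ℂ) • A) v = r * qf A v := by
  rw [qf, qf, Matrix.smul_mulVec, smul_dotProduct, smul_eq_mul, Complex.re_ofReal_mul]

theorem posSemidef_krausPullBack (side : Bool) {d : ℕ} (hd : 0 < d)
    (C : Matrix (Fin d × Fin d) (Fin d × Fin d) ℂ) {A : Matrix (Fin d) (Fin d) ℂ} (hA : A.PosSemidef) :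
    (krausPullBack side hd C A).PosSemidef :=
  Matrix.posSemidef_sum _ fun _ _ => hA.conjTranspose_mul_mul_same _

theorem withAncilla_eq_tensor {n : ℕ} (ψ : Qubits n) :
    withAncilla (Nat.two_pow_pos n) ψ = tensor ψ (ketZero n) := by
  funext p
  simp only [withAncilla, tensor, ketZero, PiLp.single_apply]

section

variable {n : ℕ} {C : Matrix (Fin (2 ^ n) × Fin (2 ^ n)) (Fin (2 ^ n) × Fin (2 ^ n)) ℂ} {ψ φ χ : Qubits n}

/-- Since the image of `ψ` is the product `φ ⊗ χ`, its slices are `Kⱼψ = χⱼφ`, and `∑ |χⱼ|² = 1`. -/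
theorem qf_krausPullBack_true (h : C.mulVec (tensor ψ (ketZero n)) = tensor φ χ) (hχ : ‖χ‖ = 1)
    (A : Matrix (Fin (2 ^ n)) (Fin (2 ^ n)) ℂ) :
    qf (krausPullBack true (Nat.two_pow_pos n) C A) ψ = qf A φ := by
  have hj : ∀ j, (kraus true (Nat.two_pow_pos n) C j).mulVec ψ = χ j • (φ : Fin (2 ^ n) → ℂ) := by
    intro j
    funext a
    rw [kraus_mulVec, withAncilla_eq_tensor, h]
    simp [tensor, mul_comm]
  rw [qf_krausPullBack]
  simp_rw [hj, qf_smul]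
  rw [← Finset.sum_mul, sum_norm_sq_eq_one hχ, one_mul]

theorem qf_krausPullBack_false (h : C.mulVec (tensor ψ (ketZero n)) = tensor φ χ) (hφ : ‖φ‖ = 1)
    (A : Matrix (Fin (2 ^ n)) (Fin (2 ^ n)) ℂ) :
    qf (krausPullBack false (Nat.two_pow_pos n) C A) ψ = qf A χ := by
  have hj : ∀ j, (kraus false (Nat.two_pow_pos n) C j).mulVec ψ = φ j • (χ : Fin (2 ^ n) → ℂ) := by
    intro j
    funext a
    rw [kraus_mulVec, withAncilla_eq_tensor, h]
    simp [tensor]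
  rw [qf_krausPullBack]
  simp_rw [hj, qf_smul]
  rw [← Finset.sum_mul, sum_norm_sq_eq_one hφ, one_mul]

end

/-- The pull back of a product test, suitably scaled, is a product test. -/
theorem exists_scale_productTests : ∃ r : ℚ, 0 < r ∧ ∀ (n : ℕ)
    (C : Matrix (Fin (2 ^ n) × Fin (2 ^ n)) (Fin (2 ^ n) × Fin (2 ^ n)) GaussRat),
    toComplexMat C ∈ Matrix.unitaryGroup (Fin (2 ^ n) × Fin (2 ^ n)) ℂ →
    ∀ A B : Matrix (Fin (2 ^ n)) (Fin (2 ^ n)) ℂ, A.PosSemidef → B.PosSemidef →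
    univExpect (matCode (flat C)) n A * univExpect (matCode (flat C)) n B ≤ 1 →
    univExpect (matCode (flat C)) n
        (((r : ℝ) : ℂ) • krausPullBack true (Nat.two_pow_pos n) (toComplexMat C) A) *
      univExpect (matCode (flat C)) n (krausPullBack false (Nat.two_pow_pos n) (toComplexMat C) B) ≤ 1 := by
  obtain ⟨K₁, h₁, hK₁⟩ := exists_domination true
  obtain ⟨K₂, h₂, hK₂⟩ := exists_domination false
  -- The two domination constants multiply; the scale `1 / N` compensates their product and is put
  -- entirely on the first factor.
  obtain ⟨N, hN⟩ := ENNReal.exists_nat_gt (ENNReal.mul_ne_top h₁ h₂)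
  have hN0 : 0 < N := by
    have : (0 : ℝ≥0∞) < N := (zero_le).trans_lt hN
    exact_mod_cast this
  refine ⟨(N : ℚ)⁻¹, by positivity, fun n C hC A B hA hB hAB => ?_⟩
  have hsmul : univExpect (matCode (flat C)) n
      ((((N : ℚ)⁻¹ : ℚ) : ℝ) • krausPullBack true (Nat.two_pow_pos n) (toComplexMat C) A) =
      (N : ℝ≥0∞)⁻¹ * univExpect (matCode (flat C)) n
        (krausPullBack true (Nat.two_pow_pos n) (toComplexMat C) A) := by
    rw [univExpect, univExpect, ← ENNReal.tsum_mul_left]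
    refine tsum_congr fun v => ?_
    have : ENNReal.ofReal (qf ((((N : ℚ)⁻¹ : ℚ) : ℝ) •
        krausPullBack true (Nat.two_pow_pos n) (toComplexMat C) A) v.ket) = (N : ℝ≥0∞)⁻¹ *
        ENNReal.ofReal (qf (krausPullBack true (Nat.two_pow_pos n) (toComplexMat C) A) v.ket) := by
      have h := qf_smul_left (krausPullBack true (Nat.two_pow_pos n) (toComplexMat C) A)
        (((N : ℚ)⁻¹ : ℚ) : ℝ) v.ket
      rw [Complex.coe_smul] at h
      rw [h, ENNReal.ofReal_mul (by positivity)]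
      congr 1
      push_cast
      rw [ENNReal.ofReal_inv_of_pos (by exact_mod_cast hN0), ENNReal.ofReal_natCast]
    rw [this, mul_left_comm]
  rw [Complex.coe_smul, hsmul]
  calc _ ≤ (N : ℝ≥0∞)⁻¹ * (K₁ * univExpect (matCode (flat C)) n A) *
        (K₂ * univExpect (matCode (flat C)) n B) := by
        gcongr
        · exact hK₁ n C A hC hA
        · exact hK₂ n C B hC hB
    _ = (N : ℝ≥0∞)⁻¹ * (K₁ * K₂) *
        (univExpect (matCode (flat C)) n A * univExpect (matCode (flat C)) n B) := by ring
    _ ≤ (N : ℝ≥0∞)⁻¹ * N * 1 := by gcongr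
    _ = 1 := by
        rw [mul_one, ENNReal.inv_mul_cancel (by exact_mod_cast hN0.ne') (by finiteness)]

end QAIT

namespace QAIT

/-! ### The trace of the universal test as a sum over programs -/

/-- Product tests with programs that lower compute them. -/
abbrev TestProgram (z n : ℕ) : Type :=
  {p : productTests z n × List Bool // LowerComputes z p.2 (flat p.1.1)}

/-- With tests and their programs as one index set, the pull back becomes an injection of the index
set into itself. -/
theorem testTrace_eq_tsum (z n : ℕ) (σ ρ : Matrix (Fin (2 ^ n)) (Fin (2 ^ n)) ℂ) :
    testTrace z n σ ρ = ∑' s : TestProgram z n, uprob z (Encodable.encode s.1.2) n *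
      ENNReal.ofReal (s.1.1.1 * (σ ⊗ₖ ρ)).trace.re := by
  classical
  have h := tsum_subtype {p : productTests z n × List Bool | LowerComputes z p.2 (flat p.1.1)}
    fun p => uprob z (Encodable.encode p.2) n * ENNReal.ofReal (p.1.1 * (σ ⊗ₖ ρ)).trace.re
  refine Eq.trans ?_ h.symm
  rw [ENNReal.tsum_prod']
  refine tsum_congr fun M => ?_
  rw [lowerProb, ← ENNReal.tsum_mul_right]
  refine tsum_congr fun q => ?_
  simp only [Set.indicator_apply, Set.mem_ofPred_eq, ite_mul, zero_mul]

theorem TestProgram.ext_program {z n : ℕ} {s t : TestProgram z n} (h : s.1.2 = t.1.2) : s = t := by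
  refine Subtype.ext (Prod.ext (Subtype.ext (flat_injective ?_)) h)
  have := s.2
  rw [h] at this
  exact this.unique t.2

theorem tsum_testProgram_le_one (z n : ℕ) :
    ∑' s : TestProgram z n, uprob z (Encodable.encode s.1.2) n ≤ 1 :=
  (ENNReal.tsum_comp_le_tsum_of_injective (f := fun s : TestProgram z n => Encodable.encode s.1.2)
    (fun _ _ h => TestProgram.ext_program (Encodable.encode_injective h))
    fun x => uprob z x n).trans (uprob_sum_le_one z n)

theorem primrec_word (e : ℕ) : Primrec (word e) :=
  Primrec.list_append.comp (Primrec.const _) (Primrec.list_cons.comp (Primrec.const false) Primrec.id)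

theorem exists_uprob_word (e : ℕ) : ∃ c : ℝ≥0∞, c ≠ ∞ ∧ ∀ z (q : List Bool) n,
    uprob z (Encodable.encode q) n ≤ c * uprob z (Encodable.encode (word e q)) n := by
  obtain ⟨c, -, hc, h⟩ := exists_uprob_map
    (f := fun x => Encodable.encode (word e ((Encodable.decode x).getD [])))
    (Primrec.encode.comp ((primrec_word e).comp
      (Primrec.option_getD.comp Primrec.decode (Primrec.const [])))).to_comp
  refine ⟨c, hc, fun z q n => ?_⟩
  simpa [Encodable.encodek] using h z (Encodable.encode q) n

/-- Conservation of the universal test under a gate that splits a state. -/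
theorem exists_testTrace_le : ∃ K : ℝ≥0∞, K ≠ ∞ ∧ ∀ (n : ℕ)
    (C : Matrix (Fin (2 ^ n) × Fin (2 ^ n)) (Fin (2 ^ n) × Fin (2 ^ n)) GaussRat) (ψ φ χ : Qubits n),
    toComplexMat C ∈ Matrix.unitaryGroup (Fin (2 ^ n) × Fin (2 ^ n)) ℂ → ‖φ‖ = 1 → ‖χ‖ = 1 →
    (toComplexMat C).mulVec (tensor ψ (ketZero n)) = tensor φ χ →
    testTrace (matCode (flat C)) n (ketBra φ) (ketBra χ) ≤
      K * testTrace (matCode (flat C)) n (ketBra ψ) (ketBra ψ) := by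
  obtain ⟨r, hr, htest⟩ := exists_scale_productTests
  have hr' : (0 : ℝ) < r := by exact_mod_cast hr
  have hκ : (⟨r, 0⟩ : GaussRat).toComplex = ((r : ℝ) : ℂ) := by
    apply Complex.ext <;> simp [GaussRat.toComplex]
  obtain ⟨e, he⟩ := exists_lowerComputes_pullBack hκ hr'.le
  obtain ⟨c, hc, hprob⟩ := exists_uprob_word e
  -- `c` is the price of prefixing `1ᵉ0` to a program, and `r⁻¹` undoes the scaling of the pulled
  -- back test.
  refine ⟨c * (ENNReal.ofReal r)⁻¹, ENNReal.mul_ne_top hc (by simpa using hr), ?_⟩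
  intro n C ψ φ χ hC hφ hχ h
  have hpull : ∀ s : TestProgram (matCode (flat C)) n, ∃ t : TestProgram (matCode (flat C)) n,
      t.1.2 = word e s.1.2 ∧ (t.1.1.1 * (ketBra ψ ⊗ₖ ketBra ψ)).trace.re =
        r * (s.1.1.1 * (ketBra φ ⊗ₖ ketBra χ)).trace.re := by
    rintro ⟨⟨⟨M, ⟨A, B, hA, hB, rfl⟩, -, hM⟩, q⟩, hq⟩
    have hq' := he _ (Nat.two_pow_pos n) C q _ hq
    rw [flatPullBack_kronecker] at hq'
    have hA' : (((r : ℝ) : ℂ) • krausPullBack true (Nat.two_pow_pos n) (toComplexMat C) A).PosSemidef :=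
      (posSemidef_krausPullBack true _ _ hA).smul (by exact_mod_cast hr'.le : (0 : ℂ) ≤ ((r : ℝ) : ℂ))
    have hB' := posSemidef_krausPullBack false (Nat.two_pow_pos n) (toComplexMat C) hB
    refine ⟨⟨⟨⟨_, ⟨_, _, hA', hB', rfl⟩, ⟨_, hq'⟩, ?_⟩, word e q⟩, hq'⟩, rfl, ?_⟩
    · rw [trace_kronecker_univMatrix_le_one_iff hA' hB']
      exact htest n C hC A B hA hB ((trace_kronecker_univMatrix_le_one_iff hA hB).1 hM)
    · dsimp only
      rw [trace_kronecker_ketBra hA' hB', trace_kronecker_ketBra hA hB, qf_smul_left,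
        qf_krausPullBack_true h hχ, qf_krausPullBack_false h hφ, mul_assoc]
  choose t ht htr using hpull
  -- The prefix `1ᵉ0` can be removed, and a program determines its test.
  have hinj : Function.Injective t := by
    intro s s' hs
    refine TestProgram.ext_program ((word_inj (e := e) (e' := e)).1 ?_).2
    rw [← ht, ← ht, hs]
  rw [testTrace_eq_tsum, testTrace_eq_tsum, ← ENNReal.tsum_mul_left]
  refine le_trans (ENNReal.tsum_le_tsum fun s => ?_) (ENNReal.tsum_comp_le_tsum_of_injective hinj _)
  rw [htr, ENNReal.ofReal_mul hr'.le, ht]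
  have h0 : ENNReal.ofReal r ≠ 0 := by simpa using hr
  calc _ ≤ c * uprob (matCode (flat C)) (Encodable.encode (word e s.1.2)) n *
        ENNReal.ofReal (s.1.1.1 * (ketBra φ ⊗ₖ ketBra χ)).trace.re := by
        gcongr; exact hprob _ _ _
    _ = (ENNReal.ofReal r)⁻¹ * ENNReal.ofReal r * (c *
        uprob (matCode (flat C)) (Encodable.encode (word e s.1.2)) n *
        ENNReal.ofReal (s.1.1.1 * (ketBra φ ⊗ₖ ketBra χ)).trace.re) := by
        rw [ENNReal.inv_mul_cancel h0 ENNReal.ofReal_ne_top, one_mul]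
    _ = _ := by ring

/-! ### The trace of the universal test is positive and finite -/

/-- The basis states are elementary. -/
def ElemState.basis {n : ℕ} (i : Fin (2 ^ n)) : ElemState n :=
  .ofUnit ⟨fun j => if j = i then 1 else 0, by
    have : ∀ j, ((if j = i then 1 else 0 : GaussRat)).toComplex = if j = i then 1 else 0 := by
      intro j; split_ifs <;> simp
    simp [IsUnitVec, dotProduct, cvec, this]⟩

theorem ElemState.basis_ket {n : ℕ} (i j : Fin (2 ^ n)) :
    (ElemState.basis i).ket j = if j = i then 1 else 0 := by
  change ((if j = i then 1 else 0 : GaussRat)).toComplex = _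
  split_ifs <;> simp

theorem ElemState.basis_injective {n : ℕ} :
    Function.Injective (ElemState.basis : Fin (2 ^ n) → ElemState n) := by
  intro i j h
  have := congrArg (fun v : ElemState n => v.ket i) h
  simpa [ElemState.basis_ket] using this

open scoped MatrixOrder Matrix.Norms.L2Operator in
theorem exists_eq_conjTranspose_mul_self {m : Type*} [Fintype m] [DecidableEq m]
    {A : Matrix m m ℂ} (hA : A.PosSemidef) : ∃ B : Matrix m m ℂ, A = B.conjTranspose * B :=
  CStarAlgebra.nonneg_iff_eq_star_mul_self.mp hA.nonneg

/-- A positive semidefinite form on a unit vector is at most the trace: write `A = B*B` and apply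
Cauchy–Schwarz to each row of `B`. -/
theorem qf_le_sum_basis {n : ℕ} {A : Matrix (Fin (2 ^ n)) (Fin (2 ^ n)) ℂ} (hA : A.PosSemidef)
    {φ : Qubits n} (hφ : ‖φ‖ = 1) : qf A φ ≤ ∑ i, qf A (ElemState.basis i).ket := by
  obtain ⟨B, rfl⟩ := exists_eq_conjTranspose_mul_self hA
  have hq : ∀ v : Fin (2 ^ n) → ℂ, qf (B.conjTranspose * B) v = ∑ k, ‖B.mulVec v k‖ ^ 2 := by
    intro v
    have h := qf_conj (1 : Matrix (Fin (2 ^ n)) (Fin (2 ^ n)) ℂ) B v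
    rw [mul_one] at h
    rw [h, qf, Matrix.one_mulVec, dotProduct, Complex.re_sum]
    refine Finset.sum_congr rfl fun k _ => ?_
    rw [Pi.star_apply, Complex.star_def, Complex.mul_conj', ← Complex.ofReal_pow, Complex.ofReal_re]
  have hb : ∀ i k, B.mulVec (ElemState.basis i).ket k = B k i := by
    intro i k
    simp [Matrix.mulVec, dotProduct, ElemState.basis_ket]
  simp_rw [hq, hb]
  rw [Finset.sum_comm]
  refine Finset.sum_le_sum fun k _ => ?_
  have h1 : ‖B.mulVec φ k‖ ≤ ∑ j, ‖B k j‖ * ‖φ j‖ := by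
    change ‖∑ j, B k j * φ j‖ ≤ _
    exact (norm_sum_le _ _).trans (le_of_eq (Finset.sum_congr rfl fun j _ => norm_mul _ _))
  calc ‖B.mulVec φ k‖ ^ 2 ≤ (∑ j, ‖B k j‖ * ‖φ j‖) ^ 2 := by gcongr
    _ ≤ (∑ j, ‖B k j‖ ^ 2) * ∑ j, ‖φ j‖ ^ 2 := Finset.sum_mul_sq_le_sq_mul_sq _ _ _
    _ = ∑ j, ‖B k j‖ ^ 2 := by rw [sum_norm_sq_eq_one hφ, mul_one]

/-- The basis states all have positive probability, so `𝛍` dominates a multiple of the identity. The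
factor may depend on `n`, since it is used only for finiteness. -/
theorem exists_mul_qf_le_univExpect (z n : ℕ) : ∃ c : ℝ≥0∞, c ≠ 0 ∧ ∀ (φ : Qubits n), ‖φ‖ = 1 →
    ∀ A : Matrix (Fin (2 ^ n)) (Fin (2 ^ n)) ℂ, A.PosSemidef →
    c * ENNReal.ofReal (qf A φ) ≤ univExpect z n A := by
  choose c hc hle using exists_uprob_pos
  have : Nonempty (Fin (2 ^ n)) := ⟨⟨0, Nat.two_pow_pos n⟩⟩
  obtain ⟨i₀, hi₀⟩ := Finite.exists_min fun i : Fin (2 ^ n) => c (vecCode (ElemState.basis i).1)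
  refine ⟨c (vecCode (ElemState.basis i₀).1), hc _, fun φ hφ A hA => ?_⟩
  calc c (vecCode (ElemState.basis i₀).1) * ENNReal.ofReal (qf A φ)
      ≤ c (vecCode (ElemState.basis i₀).1) * ∑ i, ENNReal.ofReal (qf A (ElemState.basis i).ket) := by
        gcongr
        rw [← ENNReal.ofReal_sum_of_nonneg fun i _ => qf_nonneg hA _]
        exact ENNReal.ofReal_le_ofReal (qf_le_sum_basis hA hφ)
    _ ≤ ∑ i, uprob z (vecCode (ElemState.basis i).1) n *
          ENNReal.ofReal (qf A (ElemState.basis i).ket) := by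
        rw [Finset.mul_sum]
        exact Finset.sum_le_sum fun i _ => mul_le_mul_left ((hi₀ i).trans (hle _ z n)) _
    _ ≤ univExpect z n A := by
        rw [← tsum_fintype (L := .unconditional _)]
        exact ENNReal.tsum_comp_le_tsum_of_injective ElemState.basis_injective
          fun v : ElemState n => uprob z (vecCode v.1) n * ENNReal.ofReal (qf A v.ket)

/-- The condition on a test bounds its value on product states by `c⁻¹ * c⁻¹`, and the weights of
all programs sum to at most `1`. -/
theorem testTrace_ne_top (z n : ℕ) {φ χ : Qubits n} (hφ : ‖φ‖ = 1) (hχ : ‖χ‖ = 1) :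
    testTrace z n (ketBra φ) (ketBra χ) ≠ ∞ := by
  obtain ⟨c, hc, h⟩ := exists_mul_qf_le_univExpect z n
  have hb : ∀ s : TestProgram z n,
      ENNReal.ofReal (s.1.1.1 * (ketBra φ ⊗ₖ ketBra χ)).trace.re ≤ c⁻¹ * c⁻¹ := by
    rintro ⟨⟨⟨M, ⟨A, B, hA, hB, rfl⟩, -, hM⟩, q⟩, hq⟩
    rw [trace_kronecker_univMatrix_le_one_iff hA hB] at hM
    rw [trace_kronecker_ketBra hA hB, ENNReal.ofReal_mul (qf_nonneg hA _),
      ← ENNReal.mul_inv (.inl hc) (.inr hc), ENNReal.le_inv_iff_mul_le]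
    calc _ = (c * ENNReal.ofReal (qf A φ)) * (c * ENNReal.ofReal (qf B χ)) := by ring
      _ ≤ univExpect z n A * univExpect z n B := by gcongr <;> [exact h φ hφ A hA; exact h χ hχ B hB]
      _ ≤ 1 := hM
  rw [testTrace_eq_tsum]
  refine ne_top_of_le_ne_top (b := 1 * (c⁻¹ * c⁻¹)) ?_ ?_
  · rw [one_mul]
    exact ENNReal.mul_ne_top (ENNReal.inv_ne_top.2 hc) (ENNReal.inv_ne_top.2 hc)
  · refine (ENNReal.tsum_le_tsum fun s => mul_le_mul_right (hb s) _).trans ?_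
    rw [ENNReal.tsum_mul_right]
    exact mul_le_mul_left (tsum_testProgram_le_one z n) _

theorem qf_one {n : ℕ} {φ : Qubits n} (hφ : ‖φ‖ = 1) :
    qf (1 : Matrix (Fin (2 ^ n)) (Fin (2 ^ n)) ℂ) φ = 1 := by
  rw [qf, Matrix.one_mulVec, dotProduct, Complex.re_sum, ← sum_norm_sq_eq_one hφ]
  refine Finset.sum_congr rfl fun k _ => ?_
  rw [Pi.star_apply, Complex.star_def, Complex.mul_conj', ← Complex.ofReal_pow, Complex.ofReal_re]

theorem univExpect_one_le (z n : ℕ) : univExpect z n 1 ≤ 1 := by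
  refine le_trans (le_of_eq (tsum_congr fun v => ?_)) (tsum_uprob_elemState_le_one z n)
  rw [qf_one v.norm_ket, ENNReal.ofReal_one, mul_one]

/-- The elementary identity matrix. -/
def elemOne (d : ℕ) : Matrix (Fin d) (Fin d) GaussRat := Matrix.of fun i j => if i = j then 1 else 0

theorem toComplexMat_elemOne (d : ℕ) : toComplexMat (elemOne d) = 1 := by
  ext i j
  simp only [toComplexMat, elemOne, Matrix.map_apply, Matrix.of_apply, Matrix.one_apply]
  split_ifs <;> simp

theorem exists_lowerComputes_one (z d : ℕ) :
    ∃ q, LowerComputes z q (1 : Matrix (Fin d) (Fin d) ℂ) := by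
  obtain ⟨q, hq⟩ := exists_program_const (matCode (elemOne d))
  obtain ⟨-, hr, he⟩ := hq z 0
  refine ⟨q, hr, fun _ => elemOne d, ⟨_, (he 0 _).2 ⟨rfl, rfl⟩⟩, fun i x h => ((he i x).1 h).2,
    fun _ _ => rfl, fun _ => ?_, fun _ => ?_, ?_⟩
  · rw [toComplexMat_elemOne]; exact Matrix.PosSemidef.one
  · rw [sub_self]; exact Matrix.PosSemidef.zero
  · simp only [toComplexMat_elemOne]; exact tendsto_const_nhds

/-- The identity is a product test with a program of positive probability, and its value on unit
vectors is `1`. -/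
theorem testTrace_ne_zero (z n : ℕ) {φ χ : Qubits n} (hφ : ‖φ‖ = 1) (hχ : ‖χ‖ = 1) :
    testTrace z n (ketBra φ) (ketBra χ) ≠ 0 := by
  obtain ⟨q, hq⟩ := exists_lowerComputes_one z (2 ^ n * 2 ^ n)
  have h1 : (1 : Matrix (Fin (2 ^ n)) (Fin (2 ^ n)) ℂ).PosSemidef := Matrix.PosSemidef.one
  have hflat : flat ((1 : Matrix (Fin (2 ^ n)) (Fin (2 ^ n)) ℂ) ⊗ₖ
      (1 : Matrix (Fin (2 ^ n)) (Fin (2 ^ n)) ℂ)) = 1 := by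
    rw [Matrix.one_kronecker_one]
    simp [flat]
  rw [← hflat] at hq
  have hM : (1 : Matrix (Fin (2 ^ n)) (Fin (2 ^ n)) ℂ) ⊗ₖ (1 : Matrix (Fin (2 ^ n)) (Fin (2 ^ n)) ℂ) ∈
      productTests z n := by
    refine ⟨⟨1, 1, h1, h1, rfl⟩, ⟨q, hq⟩, ?_⟩
    rw [trace_kronecker_univMatrix_le_one_iff h1 h1]
    exact mul_le_one' (univExpect_one_le z n) (univExpect_one_le z n)
  obtain ⟨c, hc, hle⟩ := exists_uprob_pos (Encodable.encode q)
  rw [testTrace_eq_tsum]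
  intro h0
  have := ENNReal.tsum_eq_zero.1 h0 ⟨⟨⟨_, hM⟩, q⟩, hq⟩
  dsimp only at this
  rw [trace_kronecker_ketBra h1 h1, qf_one hφ, qf_one hχ, mul_one, ENNReal.ofReal_one, mul_one] at this
  have h2 := hle z n
  rw [this] at h2
  exact hc (le_antisymm h2 zero_le)

/-- In the constant, `K + 1` keeps the logarithm meaningful when `K = 0`, and the final `1` makes
the inequality strict. That `b` is neither `0` nor `∞` makes the right side real, so the strictness
survives in `EReal`. -/
theorem log_div_lt_of_le_mul {a b K : ℝ≥0∞} (h : a ≤ K * b) (hK : K ≠ ∞) (hb0 : b ≠ 0) (hb : b ≠ ∞) :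
    ENNReal.log a / ((Real.log 2 : ℝ) : EReal) <
      ENNReal.log b / ((Real.log 2 : ℝ) : EReal) +
        ((Real.log (K.toReal + 1) / Real.log 2 + 1 : ℝ) : EReal) := by
  have hlog2 : 0 < Real.log 2 := Real.log_pos one_lt_two
  have hbpos : 0 < b.toReal := ENNReal.toReal_pos hb0 hb
  have hlb : ENNReal.log b = ((Real.log b.toReal : ℝ) : EReal) := ENNReal.log_pos_real hb0 hb
  rcases eq_or_ne a 0 with rfl | ha0
  · rw [ENNReal.log_zero, EReal.bot_div_of_pos_ne_top (by exact_mod_cast hlog2) (EReal.coe_ne_top _),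
      hlb, ← EReal.coe_div, ← EReal.coe_add]
    exact EReal.bot_lt_coe _
  · have ha : a ≠ ∞ := ne_top_of_le_ne_top (ENNReal.mul_ne_top hK hb) h
    have hla : ENNReal.log a = ((Real.log a.toReal : ℝ) : EReal) := ENNReal.log_pos_real ha0 ha
    have hapos : 0 < a.toReal := ENNReal.toReal_pos ha0 ha
    rw [hla, hlb, ← EReal.coe_div, ← EReal.coe_div, ← EReal.coe_add, EReal.coe_lt_coe_iff]
    have hle : a.toReal ≤ (K.toReal + 1) * b.toReal := by
      have := ENNReal.toReal_mono (ENNReal.mul_ne_top hK hb) h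
      rw [ENNReal.toReal_mul] at this
      linarith
    have hK0 : 0 < K.toReal + 1 := by positivity
    have := Real.log_le_log hapos hle
    rw [Real.log_mul hK0.ne' hbpos.ne'] at this
    have h3 : Real.log a.toReal / Real.log 2 ≤
        (Real.log (K.toReal + 1) + Real.log b.toReal) / Real.log 2 := by gcongr
    rw [add_div] at h3
    linarith

end QAIT

theorem theorem12 :
    ∃ c : ℝ, ∀ (n : ℕ)
      (C : Matrix (Fin (2 ^ n) × Fin (2 ^ n)) (Fin (2 ^ n) × Fin (2 ^ n)) QAIT.GaussRat)
      (ψ φ χ : QAIT.Qubits n),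
      QAIT.toComplexMat C ∈ Matrix.unitaryGroup (Fin (2 ^ n) × Fin (2 ^ n)) ℂ →
      ‖ψ‖ = 1 → ‖φ‖ = 1 → ‖χ‖ = 1 →
      (QAIT.toComplexMat C).mulVec (QAIT.tensor ψ (QAIT.ketZero n)) = QAIT.tensor φ χ →
      QAIT.mutualInfo (QAIT.matCode (QAIT.flat C)) n (QAIT.ketBra φ) (QAIT.ketBra χ) <
        QAIT.mutualInfo (QAIT.matCode (QAIT.flat C)) n (QAIT.ketBra ψ) (QAIT.ketBra ψ)
          + (c : EReal) := by
  obtain ⟨K, hK, h⟩ := QAIT.exists_testTrace_le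
  exact ⟨_, fun n C ψ φ χ hC hψ hφ hχ hsplit =>
    QAIT.log_div_lt_of_le_mul (h n C ψ φ χ hC hφ hχ hsplit) hK
      (QAIT.testTrace_ne_zero _ n hψ hψ) (QAIT.testTrace_ne_top _ n hψ hψ)⟩
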